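/- \textbf{Setting.} Let $0\le k<n$, let $W\subseteq\mathbb{R}^n$ be a totally positive subspace of dimension $k+1$ (all Plücker coordinates positive), and let $\mathcal{B}_{n,k,1}(W)=\{V^\perp\cap W : V\in \mathrm{Gr}_{k,n}^{\ge 0}\}\subseteq\mathbb{P}(W)$ be the $m=1$ amplituhedron, where $\mathrm{Gr}_{k,n}^{\ge0}$ is the set of $k$-dimensional subspaces with nonnegative Plücker coordinates. A Le-diagram of type $(k,n)$ is a Young diagram inside a $k\times(n-k)$ rectangle, filled with $0$'s and $+$'s so that no $0$ has both a $+$ above it in its column and a $+$ to its left in its row. Let $\mathcal{D}_{n,k,1}$ (respectively $\overline{\mathcal{D}_{n,k,1}}$) be the set of those whose $k$ rows each contain exactly one (respectively at most one) $+$, every $+$ being at the right end of its row. Label the steps of the southeast border of $D\in\overline{\mathcal{D}_{n,k,1}}$, from the northeast to the southwest corner of the rectangle, by $1,\dots,n$; let $h_1<\dots<h_{n-k}$ be the labels of the horizontal steps and let $C$ be the set of labels of the vertical steps of rows without $+$. Define: \begin{itemize} \item $\sigma(D)\in\{0,+,-\}^n$: start with $+$ in component $1$ and let components $i,i+1$ agree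 if and only if $i$ labels a horizontal step; then set the components in $C$ to $0$; \item the interval partition $[n]=E_1\sqcup\dots\sqcup E_{n-k}$: $E_j=\{h_{j-1}+1,\dots,h_j\}$, except that $E_1$ starts at $1$ and $E_{n-k}$ ends at $n$; and the matroid $M(D)$ on $[n]$, which is the direct sum over $j$ of the matroids on $E_j$ in which the elements of $E_j\cap C$ are coloops and whose restriction to $E_j\setminus C$ is uniform of rank $|E_j\setminus C|-1$; \item the decorated permutation $\pi(D)$: replace each $+$ by an elbow joint and each $0$ by a cross, give opposite edges of the border the same label, and let $\pi(D)(i)$ be the label on the northwest border at which the pipe starting at $i$ on the southeast border ends; a fixed point is white if it labels a vertical step, black if it labels a horizontal step; \item the cell $\mathcal{B}_D(W)=\{\langle w\rangle\in\mathcal{B}_{n,k,1}(W) : \operatorname{sign}(w)=\pm\sigma(D)\}$; its dimension is the number of $+$'s of $D$, and its codimension is $k$ minus this number. \end{itemize} Products of permutations are compositions of maps (the right factor acts first), and $s_j$ is the transposition exchanging $j$ and $j+1$. \textbf{Proposition.} Let $D_1\ne D_2$ be elements of $\mathcal{D}_{n,k,1}$. All fixed points of $\pi(D_1)$ and $\pi(D_2)$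 are black, and the following are equivalent: \begin{enumerate} \item[(i)] $\mathcal{B}_{D_1}(W)$ and $\mathcal{B}_{D_2}(W)$ are adjacent, i.e. $\overline{\mathcal{B}_{D_1}(W)}\cap\overline{\mathcal{B}_{D_2}(W)}=\overline{\mathcal{B}_{D'}(W)}$ for some $D'\in\overline{\mathcal{D}_{n,k,1}}$ whose cell has codimension $1$ (closures taken in $\mathcal{B}_{n,k,1}(W)$); \item[(ii)] the Young diagrams of $D_1$ and $D_2$ differ by a single box; \item[(iii)] there is $2\le i\le n-1$ such that $\sigma(D_1)$ and $\sigma(D_2)$ differ precisely in component $i$; \item[(iv)] there is $2\le i\le n-1$ such that the interval partition for $D_1$ is obtained from that for $D_2$ by moving $i$ from one interval to another; \item[(v)] there is $2\le i\le n-1$ such that $\pi(D_2)=s_{i-1}\pi(D_1)s_i$ (as permutations). \end{enumerate} If they hold, $D'$ in (i) is unique, and for every box $b$ as in (ii) and every $i$ as in (iii), (iv), (v), respectively: \begin{enumerate} \item[(ii$'$)] $D'$ is obtained from whichever of $D_1,D_2$ contains $b$ by deleting $b$ (which contains a $+$), and from the other one by replacing the $+$ at the right end of the row of $b$ by a $0$;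 \item[(iii$'$)] $\sigma(D')$ is obtained from either $\sigma(D_1)$ or $\sigma(D_2)$ by setting component $i$ to $0$; \item[(iv$'$)] $M(D')$ is obtained from either $M(D_1)$ or $M(D_2)$ by turning $i$ into a coloop (deleting all bases not containing $i$); \item[(v$'$)] $\pi(D_1)s_i=s_{i-1}\pi(D_2)$ and $s_{i-1}\pi(D_1)=\pi(D_2)s_i$; exactly one of these two permutations has exactly $k-1$ inversions, and it is the permutation underlying $\pi(D')$, in which $i$ is the only white fixed point. \end{enumerate} -/

import Mathlib

open scoped LinearAlgebra.Projectivization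

/-! ### Le-diagrams

The set `[n] = {1, …, n}` is modelled by `Fin n`; the index `i : Fin n` stands for the label
`i + 1`. Rows are counted from the top and columns from the left, both starting from `0`. -/

/-- A Le-diagram of type `(k, n)`: a Young diagram inside a `k × (n - k)` rectangle, whose boxes
are filled with `0`'s and `+`'s, such that there is no `0` with a `+` above it in the same column
and a `+` to its left in the same row. -/
@[ext]
structure LeDiagram (k n : ℕ) where
  /-- the Young diagram, in English notation; `(r, c)` is the box in row `r` and column `c` -/
  shape : YoungDiagram
  /-- the set of boxes containing a `+`; all other boxes of the diagram contain a `0` -/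
  plus : Finset (ℕ × ℕ)
  k_le_n : k ≤ n
  shape_le : ∀ b ∈ shape, b.1 < k ∧ b.2 < n - k
  plus_subset : plus ⊆ shape.cells
  le_property : ∀ r c, (r, c) ∈ shape → (∃ r' < r, (r', c) ∈ plus) →
    (∃ c' < c, (r, c') ∈ plus) → (r, c) ∈ plus

namespace LeDiagram

variable {k n : ℕ} (D : LeDiagram k n)

/-- every `+` is at the right end of its row -/
def PlusAtRightEnd : Prop := ∀ r c, (r, c) ∈ D.plus → c + 1 = D.shape.rowLen r

/-- `D ∈ 𝒟_{n,k,1}`: each of the `k` rows has precisely one `+`, which is at its right end. -/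
def IsMaximal : Prop :=
  (∀ r < k, (D.plus.filter fun b => b.1 = r).card = 1) ∧ D.PlusAtRightEnd

/-- `D` is in the closure of `𝒟_{n,k,1}`: each row has at most one `+`, which is at its right
end. -/
def InClosure : Prop :=
  (∀ r < k, (D.plus.filter fun b => b.1 = r).card ≤ 1) ∧ D.PlusAtRightEnd

/-- The dimension of the cell of `D`, for `D` in the closure of `𝒟_{n,k,1}`: the number
of `+`'s. -/
def dim : ℕ := D.plus.card

/-- row `r` contains no `+` -/
def IsZeroRow (r : ℕ) : Prop := ∀ c, (r, c) ∉ D.plus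

/-! ### Labels of the southeast border -/

theorem rowLen_le (r : ℕ) : D.shape.rowLen r ≤ n - k := by
  by_contra h
  have := (D.shape_le (r, n - k) (YoungDiagram.mem_iff_lt_rowLen.2 (by omega))).2
  simp at this

theorem colLen_le (c : ℕ) : D.shape.colLen c ≤ k := by
  by_contra h
  have := (D.shape_le (k, c) (YoungDiagram.mem_iff_lt_colLen.2 (by omega))).1
  simp at this

/-- The label of the vertical step of the southeast border in row `r`. Walking from the northeast
corner of the rectangle, it comes after `r` vertical and `(n - k) - rowLen r` horizontal steps. -/
def vLabel (r : Fin k) : Fin n :=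
  ⟨r + (n - k - D.shape.rowLen r), by have := D.k_le_n; have := r.2; omega⟩

/-- The label of the horizontal step of the southeast border in column `c`. Walking from the
northeast corner of the rectangle, it comes after `colLen c` vertical and `(n - k) - 1 - c`
horizontal steps. -/
def hLabel (c : Fin (n - k)) : Fin n :=
  ⟨D.shape.colLen c + (n - k - 1 - c), by
    have := D.colLen_le c; have := D.k_le_n; have := c.2; omega⟩

/-- The label of the step of the southeast border in a given row (vertical step) or column
(horizontal step). -/
def stepLabel : Fin k ⊕ Fin (n - k) → Fin n := Sum.elim D.vLabel D.hLabel

theorem vLabel_ne_hLabel (r : Fin k) (c : Fin (n - k)) : D.vLabel r ≠ D.hLabel c := by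
  intro h
  have h' := congrArg Fin.val h
  simp only [vLabel, hLabel] at h'
  have h1 := D.rowLen_le r
  have h2 := D.colLen_le c
  have h3 : (c : ℕ) < D.shape.rowLen r ↔ (r : ℕ) < D.shape.colLen c :=
    YoungDiagram.mem_iff_lt_rowLen.symm.trans YoungDiagram.mem_iff_lt_colLen
  have := c.2
  omega

theorem vLabel_injective : Function.Injective D.vLabel := by
  intro r s h
  have h' := congrArg Fin.val h
  simp only [vLabel] at h'
  have h1 := D.rowLen_le r
  have h2 := D.rowLen_le s
  rcases lt_trichotomy (r : ℕ) s with hl | hl | hl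
  · have := D.shape.rowLen_anti r s hl.le; omega
  · exact Fin.ext hl
  · have := D.shape.rowLen_anti s r hl.le; omega

theorem hLabel_strictAnti : StrictAnti D.hLabel := by
  intro c d h
  have h0 : (c : ℕ) < d := h
  have h1 := D.shape.colLen_anti c d h0.le
  have := d.2
  change D.shape.colLen d + (n - k - 1 - d) < D.shape.colLen c + (n - k - 1 - c)
  omega

theorem stepLabel_bijective : Function.Bijective D.stepLabel := by
  have hinj : Function.Injective D.stepLabel :=
    D.vLabel_injective.sumElim D.hLabel_strictAnti.injective D.vLabel_ne_hLabel
  refine (Fintype.bijective_iff_injective_and_card _).2 ⟨hinj, ?_⟩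
  have := D.k_le_n
  simp
  omega

/-- The labelling of the steps of the southeast border by `[n]`. -/
noncomputable def stepEquiv : Fin k ⊕ Fin (n - k) ≃ Fin n :=
  Equiv.ofBijective D.stepLabel D.stepLabel_bijective

/-! ### The sign vector -/

/-- The sign vector of the Young diagram: it starts with `+`, and two consecutive components
`i`, `i + 1` agree if and only if `i` labels a horizontal step. -/
def signHat : ℕ → SignType
  | 0 => 1
  | i + 1 => if ∃ c, (D.hLabel c : ℕ) = i then signHat i else -signHat i

open Classical in
/-- The sign vector `σ(D)`: the sign vector of the Young diagram of `D`, with the components that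
label the (vertical steps of the) rows without `+` set to `0`. -/
noncomputable def sigma (i : Fin n) : SignType :=
  if ∃ r, D.vLabel r = i ∧ D.IsZeroRow r then 0 else D.signHat i

/-! ### The interval partition and the matroid -/

/-- The interval `E_{j+1} = {h_j + 1, …, h_{j+1}}`, where `h_1 < ⋯ < h_{n-k}` are the labels of the
horizontal steps; the first interval starts at `1` and the last one ends at `n`.
The label `h_{j+1}` belongs to column `n - k - 1 - j`. -/
def block (j : Fin (n - k)) : Set (Fin n) :=
  {i | (∀ j' : Fin (n - k), (j' : ℕ) + 1 = j → D.hLabel j'.rev < i) ∧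
    (i ≤ D.hLabel j.rev ∨ (j : ℕ) + 1 = n - k)}

/-- The set `C` of labels of the vertical steps of rows without `+`. -/
def coloopSet : Set (Fin n) := {i | ∃ r, D.vLabel r = i ∧ D.IsZeroRow r}

theorem block_disjoint_of_lt {i j : Fin (n - k)} (h : i < j) :
    Disjoint (D.block i) (D.block j) := by
  rw [Set.disjoint_left]
  rintro x ⟨-, hx⟩ ⟨hx', -⟩
  have h0 : (i : ℕ) < j := h
  have hj := j.2
  have h1 := hx' ⟨(j : ℕ) - 1, by omega⟩ (by simp only; omega)
  rcases hx with hx | hx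
  · have h2 : D.hLabel i.rev ≤ D.hLabel (Fin.rev ⟨(j : ℕ) - 1, by omega⟩) := by
      apply D.hLabel_strictAnti.antitone
      rw [Fin.rev_le_rev, Fin.le_def]
      simp only
      omega
    exact absurd (lt_of_le_of_lt h2 h1) (not_lt.2 hx)
  · omega

theorem block_disjoint : Pairwise (Function.onFun Disjoint D.block) := by
  intro i j hij
  rcases lt_or_gt_of_ne hij with h | h
  · exact D.block_disjoint_of_lt h
  · exact (D.block_disjoint_of_lt h).symm

end LeDiagram

/-- The uniform matroid of rank `r` on a subset `E` of `Fin n`: the bases are the `r`-element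
subsets of `E`. -/
def uniformMatroid {n : ℕ} (E : Set (Fin n)) (r : ℕ) (hr : r ≤ E.ncard) : Matroid (Fin n) :=
  Matroid.ofIsBaseOfFinite (E := E) E.toFinite (fun B => B ⊆ E ∧ B.ncard = r)
    (by
      obtain ⟨B, hB, hc⟩ := Set.exists_subset_card_eq hr
      exact ⟨B, hB, hc⟩)
    (by
      rintro X Y ⟨hX, hXc⟩ ⟨hY, hYc⟩ a ha
      have hne : (Y \ X).Nonempty := by
        rw [Set.nonempty_iff_ne_empty, Ne, Set.sdiff_eq_empty]
        intro hYX
        have : Y = X := Set.eq_of_subset_of_ncard_le hYX (by omega)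
        exact ha.2 (this ▸ ha.1)
      obtain ⟨b, hb⟩ := hne
      refine ⟨b, hb, Set.insert_subset (hY hb.1) (Set.sdiff_subset.trans hX), ?_⟩
      rw [Set.ncard_exchange hb.2 ha.1, hXc])
    (fun B hB => hB.1)

namespace LeDiagram

variable {k n : ℕ} (D : LeDiagram k n)

/-- The `j`-th summand of the matroid of `D`: on the interval `E_j`, the elements of `C` are
coloops, and the restriction to `E_j \ C` is uniform of rank `|E_j \ C| - 1`
(here `E_j \ C` is never empty). -/
noncomputable def summand (j : Fin (n - k)) : Matroid (Fin n) :=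
  (Matroid.freeOn (D.block j ∩ D.coloopSet)).disjointSum
    (uniformMatroid (D.block j \ D.coloopSet) ((D.block j \ D.coloopSet).ncard - 1)
      (Nat.sub_le _ _))
    (Set.disjoint_sdiff_right.mono_left Set.inter_subset_right)

theorem summand_ground (j : Fin (n - k)) : (D.summand j).E = D.block j := by
  unfold summand
  rw [Matroid.disjointSum_ground_eq]
  exact Set.inter_union_sdiff _ _

/-- The matroid `M(D)` on `[n]`, for `D` in the closure of `𝒟_{n,k,1}`. -/
noncomputable def matroid : Matroid (Fin n) :=
  Matroid.disjointSigma D.summand (by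
    intro i j hij
    simpa only [Function.onFun, D.summand_ground] using D.block_disjoint hij)

end LeDiagram

/-- `M'` is obtained from `M` by turning `i` into a coloop: the bases of `M` not containing `i` are
deleted. -/
def TurnsIntoColoop {n : ℕ} (M M' : Matroid (Fin n)) (i : Fin n) : Prop :=
  M'.E = M.E ∧ ∀ B, M'.IsBase B ↔ M.IsBase B ∧ i ∈ B

/-- The family of blocks `E` is obtained from the family of blocks `F` by moving `i` from one block
to another one. -/
def IsMove {n m : ℕ} (F E : Fin m → Set (Fin n)) (i : Fin n) : Prop :=
  ∃ a b, a ≠ b ∧ i ∈ F a ∧ E a = F a \ {i} ∧ E b = F b ∪ {i} ∧ ∀ c, c ≠ a → c ≠ b → E c = F c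

/-! ### Decorated permutations and pipe dreams -/

/-- A decorated permutation: a permutation whose fixed points are coloured black or white. -/
@[ext]
structure DecoratedPerm (n : ℕ) where
  perm : Equiv.Perm (Fin n)
  /-- the white fixed points; all other fixed points are black -/
  white : Set (Fin n)
  white_fixed : ∀ i ∈ white, perm i = i

/-- The edges of the `k × m` grid of boxes. Box `(r, c)` has the left edge `inl (r, c)`, the right
edge `inl (r, c + 1)`, the top edge `inr (r, c)` and the bottom edge `inr (r + 1, c)`. -/
abbrev GridEdge (k m : ℕ) := (Fin k × Fin (m + 1)) ⊕ (Fin (k + 1) × Fin m)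

namespace LeDiagram

variable {k n : ℕ} (D : LeDiagram k n)

/-- One step of a pipe through the box to the left of a vertical edge, or above a horizontal edge:
in a box with a `+` (elbow joint) the pipe turns, from the right edge to the top edge or from the
bottom edge to the left edge; in a box with a `0` (cross) it goes straight on. On the left and top
border of the rectangle the pipe stays where it is. -/
def pipeStep : GridEdge k (n - k) → GridEdge k (n - k)
  | Sum.inl (r, ⟨0, h⟩) => Sum.inl (r, ⟨0, h⟩)
  | Sum.inl (r, ⟨c + 1, h⟩) =>
      if ((r : ℕ), c) ∈ D.plus then Sum.inr (r.castSucc, ⟨c, by omega⟩)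
      else Sum.inl (r, ⟨c, by omega⟩)
  | Sum.inr (⟨0, h⟩, c) => Sum.inr (⟨0, h⟩, c)
  | Sum.inr (⟨r + 1, h⟩, c) =>
      if (r, (c : ℕ)) ∈ D.plus then Sum.inl (⟨r, by omega⟩, c.castSucc)
      else Sum.inr (⟨r, by omega⟩, c)

/-- The step of the southeast border in a given row or column, as an edge of the grid. -/
def borderEdge : Fin k ⊕ Fin (n - k) → GridEdge k (n - k) :=
  Sum.map (fun r => (r, ⟨D.shape.rowLen r, Nat.lt_succ_of_le (D.rowLen_le r)⟩))
    (fun c => (⟨D.shape.colLen c, Nat.lt_succ_of_le (D.colLen_le c)⟩, c))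

/-- The row of a vertical edge, the column of a horizontal edge. -/
def edgeLine {k m : ℕ} : GridEdge k m → Fin k ⊕ Fin m := Sum.map Prod.fst Prod.snd

/-- Follow the pipe from a step of the southeast border to the northwest border (`n` steps are
enough to get there), and return the row or column in which it ends. -/
def pipe (e : Fin k ⊕ Fin (n - k)) : Fin k ⊕ Fin (n - k) :=
  edgeLine (D.pipeStep^[n] (D.borderEdge e))

/-- One step of a pipe in the reverse direction. -/
def pipePrev : GridEdge k (n - k) → GridEdge k (n - k)
  | Sum.inl (r, c) =>
      if h : (c : ℕ) < D.shape.rowLen r then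
        if ((r : ℕ), (c : ℕ)) ∈ D.plus then
          Sum.inr (r.succ, ⟨c, lt_of_lt_of_le h (D.rowLen_le r)⟩)
        else Sum.inl (r, ⟨c + 1, Nat.succ_lt_succ (lt_of_lt_of_le h (D.rowLen_le r))⟩)
      else Sum.inl (r, c)
  | Sum.inr (r, c) =>
      if h : (r : ℕ) < D.shape.colLen c then
        if ((r : ℕ), (c : ℕ)) ∈ D.plus then
          Sum.inl (⟨r, lt_of_lt_of_le h (D.colLen_le c)⟩, c.succ)
        else Sum.inr (⟨r + 1, Nat.succ_lt_succ (lt_of_lt_of_le h (D.colLen_le c))⟩, c)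
      else Sum.inr (r, c)

/-- the edges of the boxes of the Young diagram -/
def EdgeInside : GridEdge k (n - k) → Prop
  | Sum.inl (r, c) => (c : ℕ) ≤ D.shape.rowLen r
  | Sum.inr (r, c) => (r : ℕ) ≤ D.shape.colLen c

/-- the sum of the coordinates of an edge -/
def edgeHeight {k m : ℕ} : GridEdge k m → ℕ
  | Sum.inl (r, c) => r + c
  | Sum.inr (r, c) => r + c

theorem lt_rowLen_iff_lt_colLen (r c : ℕ) : c < D.shape.rowLen r ↔ r < D.shape.colLen c :=
  YoungDiagram.mem_iff_lt_rowLen.symm.trans YoungDiagram.mem_iff_lt_colLen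

theorem edgeInside_pipeStep (s : GridEdge k (n - k)) (hs : D.EdgeInside s) :
    D.EdgeInside (D.pipeStep s) := by
  rcases s with ⟨r, ⟨_ | c, h⟩⟩ | ⟨⟨_ | r, h⟩, c⟩
  · exact hs
  · have h1 : c < D.shape.rowLen r := hs
    have h2 := (D.lt_rowLen_iff_lt_colLen r c).1 h1
    simp only [pipeStep]
    split_ifs
    · exact h2.le
    · exact h1.le
  · exact hs
  · have h1 : r < D.shape.colLen c := hs
    have h2 := (D.lt_rowLen_iff_lt_colLen r c).2 h1
    simp only [pipeStep]
    split_ifs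
    · exact h2.le
    · exact h1.le

theorem pipePrev_pipeStep (s : GridEdge k (n - k)) (hs : D.EdgeInside s)
    (hne : D.pipeStep s ≠ s) : D.pipePrev (D.pipeStep s) = s := by
  rcases s with ⟨r, ⟨_ | c, h⟩⟩ | ⟨⟨_ | r, h⟩, c⟩
  · exact absurd rfl hne
  · have h1 : c < D.shape.rowLen r := hs
    have h2 := (D.lt_rowLen_iff_lt_colLen r c).1 h1
    by_cases hp : ((r : ℕ), c) ∈ D.plus
    · simp [pipeStep, pipePrev, hp, h2]
    · simp [pipeStep, pipePrev, hp, h1]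
  · exact absurd rfl hne
  · have h1 : r < D.shape.colLen c := hs
    have h2 := (D.lt_rowLen_iff_lt_colLen r c).2 h1
    by_cases hp : (r, (c : ℕ)) ∈ D.plus
    · simp [pipeStep, pipePrev, hp, h2]
    · simp [pipeStep, pipePrev, hp, h1]

theorem edgeHeight_pipeStep (s : GridEdge k (n - k)) :
    D.pipeStep s = s ∨ edgeHeight (D.pipeStep s) + 1 = edgeHeight s := by
  rcases s with ⟨r, ⟨_ | c, h⟩⟩ | ⟨⟨_ | r, h⟩, c⟩
  · exact Or.inl rfl
  · right
    simp only [pipeStep]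
    split_ifs <;> simp only [edgeHeight, Fin.val_castSucc] <;> omega
  · exact Or.inl rfl
  · right
    simp only [pipeStep]
    split_ifs <;> simp only [edgeHeight, Fin.val_castSucc] <;> omega

theorem pipeStep_iterate_fixed (m : ℕ) (s : GridEdge k (n - k)) (hs : edgeHeight s ≤ m) :
    D.pipeStep (D.pipeStep^[m] s) = D.pipeStep^[m] s := by
  induction m generalizing s with
  | zero =>
    rcases D.edgeHeight_pipeStep s with h | h
    · exact h
    · omega
  | succ m ih =>
    rw [Function.iterate_succ_apply]
    rcases D.edgeHeight_pipeStep s with h | h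
    · rw [h, Function.iterate_fixed h, h]
    · exact ih _ (by omega)

theorem edgeLine_injOn_fixed (s t : GridEdge k (n - k)) (hs : D.pipeStep s = s)
    (ht : D.pipeStep t = t) (h : edgeLine s = edgeLine t) : s = t := by
  have key : ∀ s : GridEdge k (n - k), D.pipeStep s = s →
      s = Sum.map (fun r => (r, 0)) (fun c => (0, c)) (edgeLine s) := by
    intro s hs
    rcases s with ⟨r, ⟨_ | c, h⟩⟩ | ⟨⟨_ | r, h⟩, c⟩
    · rfl
    · exfalso
      have h1 := congrArg edgeHeight hs
      simp only [pipeStep] at h1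
      split_ifs at h1 <;> simp only [edgeHeight, Fin.val_castSucc] at h1 <;> omega
    · rfl
    · exfalso
      have h1 := congrArg edgeHeight hs
      simp only [pipeStep] at h1
      split_ifs at h1 <;> simp only [edgeHeight, Fin.val_castSucc] at h1 <;> omega
  rw [key s hs, key t ht, h]

theorem exists_pipePrev_iterate (m : ℕ) (s : GridEdge k (n - k)) (hs : D.EdgeInside s) :
    D.EdgeInside (D.pipeStep^[m] s) ∧ ∃ l, D.pipePrev^[l] (D.pipeStep^[m] s) = s := by
  induction m with
  | zero => exact ⟨hs, 0, rfl⟩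
  | succ m ih =>
    obtain ⟨h1, l, hl⟩ := ih
    rw [Function.iterate_succ_apply']
    refine ⟨D.edgeInside_pipeStep _ h1, ?_⟩
    by_cases hne : D.pipeStep (D.pipeStep^[m] s) = D.pipeStep^[m] s
    · exact ⟨l, by rw [hne, hl]⟩
    · exact ⟨l + 1, by rw [Function.iterate_succ_apply, D.pipePrev_pipeStep _ h1 hne, hl]⟩

theorem edgeInside_borderEdge (e : Fin k ⊕ Fin (n - k)) : D.EdgeInside (D.borderEdge e) := by
  rcases e with r | c
  · exact le_rfl
  · exact le_rfl

theorem pipePrev_borderEdge (e : Fin k ⊕ Fin (n - k)) :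
    D.pipePrev (D.borderEdge e) = D.borderEdge e := by
  rcases e with r | c <;> simp [borderEdge, pipePrev]

theorem edgeLine_borderEdge (e : Fin k ⊕ Fin (n - k)) : edgeLine (D.borderEdge e) = e := by
  rcases e with r | c <;> rfl

theorem edgeHeight_borderEdge (e : Fin k ⊕ Fin (n - k)) : edgeHeight (D.borderEdge e) ≤ n := by
  have := D.k_le_n
  rcases e with r | c
  · have := D.rowLen_le r
    have := r.2
    simp only [borderEdge, Sum.map_inl, edgeHeight]
    omega
  · have := D.colLen_le c
    have := c.2
    simp only [borderEdge, Sum.map_inr, edgeHeight]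
    omega

theorem pipe_bijective : Function.Bijective D.pipe := by
  apply Finite.injective_iff_bijective.1
  intro e f h
  have hx : D.pipeStep^[n] (D.borderEdge e) = D.pipeStep^[n] (D.borderEdge f) :=
    D.edgeLine_injOn_fixed _ _ (D.pipeStep_iterate_fixed n _ (D.edgeHeight_borderEdge e))
      (D.pipeStep_iterate_fixed n _ (D.edgeHeight_borderEdge f)) h
  obtain ⟨-, a, ha⟩ := D.exists_pipePrev_iterate n _ (D.edgeInside_borderEdge e)
  obtain ⟨-, b, hb⟩ := D.exists_pipePrev_iterate n _ (D.edgeInside_borderEdge f)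
  rw [← hx] at hb
  have key : D.borderEdge e = D.borderEdge f := by
    rcases le_total a b with hab | hab
    · obtain ⟨d, rfl⟩ := Nat.exists_eq_add_of_le' hab
      rw [Function.iterate_add_apply, ha, Function.iterate_fixed (D.pipePrev_borderEdge e)] at hb
      exact hb
    · obtain ⟨d, rfl⟩ := Nat.exists_eq_add_of_le' hab
      rw [Function.iterate_add_apply, hb, Function.iterate_fixed (D.pipePrev_borderEdge f)] at ha
      exact ha.symm
  rw [← D.edgeLine_borderEdge e, key, D.edgeLine_borderEdge]

/-- The decorated permutation `π(D)`: the pipe starting at label `i` of the southeast border ends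
at label `π(i)`, where opposite edges of the border have the same label. A fixed point is white
if it labels a vertical step, and black if it labels a horizontal step. -/
noncomputable def decoratedPerm : DecoratedPerm n where
  perm := (D.stepEquiv.symm.trans (Equiv.ofBijective D.pipe D.pipe_bijective)).trans D.stepEquiv
  white := {i | (∃ r, D.vLabel r = i) ∧
    ((D.stepEquiv.symm.trans (Equiv.ofBijective D.pipe D.pipe_bijective)).trans D.stepEquiv) i = i}
  white_fixed := fun _ hi => hi.2

end LeDiagram

/-- The transposition exchanging `a` and `a + 1` in `Fin n` (that is, the labels `a + 1` and
`a + 2`). -/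
def adjSwap (n a : ℕ) : Equiv.Perm (Fin n) :=
  if h : a + 1 < n then Equiv.swap ⟨a, by omega⟩ ⟨a + 1, h⟩ else 1

/-- the number of inversions of a permutation -/
def inversions {n : ℕ} (p : Equiv.Perm (Fin n)) : ℕ :=
  (Finset.univ.filter fun x : Fin n × Fin n => x.1 < x.2 ∧ p x.2 < p x.1).card

/-! ### The amplituhedron for `m = 1` and its cells -/

/-- `V` is the row span of the `r × n` matrix `A`. -/
def IsRowSpan {r n : ℕ} (A : Matrix (Fin r) (Fin n) ℝ)
    (V : Submodule ℝ (EuclideanSpace ℝ (Fin n))) : Prop :=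
  Submodule.span ℝ (Set.range fun i => WithLp.toLp 2 (A i)) = V

/-- `V` belongs to the totally nonnegative Grassmannian: it is an `r`-dimensional subspace of `ℝⁿ`
whose Plücker coordinates are nonnegative (for a suitable choice of the matrix representing it). -/
def IsTotallyNonneg {n : ℕ} (r : ℕ) (V : Submodule ℝ (EuclideanSpace ℝ (Fin n))) : Prop :=
  Module.finrank ℝ V = r ∧ ∃ A : Matrix (Fin r) (Fin n) ℝ, IsRowSpan A V ∧
    ∀ I : Fin r ↪o Fin n, 0 ≤ (A.submatrix id I).det

/-- `V` belongs to the totally positive Grassmannian: it is an `r`-dimensional subspace of `ℝⁿ`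
whose Plücker coordinates are positive (for a suitable choice of the matrix representing it). -/
def IsTotallyPositive {n : ℕ} (r : ℕ) (V : Submodule ℝ (EuclideanSpace ℝ (Fin n))) : Prop :=
  Module.finrank ℝ V = r ∧ ∃ A : Matrix (Fin r) (Fin n) ℝ, IsRowSpan A V ∧
    ∀ I : Fin r ↪o Fin n, 0 < (A.submatrix id I).det

/-- The quotient topology on the projective space of a topological vector space. -/
noncomputable instance projectivizationTopology {E : Type*} [AddCommGroup E] [Module ℝ E] [TopologicalSpace E] :
    TopologicalSpace (ℙ ℝ E) :=
  TopologicalSpace.coinduced (Projectivization.mk' ℝ) inferInstance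

/-- The amplituhedron `ℬ_{n,k,1}(W) = {Vᗮ ∩ W : V ∈ Gr_{k,n}^{≥0}}`, a set of lines in `W`. -/
def amplituhedron {n : ℕ} (k : ℕ) (W : Submodule ℝ (EuclideanSpace ℝ (Fin n))) :
    Set (ℙ ℝ (EuclideanSpace ℝ (Fin n))) :=
  {x | ∃ V, IsTotallyNonneg k V ∧ x.submodule = Vᗮ ⊓ W}

/-- The cell `ℬ_D(W)` of the amplituhedron: the lines spanned by a nonzero vector `w ∈ W` with
sign vector `± σ(D)` (that is, lines having a spanning vector with sign vector `σ(D)`). -/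
def cell {n k : ℕ} (W : Submodule ℝ (EuclideanSpace ℝ (Fin n))) (D : LeDiagram k n) :
    Set (amplituhedron k W) :=
  {x | ∃ (w : EuclideanSpace ℝ (Fin n)) (hw : w ≠ 0), w ∈ W ∧
    (x : ℙ ℝ (EuclideanSpace ℝ (Fin n))) = Projectivization.mk ℝ w hw ∧
    ∀ i, SignType.sign (w i) = D.sigma i}

/-- The closures of the cells of `D₁` and `D₂` intersect in (the closure of) the cell of `D'`,
which has codimension `1` in the `k`-dimensional amplituhedron. -/
def MeetAlong {n k : ℕ} (W : Submodule ℝ (EuclideanSpace ℝ (Fin n))) (D₁ D₂ D' : LeDiagram k n) :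
    Prop :=
  D'.InClosure ∧ D'.dim + 1 = k ∧
    closure (cell W D₁) ∩ closure (cell W D₂) = closure (cell W D')

/-- Adjacency of the cells of `D₁` and `D₂`. -/
def CellsAdjacent {n k : ℕ} (W : Submodule ℝ (EuclideanSpace ℝ (Fin n)))
    (D₁ D₂ : LeDiagram k n) : Prop :=
  ∃ D', MeetAlong W D₁ D₂ D'

/-- The label of `i` lies in `{2, …, n - 1}`. -/
def IsInner {n : ℕ} (i : Fin n) : Prop := 0 < (i : ℕ) ∧ (i : ℕ) + 1 < n

/-- The label `i` witnesses that the sign vectors of `D₁` and `D₂` differ precisely at `i`. -/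
def SignsDifferAt {n k : ℕ} (D₁ D₂ : LeDiagram k n) (i : Fin n) : Prop :=
  IsInner i ∧ ∀ j, D₁.sigma j ≠ D₂.sigma j ↔ j = i

/-- The interval partition of `D₁` is obtained from that of `D₂` by moving `i` from one interval
to another one. -/
def PartitionsDifferAt {n k : ℕ} (D₁ D₂ : LeDiagram k n) (i : Fin n) : Prop :=
  IsInner i ∧ IsMove D₂.block D₁.block i

/-- `π(D₂) = s_{i-1} π(D₁) s_i` -/
def PermsDifferAt {n k : ℕ} (D₁ D₂ : LeDiagram k n) (i : Fin n) : Prop :=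
  IsInner i ∧ D₂.decoratedPerm.perm = adjSwap n (i - 1) * D₁.decoratedPerm.perm * adjSwap n i

/-- The Young diagrams of `D₁` and `D₂` differ by the single box `b`. -/
def ShapesDifferBy {n k : ℕ} (D₁ D₂ : LeDiagram k n) (b : ℕ × ℕ) : Prop :=
  symmDiff D₁.shape.cells D₂.shape.cells = {b}

/-- If the Young diagram of `D` contains the box `b`, then `D'` is obtained from `D` by deleting
the box `b`, which contains a `+`. Otherwise `D'` is obtained from `D` by replacing the `+` at the
right end of the row of `b` by a `0`. -/
def IsFacetBy {n k : ℕ} (D D' : LeDiagram k n) (b : ℕ × ℕ) : Prop :=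
  (b ∈ D.shape → D'.shape.cells = D.shape.cells.erase b ∧ b ∈ D.plus ∧
    D'.plus = D.plus.erase b) ∧
  (b ∉ D.shape → D'.shape = D.shape ∧ (b.1, D.shape.rowLen b.1 - 1) ∈ D.plus ∧
    D'.plus = D.plus.erase (b.1, D.shape.rowLen b.1 - 1))

/-! Labels start from `0` here. Everything reduces to one relation, `Shift D E i`: the two southeast
borders agree except that a horizontal step followed by a vertical one, labelled `i - 1` and `i` in
`D`, are interchanged in `E`. A maximal diagram is determined by its set `hor` of horizontal labels,
and each encoding detects whether a label `x` before the last one is horizontal: the signs at `x`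
and `x + 1` agree, or `x` and `x + 1` lie in different intervals, or `π(x + 1) ≠ x`. The last label
is always horizontal, and all sets `hor` have `n - k` elements; so two distinct ones that differ at
most at `i - 1` and `i` are related by a shift (`shift_or_shift`). Hence each of (iii), (iv), (v)
for a given `i` amounts to a shift at `i` in one direction or the other, and adding one box amounts
to a shift at some `i`.

On each interval `π` of a maximal diagram is a cycle: the first element goes to the last, every
other one to its predecessor. A shift from `D` to `E` moves `i` from the beginning of one cycle to
the end of the preceding one. The common facet `F` is `D` with the `+` of the row labelled `i`
replaced by a `0` (`IsFacetAt`); in it `i` becomes a zero, a coloop and a white fixed point.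

For the geometry, total positivity of `W` says that a nonzero vector of `W` cannot alternate weakly
in sign on `k + 2` coordinates (`eq_zero_of_alternating`). Applied to vectors that alternate on each
interval (`mul_neg_of_blocks`), together with explicit totally nonnegative subspaces whose spanning
rows have at most two nonzero entries (`network`), this shows that every `σ(D)` occurs in `W` and
that every vector of `W` with these signs spans a point of the amplituhedron. Therefore the closure
of a cell consists of the lines spanned by vectors whose nonzero components have the signs of `σ(D)`
(`mem_closure_cell_iff`).

If `D` and `E` are related by a shift, their sign vectors differ only at `i`, and a line in both
closures must have `i`-th component zero (`Shift.meetAlong`). Conversely, a vector in a common cell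
of codimension one vanishes at a single `i` and has elsewhere, up to a global sign, the signs of
both diagrams; so the borders differ at most at `i - 1` and `i` (`MeetAlong.exists_shift`). -/

namespace LeDiagram

variable {k n : ℕ} (D : LeDiagram k n)

/-! ### Horizontal labels -/

/-- The set of labels of the horizontal steps. -/
def hor : Set ℕ := {x | ∃ c, (D.hLabel c : ℕ) = x}

/-- The number of horizontal steps with a label less than `x`. -/
def horCount (x : ℕ) : ℕ := (Finset.univ.filter fun c => (D.hLabel c : ℕ) < x).card

theorem hLabel_mem_hor (c : Fin (n - k)) : (D.hLabel c : ℕ) ∈ D.hor := ⟨c, rfl⟩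

theorem lt_of_mem_hor {x : ℕ} (hx : x ∈ D.hor) : x < n := by
  obtain ⟨c, rfl⟩ := hx
  exact (D.hLabel c).2

theorem vLabel_notMem_hor (r : Fin k) : (D.vLabel r : ℕ) ∉ D.hor := by
  rintro ⟨c, hc⟩
  exact D.vLabel_ne_hLabel r c (Fin.ext hc.symm)

theorem exists_vLabel_eq {x : Fin n} (hx : (x : ℕ) ∉ D.hor) : ∃ r, D.vLabel r = x := by
  obtain ⟨r | c, h⟩ := D.stepLabel_bijective.2 x
  · exact ⟨r, h⟩
  · exact absurd ⟨c, congrArg Fin.val h⟩ hx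

theorem horCount_zero : D.horCount 0 = 0 := by simp [horCount]

theorem horCount_le (x : ℕ) : D.horCount x ≤ n - k :=
  (Finset.card_filter_le _ _).trans (by simp)

theorem horCount_mono : Monotone D.horCount := by
  intro x y hxy
  refine Finset.card_le_card fun c => ?_
  simp only [Finset.mem_filter, Finset.mem_univ, true_and]
  omega

theorem horCount_top : D.horCount n = n - k := by
  simp [horCount]

theorem horCount_succ_of_mem {x : ℕ} (hx : x ∈ D.hor) :
    D.horCount (x + 1) = D.horCount x + 1 := by
  obtain ⟨c, rfl⟩ := hx
  have : (Finset.univ.filter fun d => (D.hLabel d : ℕ) < D.hLabel c + 1) =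
      insert c (Finset.univ.filter fun d => (D.hLabel d : ℕ) < D.hLabel c) := by
    ext d
    simp only [Finset.mem_filter, Finset.mem_univ, true_and, Finset.mem_insert]
    rw [Nat.lt_succ_iff_lt_or_eq, or_comm, ← Fin.ext_iff, D.hLabel_strictAnti.injective.eq_iff]
  rw [horCount, this, Finset.card_insert_of_notMem (by simp), horCount]

theorem horCount_succ_of_notMem {x : ℕ} (hx : x ∉ D.hor) :
    D.horCount (x + 1) = D.horCount x := by
  unfold horCount
  congr 1
  ext d
  simp only [Finset.mem_filter, Finset.mem_univ, true_and]
  have : (D.hLabel d : ℕ) ≠ x := fun h => hx ⟨d, h⟩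
  omega

theorem hLabel_rev_strictMono : StrictMono fun j => D.hLabel (Fin.rev j) :=
  fun _ _ h => D.hLabel_strictAnti (Fin.rev_lt_rev.2 h)

/-- Read from right to left the columns have increasing labels, so the labels below `x` form an
initial segment of length `horCount x`. -/
theorem hLabel_rev_lt_iff (j : Fin (n - k)) (x : ℕ) :
    (D.hLabel j.rev : ℕ) < x ↔ (j : ℕ) < D.horCount x := by
  have key : D.horCount x =
      (Finset.univ.filter fun i => (D.hLabel (Fin.rev i) : ℕ) < x).card := by
    refine Finset.card_equiv Fin.revPerm fun i => ?_
    simp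
  rw [key]
  constructor
  · intro h
    have := Finset.card_le_card (s := Finset.Iic j)
      (t := Finset.univ.filter fun i => (D.hLabel (Fin.rev i) : ℕ) < x) (fun i hi => by
        have h1 : D.hLabel i.rev ≤ D.hLabel j.rev :=
          D.hLabel_rev_strictMono.monotone (Finset.mem_Iic.1 hi)
        have h2 : (D.hLabel i.rev : ℕ) ≤ D.hLabel j.rev := h1
        simp only [Finset.mem_filter, Finset.mem_univ, true_and]
        omega)
    rw [Fin.card_Iic] at this
    omega
  · intro h
    by_contra hx
    have := Finset.card_le_card (t := Finset.Iio j)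
      (s := Finset.univ.filter fun i => (D.hLabel (Fin.rev i) : ℕ) < x) (fun i hi => by
        simp only [Finset.mem_filter, Finset.mem_univ, true_and] at hi
        rw [Finset.mem_Iio]
        by_contra hij
        have h1 : D.hLabel j.rev ≤ D.hLabel i.rev :=
          D.hLabel_rev_strictMono.monotone (not_lt.1 hij)
        have h2 : (D.hLabel j.rev : ℕ) ≤ D.hLabel i.rev := h1
        omega)
    rw [Fin.card_Iio] at this
    omega

theorem horCount_hLabel_rev (j : Fin (n - k)) : D.horCount (D.hLabel j.rev) = j := by
  have h1 := (D.hLabel_rev_lt_iff j (D.hLabel j.rev)).not.1 (lt_irrefl _)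
  have h2 := (D.hLabel_rev_lt_iff j (D.hLabel j.rev + 1)).1 (Nat.lt_succ_self _)
  rw [D.horCount_succ_of_mem (D.hLabel_mem_hor _)] at h2
  omega

theorem horCount_hLabel (c : Fin (n - k)) : D.horCount (D.hLabel c) = n - k - 1 - c := by
  have := D.horCount_hLabel_rev c.rev
  rw [Fin.rev_rev] at this
  rw [this, Fin.val_rev]
  omega

theorem horCount_vLabel (r : Fin k) : D.horCount (D.vLabel r) = n - k - D.shape.rowLen r := by
  have h1 := D.horCount_le (D.vLabel r)
  have key : ∀ j : Fin (n - k), (j : ℕ) < D.horCount (D.vLabel r) ↔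
      (j : ℕ) < n - k - D.shape.rowLen r := by
    intro j
    rw [← D.hLabel_rev_lt_iff]
    have h2 := D.lt_rowLen_iff_lt_colLen r j.rev
    have h3 := D.rowLen_le r
    have h4 := Fin.val_rev j
    have := j.2
    simp only [hLabel, vLabel]
    omega
  apply le_antisymm
  · by_contra h
    have := (key ⟨n - k - D.shape.rowLen r, by omega⟩).1 (by simpa using h)
    simp at this
  · by_contra h
    have := (key ⟨D.horCount (D.vLabel r), by omega⟩).2 (not_le.1 h)
    simp at this

theorem horCount_lt_of_mem {x : ℕ} (hx : x ∈ D.hor) : D.horCount x < n - k := by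
  have := D.horCount_le (x + 1)
  rw [D.horCount_succ_of_mem hx] at this
  omega

theorem eq_of_mem_hor_of_horCount_eq {x y : ℕ} (hx : x ∈ D.hor) (hy : y ∈ D.hor)
    (h : D.horCount x = D.horCount y) : x = y := by
  rcases lt_trichotomy x y with hl | hl | hl
  · have := D.horCount_mono (Nat.succ_le_of_lt hl)
    rw [Nat.succ_eq_add_one, D.horCount_succ_of_mem hx] at this
    omega
  · exact hl
  · have := D.horCount_mono (Nat.succ_le_of_lt hl)
    rw [Nat.succ_eq_add_one, D.horCount_succ_of_mem hy] at this
    omega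

/-- The sign flips once per vertical step, and the number `x - horCount x` of vertical steps before
`x` has the parity of `x + horCount x`. -/
theorem signHat_eq (x : ℕ) : D.signHat x = (-1) ^ (x + D.horCount x) := by
  induction x with
  | zero => simp [signHat, horCount_zero]
  | succ x ih =>
    rw [signHat]
    split_ifs with h
    · rw [ih, D.horCount_succ_of_mem h, show x + 1 + (D.horCount x + 1) = x + D.horCount x + 2 by ring,
        pow_add _ (x + D.horCount x), show (-1 : SignType) ^ 2 = 1 by decide, mul_one]
    · rw [ih, D.horCount_succ_of_notMem h, show x + 1 + D.horCount x = x + D.horCount x + 1 by ring,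
        pow_succ, mul_neg, mul_one]

theorem signHat_ne_zero (x : ℕ) : D.signHat x ≠ 0 := by
  rw [signHat_eq]
  exact pow_ne_zero _ (by decide)

/-- An interval is indexed by the number of earlier horizontal steps. The second alternative
collects the vertical steps of empty rows at the end of the border, which join the last interval. -/
theorem mem_block_iff (j : Fin (n - k)) (x : Fin n) : x ∈ D.block j ↔
    D.horCount x = j ∨ ((j : ℕ) + 1 = n - k ∧ D.horCount x = n - k) := by
  have h1 : (∀ j' : Fin (n - k), (j' : ℕ) + 1 = j → D.hLabel j'.rev < x) ↔
      (j : ℕ) ≤ D.horCount x := by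
    constructor
    · intro h
      by_contra hj
      have hj2 := j.2
      have := h ⟨(j : ℕ) - 1, by omega⟩ (by simp only; omega)
      rw [Fin.lt_def, hLabel_rev_lt_iff] at this
      simp only at this
      omega
    · intro h j' hj'
      rw [Fin.lt_def, hLabel_rev_lt_iff]
      omega
  have h2 : x ≤ D.hLabel j.rev ↔ D.horCount x ≤ j := by
    rw [← not_lt, Fin.lt_def, hLabel_rev_lt_iff, not_lt]
  have := D.horCount_le x
  simp only [block, Set.mem_ofPred_eq, h1, h2]
  have := j.2
  omega

theorem exists_mem_block (hkn : k < n) (x : Fin n) : ∃ j, x ∈ D.block j := by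
  have := D.horCount_le x
  by_cases h : D.horCount x = n - k
  · exact ⟨⟨n - k - 1, by omega⟩, (D.mem_block_iff _ _).2 (Or.inr ⟨by simp only; omega, h⟩)⟩
  · exact ⟨⟨D.horCount x, by omega⟩, (D.mem_block_iff _ _).2 (Or.inl rfl)⟩

theorem shape_eq_of_colLen_eq {D E : LeDiagram k n} (h : ∀ c, D.shape.colLen c = E.shape.colLen c) :
    D.shape = E.shape := by
  ext ⟨r, c⟩
  rw [YoungDiagram.mem_cells, YoungDiagram.mem_cells, YoungDiagram.mem_iff_lt_colLen,
    YoungDiagram.mem_iff_lt_colLen, h]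

theorem colLen_eq_zero {c : ℕ} (hc : n - k ≤ c) : D.shape.colLen c = 0 := by
  by_contra h
  have := (D.shape_le (0, c) (YoungDiagram.mem_iff_lt_colLen.2 (Nat.pos_of_ne_zero h))).2
  simp only at this
  omega

theorem hLabel_eq_of_hor_eq {D E : LeDiagram k n} (h : D.hor = E.hor) : D.hLabel = E.hLabel := by
  rw [← D.hLabel_strictAnti.range_inj E.hLabel_strictAnti]
  ext x
  have : (x : ℕ) ∈ D.hor ↔ (x : ℕ) ∈ E.hor := by rw [h]
  simpa only [hor, Set.mem_ofPred_eq, ← Fin.ext_iff, Set.mem_range] using this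

theorem shape_eq_of_hor_eq {D E : LeDiagram k n} (h : D.hor = E.hor) : D.shape = E.shape := by
  refine shape_eq_of_colLen_eq fun c => ?_
  by_cases hc : c < n - k
  · have := congrArg Fin.val (congrFun (hLabel_eq_of_hor_eq h) ⟨c, hc⟩)
    simp only [hLabel] at this
    omega
  · rw [D.colLen_eq_zero (not_lt.1 hc), E.colLen_eq_zero (not_lt.1 hc)]

theorem hLabel_eq_of_shape_eq {D E : LeDiagram k n} (h : D.shape = E.shape) :
    D.hLabel = E.hLabel := by
  funext c
  simp only [hLabel, h]

theorem vLabel_eq_of_shape_eq {D E : LeDiagram k n} (h : D.shape = E.shape) :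
    D.vLabel = E.vLabel := by
  funext c
  simp only [vLabel, h]

theorem hor_eq_of_shape_eq {D E : LeDiagram k n} (h : D.shape = E.shape) : D.hor = E.hor := by
  simp only [hor, hLabel_eq_of_shape_eq h]

theorem horCount_eq_of_hor {D E : LeDiagram k n} (h : D.hor = E.hor) : D.horCount = E.horCount := by
  unfold horCount
  rw [hLabel_eq_of_hor_eq h]

/-! ### The `+`'s -/

theorem exists_plus_of_not_isZeroRow {r : ℕ} (h : ¬ D.IsZeroRow r) : ∃ c, (r, c) ∈ D.plus := by
  simpa [IsZeroRow] using h

variable {D}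

theorem InClosure.mem_plus_iff (hD : D.InClosure) {r c : ℕ} :
    (r, c) ∈ D.plus ↔ ¬ D.IsZeroRow r ∧ c + 1 = D.shape.rowLen r := by
  constructor
  · intro h
    exact ⟨fun h0 => h0 c h, hD.2 r c h⟩
  · rintro ⟨h, hc⟩
    obtain ⟨d, hd⟩ := D.exists_plus_of_not_isZeroRow h
    have := hD.2 r d hd
    obtain rfl : c = d := by omega
    exact hd

theorem isZeroRow_of_rowLen_eq_zero {r : ℕ} (h : D.shape.rowLen r = 0) : D.IsZeroRow r := by
  intro c hc
  have h1 : (r, c) ∈ D.shape := D.plus_subset hc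
  rw [YoungDiagram.mem_iff_lt_rowLen] at h1
  omega

theorem isZeroRow_of_le {r : ℕ} (h : k ≤ r) : D.IsZeroRow r := by
  intro c hc
  have := (D.shape_le _ (D.plus_subset hc)).1
  simp only at this
  omega

theorem ext_of_shape {D E : LeDiagram k n} (hD : D.InClosure) (hE : E.InClosure)
    (hs : D.shape = E.shape) (hz : ∀ r : Fin k, D.IsZeroRow r ↔ E.IsZeroRow r) : D = E := by
  ext1
  · exact hs
  · ext ⟨r, c⟩
    rw [hD.mem_plus_iff, hE.mem_plus_iff, hs]
    by_cases hr : r < k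
    · rw [hz ⟨r, hr⟩]
    · simp [isZeroRow_of_le (not_lt.1 hr)]

theorem IsMaximal.inClosure (hD : D.IsMaximal) : D.InClosure :=
  ⟨fun r hr => (hD.1 r hr).le, hD.2⟩

theorem IsMaximal.not_isZeroRow (hD : D.IsMaximal) (r : Fin k) : ¬ D.IsZeroRow r := by
  intro h
  have h1 := hD.1 r r.2
  rw [Finset.card_eq_one] at h1
  obtain ⟨⟨a, c⟩, ha⟩ := h1
  have : (a, c) ∈ D.plus.filter fun b => b.1 = (r : ℕ) := by rw [ha]; simp
  rw [Finset.mem_filter] at this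
  obtain ⟨h2, h3⟩ := this
  rw [show a = r from h3] at h2
  exact h c h2

theorem IsMaximal.coloopSet_eq (hD : D.IsMaximal) : D.coloopSet = ∅ := by
  ext x
  simp only [coloopSet, Set.mem_ofPred_eq, Set.mem_empty_iff_false, iff_false]
  rintro ⟨r, -, hr⟩
  exact hD.not_isZeroRow r hr

theorem IsMaximal.rowLen_pos (hD : D.IsMaximal) (r : Fin k) : 0 < D.shape.rowLen r := by
  by_contra h
  exact hD.not_isZeroRow r (isZeroRow_of_rowLen_eq_zero (by omega))

/-- A vertical last step would belong to an empty row, which has no room for a `+`. -/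
theorem IsMaximal.last_mem_hor (hD : D.IsMaximal) {x : ℕ} (hx : x + 1 = n) : x ∈ D.hor := by
  by_contra h
  obtain ⟨r, hr⟩ := D.exists_vLabel_eq (x := ⟨x, by omega⟩) h
  have h1 := congrArg Fin.val hr
  have h2 := hD.rowLen_pos r
  have h3 := D.rowLen_le r
  have := r.2
  simp only [vLabel] at h1
  omega

theorem IsMaximal.eq_of_hor_eq {D E : LeDiagram k n} (hD : D.IsMaximal) (hE : E.IsMaximal)
    (h : D.hor = E.hor) : D = E :=
  ext_of_shape hD.inClosure hE.inClosure (shape_eq_of_hor_eq h) fun r =>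
    iff_of_false (hD.not_isZeroRow r) (hE.not_isZeroRow r)

theorem IsMaximal.mem_block_iff (hD : D.IsMaximal) (j : Fin (n - k)) (x : Fin n) :
    x ∈ D.block j ↔ D.horCount x = j := by
  rw [D.mem_block_iff, or_iff_left]
  rintro ⟨-, h⟩
  have := x.2
  have h1 := D.horCount_mono (show (x : ℕ) ≤ n - 1 by omega)
  have h2 := D.horCount_lt_of_mem (hD.last_mem_hor (x := n - 1) (by omega))
  omega

theorem mem_coloopSet_iff (D : LeDiagram k n) (r : Fin k) :
    D.vLabel r ∈ D.coloopSet ↔ D.IsZeroRow r := by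
  constructor
  · rintro ⟨s, hs, h⟩
    rwa [D.vLabel_injective hs] at h
  · intro h
    exact ⟨r, rfl, h⟩

theorem notMem_hor_of_mem_coloopSet {x : Fin n} (hx : x ∈ D.coloopSet) : (x : ℕ) ∉ D.hor := by
  obtain ⟨r, rfl, -⟩ := hx
  exact D.vLabel_notMem_hor r

theorem hLabel_notMem_coloopSet (c : Fin (n - k)) : D.hLabel c ∉ D.coloopSet :=
  fun h => notMem_hor_of_mem_coloopSet h (D.hLabel_mem_hor c)

theorem sigma_of_mem {x : Fin n} (hx : x ∈ D.coloopSet) : D.sigma x = 0 := if_pos hx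

theorem sigma_of_notMem {x : Fin n} (hx : x ∉ D.coloopSet) : D.sigma x = D.signHat x := if_neg hx

theorem sigma_eq_zero_iff {x : Fin n} : D.sigma x = 0 ↔ x ∈ D.coloopSet := by
  constructor
  · intro h
    by_contra hx
    rw [sigma_of_notMem hx] at h
    exact D.signHat_ne_zero _ h
  · exact sigma_of_mem

theorem IsMaximal.sigma_eq (hD : D.IsMaximal) (x : Fin n) : D.sigma x = D.signHat x :=
  sigma_of_notMem (by simp [hD.coloopSet_eq])

theorem horCount_lt_of_notMem_coloopSet {x : Fin n} (hx : x ∉ D.coloopSet) :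
    D.horCount x < n - k := by
  by_cases h : (x : ℕ) ∈ D.hor
  · exact D.horCount_lt_of_mem h
  · obtain ⟨r, rfl⟩ := D.exists_vLabel_eq h
    rw [mem_coloopSet_iff] at hx
    have h1 : D.shape.rowLen r ≠ 0 := fun h => hx (isZeroRow_of_rowLen_eq_zero h)
    have h2 := D.rowLen_le r
    rw [horCount_vLabel]
    omega

end LeDiagram

namespace LeDiagram

variable {k n : ℕ} {D E F : LeDiagram k n}

/-! ### Moving a horizontal step past a vertical one -/

/-- The southeast borders of `D` and `E` differ precisely in that the steps with the labels `i - 1`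
and `i` are horizontal and vertical for `D`, and vertical and horizontal for `E`. -/
structure Shift (D E : LeDiagram k n) (i : ℕ) : Prop where
  pos : 0 < i
  left_mem : i - 1 ∈ D.hor
  left_notMem : i ∉ D.hor
  right_notMem : i - 1 ∉ E.hor
  right_mem : i ∈ E.hor
  agree : ∀ x, x ≠ i - 1 → x ≠ i → (x ∈ D.hor ↔ x ∈ E.hor)

theorem Shift.horCount_eq {i x : ℕ} (h : Shift D E i) (hx : x ≠ i) :
    D.horCount x = E.horCount x := by
  -- At `i` itself the count for `D` is one larger; carrying the three cases together lets the
  -- induction pass through `i`.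
  have key : ∀ x, (x < i → D.horCount x = E.horCount x) ∧
      (i < x → D.horCount x = E.horCount x) ∧ (x = i → D.horCount x = E.horCount x + 1) := by
    intro x
    induction x with
    | zero =>
      refine ⟨fun _ => by rw [horCount_zero, horCount_zero], fun h => by omega, fun h0 => ?_⟩
      have := h.pos
      omega
    | succ x ih =>
      rcases Nat.lt_trichotomy (x + 1) i with hl | hl | hl
      · refine ⟨fun _ => ?_, by omega, by omega⟩
        by_cases hx : x ∈ D.hor
        · rw [horCount_succ_of_mem _ hx,
            horCount_succ_of_mem _ ((h.agree x (by omega) (by omega)).1 hx), ih.1 (by omega)]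
        · rw [horCount_succ_of_notMem _ hx,
            horCount_succ_of_notMem _ (mt (h.agree x (by omega) (by omega)).2 hx), ih.1 (by omega)]
      · refine ⟨by omega, by omega, fun _ => ?_⟩
        have hx : x = i - 1 := by omega
        rw [horCount_succ_of_mem _ (hx ▸ h.left_mem), horCount_succ_of_notMem _ (hx ▸ h.right_notMem),
          ih.1 (by omega)]
      · refine ⟨by omega, fun _ => ?_, by omega⟩
        by_cases hi : x = i
        · rw [horCount_succ_of_notMem _ (hi ▸ h.left_notMem), horCount_succ_of_mem _ (hi ▸ h.right_mem),
            ih.2.2 hi]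
        · by_cases hx : x ∈ D.hor
          · rw [horCount_succ_of_mem _ hx,
              horCount_succ_of_mem _ ((h.agree x (by omega) (by omega)).1 hx), ih.2.1 (by omega)]
          · rw [horCount_succ_of_notMem _ hx,
              horCount_succ_of_notMem _ (mt (h.agree x (by omega) (by omega)).2 hx),
              ih.2.1 (by omega)]
  rcases Nat.lt_or_gt_of_ne hx with hl | hl
  · exact (key x).1 hl
  · exact (key x).2.1 hl

theorem Shift.horCount_self {i : ℕ} (h : Shift D E i) : D.horCount i = E.horCount i + 1 := by
  obtain ⟨j, rfl⟩ : ∃ j, i = j + 1 := ⟨i - 1, (Nat.sub_add_cancel h.pos).symm⟩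
  have h1 := h.left_mem
  have h2 := h.right_notMem
  rw [Nat.add_sub_cancel] at h1 h2
  rw [horCount_succ_of_mem _ h1, horCount_succ_of_notMem _ h2,
    h.horCount_eq (by omega)]

theorem Shift.isInner {i : Fin n} (hD : D.IsMaximal) (h : Shift D E i) : IsInner i := by
  refine ⟨h.pos, ?_⟩
  by_contra hi
  exact h.left_notMem (hD.last_mem_hor (by omega))

open Classical in
theorem card_filter_hor (D : LeDiagram k n) :
    ((Finset.range n).filter fun x => x ∈ D.hor).card = n - k := by
  have : (Finset.range n).filter (fun x => x ∈ D.hor) =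
      Finset.univ.image fun c => (D.hLabel c : ℕ) := by
    ext x
    simp only [Finset.mem_filter, Finset.mem_range, Finset.mem_image, Finset.mem_univ, true_and]
    exact ⟨fun h => h.2, fun h => ⟨D.lt_of_mem_hor h, h⟩⟩
  rw [this, Finset.card_image_of_injective, Finset.card_univ, Fintype.card_fin]
  exact Fin.val_injective.comp D.hLabel_strictAnti.injective

theorem eq_of_hor_subset (h : D.hor ⊆ E.hor) : D.hor = E.hor := by
  classical
  have hsub : (Finset.range n).filter (fun x => x ∈ D.hor) ⊆
      (Finset.range n).filter (fun x => x ∈ E.hor) :=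
    Finset.monotone_filter_right _ fun x _ hx => h hx
  have := Finset.eq_of_subset_of_card_le hsub (by rw [card_filter_hor, card_filter_hor])
  refine h.antisymm fun x hx => ?_
  have hx' : x ∈ (Finset.range n).filter (fun x => x ∈ E.hor) :=
    Finset.mem_filter.2 ⟨Finset.mem_range.2 (E.lt_of_mem_hor hx), hx⟩
  rw [← this] at hx'
  exact (Finset.mem_filter.1 hx').2

/-- The two sets have the same size, so neither contains the other; a difference confined to `i - 1`
and `i` must exchange these two labels. -/
theorem shift_or_shift {i : ℕ} (hi : 0 < i) (hne : D.hor ≠ E.hor)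
    (h : ∀ x, x ≠ i - 1 → x ≠ i → (x ∈ D.hor ↔ x ∈ E.hor)) : Shift D E i ∨ Shift E D i := by
  have key : ∀ {D E : LeDiagram k n}, D.hor ≠ E.hor →
      (∀ x, x ≠ i - 1 → x ≠ i → (x ∈ D.hor ↔ x ∈ E.hor)) →
      (i - 1 ∈ D.hor ∧ i - 1 ∉ E.hor) ∨ (i ∈ D.hor ∧ i ∉ E.hor) := by
    intro D E hne h
    by_contra hc
    refine hne (eq_of_hor_subset fun x hx => ?_)
    by_cases h1 : x = i - 1
    · subst h1
      tauto
    · by_cases h2 : x = i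
      · subst h2
        tauto
      · exact (h x h1 h2).1 hx
  have h1 := key hne h
  have h2 := key hne.symm fun x hx hx' => (h x hx hx').symm
  by_cases hD : i - 1 ∈ D.hor
  · exact Or.inl ⟨hi, hD, by tauto, by tauto, by tauto, h⟩
  · exact Or.inr ⟨hi, by tauto, by tauto, by tauto, by tauto, fun x hx hx' => (h x hx hx').symm⟩

/-- The last label is horizontal in both diagrams, so only labels with a successor, where
consecutive data can be compared, need checking. -/
theorem agree_of_agree_below (hD : D.IsMaximal) (hE : E.IsMaximal) {i : ℕ}
    (h : ∀ x, x + 1 < n → x ≠ i - 1 → x ≠ i → (x ∈ D.hor ↔ x ∈ E.hor)) (x : ℕ)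
    (h1 : x ≠ i - 1) (h2 : x ≠ i) : x ∈ D.hor ↔ x ∈ E.hor := by
  rcases Nat.lt_trichotomy (x + 1) n with hl | hl | hl
  · exact h x hl h1 h2
  · exact iff_of_true (hD.last_mem_hor hl) (hE.last_mem_hor hl)
  · refine iff_of_false (fun hx => ?_) (fun hx => ?_)
    · have := D.lt_of_mem_hor hx
      omega
    · have := E.lt_of_mem_hor hx
      omega

/-! ### Adjacency in terms of sign vectors -/

theorem signHat_succ_eq_iff (D : LeDiagram k n) (x : ℕ) :
    D.signHat (x + 1) = D.signHat x ↔ x ∈ D.hor := by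
  have h0 := D.signHat_ne_zero x
  rw [signHat]
  split_ifs with h
  · exact iff_of_true rfl h
  · refine iff_of_false (fun h' => ?_) h
    revert h' h0
    cases D.signHat x <;> decide

theorem Shift.signHat_ne_iff {i : ℕ} (h : Shift D E i) (x : ℕ) :
    D.signHat x ≠ E.signHat x ↔ x = i := by
  constructor
  · intro hx
    by_contra hxi
    rw [signHat_eq, signHat_eq, h.horCount_eq hxi] at hx
    exact hx rfl
  · rintro rfl
    have h0 := E.signHat_ne_zero x
    rw [signHat_eq, h.horCount_self, ← add_assoc, pow_succ, ← signHat_eq, mul_neg, mul_one]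
    revert h0
    cases E.signHat x <;> decide

/-- Whether `x` is horizontal depends on the signs at `x` and `x + 1` only, and these avoid `i`
unless `x` is `i - 1` or `i`. -/
theorem signsDifferAt_iff (hD : D.IsMaximal) (hE : E.IsMaximal) (hne : D ≠ E) (i : Fin n) :
    SignsDifferAt D E i ↔ Shift D E i ∨ Shift E D i := by
  constructor
  · rintro ⟨⟨hi, hi'⟩, h⟩
    refine shift_or_shift hi (fun h => hne (hD.eq_of_hor_eq hE h))
      (agree_of_agree_below hD hE fun x hx h1 h2 => ?_)
    have e1 := (h ⟨x, by omega⟩).not.2 (fun h => h2 (congrArg Fin.val h))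
    have e2 := (h ⟨x + 1, hx⟩).not.2 (fun h => h1 (by
      have := congrArg Fin.val h
      simp only at this
      omega))
    rw [not_not, hD.sigma_eq, hE.sigma_eq] at e1 e2
    rw [← signHat_succ_eq_iff, ← signHat_succ_eq_iff, e1, e2]
  · rintro (h | h)
    · refine ⟨h.isInner hD, fun j => ?_⟩
      rw [hD.sigma_eq, hE.sigma_eq, h.signHat_ne_iff, Fin.ext_iff]
    · refine ⟨h.isInner hE, fun j => ?_⟩
      rw [ne_comm, hD.sigma_eq, hE.sigma_eq, h.signHat_ne_iff, Fin.ext_iff]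

/-! ### Adjacency in terms of interval partitions -/

theorem IsMaximal.mem_hor_iff (hD : D.IsMaximal) {x : ℕ} (hx : x + 1 < n) :
    x ∈ D.hor ↔ ∃ j, (⟨x, by omega⟩ : Fin n) ∈ D.block j ∧ (⟨x + 1, hx⟩ : Fin n) ∉ D.block j := by
  simp only [hD.mem_block_iff]
  constructor
  · intro h
    refine ⟨⟨D.horCount x, D.horCount_lt_of_mem h⟩, rfl, ?_⟩
    rw [horCount_succ_of_mem _ h]
    simp
  · rintro ⟨j, h1, h2⟩
    by_contra h
    rw [horCount_succ_of_notMem _ h] at h2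
    exact h2 h1

theorem isMove_of_horCount (hD : D.IsMaximal) (hE : E.IsMaximal) {i : Fin n}
    (h : ∀ x : ℕ, x ≠ i → D.horCount x = E.horCount x) (hi : D.horCount i ≠ E.horCount i) :
    IsMove E.block D.block i := by
  have lt : ∀ {D : LeDiagram k n}, D.IsMaximal → D.horCount i < n - k := fun {D} hD => by
    have h1 := i.2
    have h2 := D.horCount_mono (show (i : ℕ) ≤ n - 1 by omega)
    have h3 := D.horCount_lt_of_mem (hD.last_mem_hor (x := n - 1) (by omega))
    omega
  refine ⟨⟨E.horCount i, lt hE⟩, ⟨D.horCount i, lt hD⟩, fun h => hi (congrArg Fin.val h).symm,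
    (hE.mem_block_iff _ _).2 rfl, ?_, ?_, ?_⟩
  · ext x
    rw [Set.mem_sdiff, hD.mem_block_iff, hE.mem_block_iff, Set.mem_singleton_iff]
    by_cases hx : x = i
    · subst hx
      simp [hi]
    · rw [h x (fun h => hx (Fin.ext h))]
      simp [hx]
  · ext x
    rw [Set.mem_union, hD.mem_block_iff, hE.mem_block_iff, Set.mem_singleton_iff]
    by_cases hx : x = i
    · subst hx
      simp
    · rw [h x (fun h => hx (Fin.ext h))]
      simp [hx]
  · intro c ha hb
    ext x
    rw [hD.mem_block_iff, hE.mem_block_iff]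
    by_cases hx : x = i
    · subst hx
      exact iff_of_false (fun h => hb (Fin.ext h.symm)) (fun h => ha (Fin.ext h.symm))
    · rw [h x (fun h => hx (Fin.ext h))]

theorem partitionsDifferAt_iff (hD : D.IsMaximal) (hE : E.IsMaximal) (hne : D ≠ E) (i : Fin n) :
    PartitionsDifferAt D E i ↔ Shift D E i ∨ Shift E D i := by
  constructor
  · rintro ⟨⟨hi, hi'⟩, a, b, hab, hia, ha, hb, hc⟩
    refine shift_or_shift hi (fun h => hne (hD.eq_of_hor_eq hE h))
      (agree_of_agree_below hD hE fun x hx h1 h2 => ?_)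
    have key : ∀ y : Fin n, y ≠ i → ∀ j, y ∈ D.block j ↔ y ∈ E.block j := by
      intro y hy j
      by_cases hja : j = a
      · simp [hja, ha, hy]
      · by_cases hjb : j = b
        · simp [hjb, hb, hy]
        · rw [hc j hja hjb]
    rw [hD.mem_hor_iff hx, hE.mem_hor_iff hx]
    refine exists_congr fun j => ?_
    rw [key _ (fun h => h2 (congrArg Fin.val h)), key _ (fun h => h1 (by
      have := congrArg Fin.val h
      simp only at this
      omega))]
  · rintro (h | h)
    · refine ⟨h.isInner hD, isMove_of_horCount hD hE (fun x hx => h.horCount_eq hx) ?_⟩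
      rw [h.horCount_self]
      omega
    · refine ⟨h.isInner hE, isMove_of_horCount hD hE (fun x hx => (h.horCount_eq hx).symm) ?_⟩
      rw [h.horCount_self]
      omega

/-! ### Adjacency in terms of Young diagrams -/

/-- The two interchanged horizontal steps have the same rank among the horizontal steps, so they
bound the same column. All other columns keep their label and hence their length, while this one
grows by a box. -/
theorem Shift.exists_column {i : ℕ} (h : Shift D E i) : ∃ c : Fin (n - k),
    (D.hLabel c : ℕ) = i - 1 ∧ (E.hLabel c : ℕ) = i ∧
    E.shape.cells = insert (D.shape.colLen c, (c : ℕ)) D.shape.cells ∧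
    (D.shape.colLen c, (c : ℕ)) ∉ D.shape := by
  obtain ⟨c, hc⟩ := h.left_mem
  obtain ⟨d, hd⟩ := h.right_mem
  have hcount : ∀ {c d : Fin (n - k)} {x y : ℕ}, (D.hLabel c : ℕ) = x → (E.hLabel d : ℕ) = y →
      D.horCount x = E.horCount y → c = d := by
    rintro c d x y rfl rfl h
    rw [horCount_hLabel, horCount_hLabel] at h
    have := c.2
    have := d.2
    exact Fin.ext (by omega)
  have hcd : c = d := by
    refine hcount hc hd ?_
    have h1 := D.horCount_succ_of_mem h.left_mem
    rw [Nat.sub_add_cancel h.pos, h.horCount_self] at h1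
    omega
  subst hcd
  have hoth : ∀ c', c' ≠ c → D.hLabel c' = E.hLabel c' := by
    intro c' hc'
    have h1 : (D.hLabel c' : ℕ) ≠ i - 1 := fun h =>
      hc' (D.hLabel_strictAnti.injective (Fin.ext (h.trans hc.symm)))
    have h2 : (D.hLabel c' : ℕ) ≠ i := fun h' => h.left_notMem (h' ▸ D.hLabel_mem_hor c')
    obtain ⟨d, hd'⟩ := (h.agree _ h1 h2).1 (D.hLabel_mem_hor c')
    have := hcount rfl hd' (h.horCount_eq h2)
    subst this
    exact Fin.ext hd'.symm
  have hcol : E.shape.colLen c = D.shape.colLen c + 1 := by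
    have := h.pos
    simp only [hLabel] at hc hd
    omega
  refine ⟨c, hc, hd, ?_, by rw [YoungDiagram.mem_iff_lt_colLen]; exact lt_irrefl _⟩
  ext ⟨r, c'⟩
  rw [Finset.mem_insert, YoungDiagram.mem_cells, YoungDiagram.mem_cells,
    YoungDiagram.mem_iff_lt_colLen, YoungDiagram.mem_iff_lt_colLen, Prod.mk.injEq]
  by_cases hcc : c' = c
  · subst hcc
    rw [hcol]
    omega
  · have : E.shape.colLen c' = D.shape.colLen c' := by
      by_cases hlt : c' < n - k
      · have := congrArg Fin.val (hoth ⟨c', hlt⟩ (fun h => hcc (congrArg Fin.val h)))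
        simp only [hLabel] at this
        omega
      · rw [D.colLen_eq_zero (not_lt.1 hlt), E.colLen_eq_zero (not_lt.1 hlt)]
    rw [this]
    simp [hcc]

theorem exists_shift_of_insert {b : ℕ × ℕ} (hb : b ∉ D.shape)
    (h : E.shape.cells = insert b D.shape.cells) : ∃ i : Fin n, Shift D E i := by
  obtain ⟨r, c⟩ := b
  have hmem : ∀ r' c', (r', c') ∈ E.shape ↔ (r' = r ∧ c' = c) ∨ (r', c') ∈ D.shape := by
    intro r' c'
    rw [← YoungDiagram.mem_cells, h, Finset.mem_insert, YoungDiagram.mem_cells, Prod.mk.injEq]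
  have hbE : (r, c) ∈ E.shape := (hmem r c).2 (Or.inl ⟨rfl, rfl⟩)
  have hcn := (E.shape_le _ hbE).2
  simp only at hcn
  simp only [YoungDiagram.mem_iff_lt_colLen] at hmem hb hbE
  have hoth : ∀ c', c' ≠ c → E.shape.colLen c' = D.shape.colLen c' := by
    intro c' hc'
    have := hmem (E.shape.colLen c') c'
    have := hmem (D.shape.colLen c') c'
    omega
  have hcol : E.shape.colLen c = D.shape.colLen c + 1 := by
    have := hmem (D.shape.colLen c) c
    have := hmem (D.shape.colLen c + 1) c
    have := hmem (E.shape.colLen c) c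
    omega
  have hD : ∀ c' : Fin (n - k), (c' : ℕ) ≠ c → D.hLabel c' = E.hLabel c' := by
    intro c' hc'
    simp only [hLabel, hoth c' hc']
  have hself : (D.hLabel ⟨c, hcn⟩ : ℕ) + 1 = E.hLabel ⟨c, hcn⟩ := by
    simp only [hLabel, hcol]
    omega
  have hval : ∀ c' : Fin (n - k), (c' : ℕ) = c → c' = ⟨c, hcn⟩ := fun c' h => Fin.ext h
  -- The witness is the label, in the larger diagram, of the lengthened column; it has increased by
  -- one and no other column label has changed.
  refine ⟨E.hLabel ⟨c, hcn⟩, ⟨by omega, ⟨⟨c, hcn⟩, by omega⟩, ?_, ?_, E.hLabel_mem_hor _, ?_⟩⟩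
  · rintro ⟨c', hc'⟩
    by_cases hcc : (c' : ℕ) = c
    · rw [hval c' hcc] at hc'
      omega
    · rw [hD c' hcc] at hc'
      exact hcc (congrArg Fin.val (E.hLabel_strictAnti.injective (Fin.ext hc')))
  · rintro ⟨c', hc'⟩
    by_cases hcc : (c' : ℕ) = c
    · rw [hval c' hcc] at hc'
      omega
    · rw [← hD c' hcc] at hc'
      exact hcc (congrArg Fin.val (D.hLabel_strictAnti.injective
        (Fin.ext (hc'.trans (by omega : _ = (D.hLabel ⟨c, hcn⟩ : ℕ))))))
  · intro x h1 h2
    refine exists_congr fun c' => ?_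
    by_cases hcc : (c' : ℕ) = c
    · rw [hval c' hcc]
      omega
    · rw [hD c' hcc]

theorem shapesDifferBy_symm {b : ℕ × ℕ} (h : ShapesDifferBy D E b) : ShapesDifferBy E D b := by
  rw [ShapesDifferBy, symmDiff_comm]
  exact h

theorem insert_or_insert {b : ℕ × ℕ} (h : ShapesDifferBy D E b) :
    (b ∉ D.shape ∧ E.shape.cells = insert b D.shape.cells) ∨
      (b ∉ E.shape ∧ D.shape.cells = insert b E.shape.cells) := by
  have key : ∀ x, (x ∈ D.shape ∧ x ∉ E.shape ∨ x ∈ E.shape ∧ x ∉ D.shape) ↔ x = b := by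
    intro x
    rw [← Finset.mem_singleton, ← h, Finset.mem_symmDiff, YoungDiagram.mem_cells,
      YoungDiagram.mem_cells]
  have hb := (key b).2 rfl
  rcases hb with hb | hb
  · refine Or.inr ⟨hb.2, ?_⟩
    ext x
    have := key x
    rw [Finset.mem_insert, YoungDiagram.mem_cells, YoungDiagram.mem_cells]
    by_cases hx : x = b
    · subst hx
      tauto
    · tauto
  · refine Or.inl ⟨hb.2, ?_⟩
    ext x
    have := key x
    rw [Finset.mem_insert, YoungDiagram.mem_cells, YoungDiagram.mem_cells]
    by_cases hx : x = b
    · subst hx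
      tauto
    · tauto

theorem shapesDifferBy_of_insert {b : ℕ × ℕ} (hb : b ∉ D.shape)
    (h : E.shape.cells = insert b D.shape.cells) : ShapesDifferBy D E b := by
  rw [← YoungDiagram.mem_cells] at hb
  rw [ShapesDifferBy, h]
  ext x
  rw [Finset.mem_symmDiff, Finset.mem_insert, Finset.mem_singleton]
  by_cases hx : x = b
  · subst hx
    tauto
  · tauto

theorem exists_shapesDifferBy_iff :
    (∃ b, ShapesDifferBy D E b) ↔ ∃ i : Fin n, Shift D E i ∨ Shift E D i := by
  constructor
  · rintro ⟨b, h⟩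
    rcases insert_or_insert h with ⟨h1, h2⟩ | ⟨h1, h2⟩
    · obtain ⟨i, hi⟩ := exists_shift_of_insert h1 h2
      exact ⟨i, Or.inl hi⟩
    · obtain ⟨i, hi⟩ := exists_shift_of_insert h1 h2
      exact ⟨i, Or.inr hi⟩
  · rintro ⟨i, h | h⟩
    · obtain ⟨c, -, -, h1, h2⟩ := h.exists_column
      exact ⟨_, shapesDifferBy_of_insert h2 h1⟩
    · obtain ⟨c, -, -, h1, h2⟩ := h.exists_column
      exact ⟨_, shapesDifferBy_symm (shapesDifferBy_of_insert h2 h1)⟩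

end LeDiagram

/-! ### Inversions -/

theorem swap_lt_swap {n : ℕ} {a b x y : Fin n} (hab : (a : ℕ) + 1 = b) (hxy : x < y)
    (hne : (x, y) ≠ (a, b)) : Equiv.swap a b x < Equiv.swap a b y := by
  rw [Ne, Prod.mk.injEq] at hne
  simp only [Equiv.swap_apply_def, Fin.ext_iff, Fin.lt_def] at *
  split_ifs <;> omega

/-- An adjacent transposition reverses only the pair `(a, b)`. Applied to both entries of a pair, it
matches the inversions of `p` with those of the product other than `(a, b)`, which is new. -/
theorem inversions_mul_swap {n : ℕ} (p : Equiv.Perm (Fin n)) {a b : Fin n} (hab : (a : ℕ) + 1 = b)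
    (h : p a < p b) : inversions (p * Equiv.swap a b) = inversions p + 1 := by
  have hlt : a < b := by rw [Fin.lt_def]; omega
  have key : (Finset.univ.filter fun x : Fin n × Fin n => x.1 < x.2 ∧
        (p * Equiv.swap a b) x.2 < (p * Equiv.swap a b) x.1) =
      insert (a, b) ((Finset.univ.filter fun x : Fin n × Fin n => x.1 < x.2 ∧ p x.2 < p x.1).map
        ((Equiv.swap a b).prodCongr (Equiv.swap a b)).toEmbedding) := by
    ext ⟨x, y⟩
    simp only [Finset.mem_filter, Finset.mem_univ, true_and, Finset.mem_insert,
      Finset.mem_map_equiv, Equiv.prodCongr_symm, Equiv.symm_swap, Equiv.prodCongr_apply,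
      Prod.map_apply]
    simp only [Equiv.Perm.mul_apply]
    constructor
    · rintro ⟨h1, h2⟩
      by_cases hne : (x, y) = (a, b)
      · exact Or.inl hne
      · exact Or.inr ⟨swap_lt_swap hab h1 hne, h2⟩
    · rintro (h0 | ⟨h1, h2⟩)
      · rw [Prod.mk.injEq] at h0
        rw [h0.1, h0.2, Equiv.swap_apply_left, Equiv.swap_apply_right]
        exact ⟨hlt, h⟩
      · refine ⟨?_, h2⟩
        have := swap_lt_swap hab h1 fun h0 => by
          rw [Prod.mk.injEq] at h0
          rw [h0.1, h0.2] at h2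
          exact lt_asymm h h2
        simpa using this
  rw [inversions, key, Finset.card_insert_of_notMem, Finset.card_map, inversions]
  simp only [Finset.mem_map_equiv, Equiv.prodCongr_symm, Equiv.symm_swap, Equiv.prodCongr_apply,
    Prod.map_apply, Finset.mem_filter, Equiv.swap_apply_left, Equiv.swap_apply_right, not_and]
  exact fun _ h => absurd h hlt.not_gt

theorem inversions_inv {n : ℕ} (p : Equiv.Perm (Fin n)) : inversions p⁻¹ = inversions p := by
  refine Finset.card_equiv ((Equiv.prodComm _ _).trans (p⁻¹.prodCongr p⁻¹)) fun x => ?_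
  simp [and_comm]

theorem inversions_swap_mul {n : ℕ} (p : Equiv.Perm (Fin n)) {a b : Fin n} (hab : (a : ℕ) + 1 = b)
    (h : p⁻¹ a < p⁻¹ b) : inversions (Equiv.swap a b * p) = inversions p + 1 := by
  rw [← inversions_inv, mul_inv_rev, Equiv.swap_inv, inversions_mul_swap _ hab h, inversions_inv]

theorem adjSwap_eq {n a : ℕ} {x y : Fin n} (hx : (x : ℕ) = a) (hy : (y : ℕ) = a + 1) :
    adjSwap n a = Equiv.swap x y := by
  have h := y.2
  rw [adjSwap, dif_pos (by omega)]
  congr 1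
  · exact Fin.ext hx.symm
  · exact Fin.ext hy.symm

theorem adjSwap_mul_self (n a : ℕ) : adjSwap n a * adjSwap n a = 1 := by
  unfold adjSwap
  split_ifs
  · exact Equiv.swap_mul_self _ _
  · exact one_mul _

namespace LeDiagram

variable {k n : ℕ} {D E F : LeDiagram k n}

/-! ### Following the pipes -/

/-- The pipe through the edge `s` reaches the edge `t`. -/
def Flows (D : LeDiagram k n) (s t : GridEdge k (n - k)) : Prop := ∃ m, D.pipeStep^[m] s = t

theorem Flows.trans {s t u : GridEdge k (n - k)} (h : D.Flows s t) (h' : D.Flows t u) :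
    D.Flows s u := by
  obtain ⟨a, rfl⟩ := h
  obtain ⟨b, rfl⟩ := h'
  exact ⟨b + a, Function.iterate_add_apply _ _ _ _⟩

theorem Flows.step {s t u : GridEdge k (n - k)} (h : D.pipeStep s = t) (h' : D.Flows t u) :
    D.Flows s u :=
  Flows.trans ⟨1, h⟩ h'

theorem Flows.refl (s : GridEdge k (n - k)) : D.Flows s s := ⟨0, rfl⟩

/-- A pipe stays put once it reaches a fixed edge and `n` steps suffice to reach one, so every fixed
edge on its way is its end, however many steps were counted. -/
theorem Flows.pipe_eq {e : Fin k ⊕ Fin (n - k)} {t : GridEdge k (n - k)}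
    (h : D.Flows (D.borderEdge e) t) (ht : D.pipeStep t = t) : D.pipe e = edgeLine t := by
  obtain ⟨m, hm⟩ := h
  have h1 := D.pipeStep_iterate_fixed n _ (D.edgeHeight_borderEdge e)
  have h2 : D.pipeStep^[m + n] (D.borderEdge e) = D.pipeStep^[n] (D.borderEdge e) := by
    rw [Function.iterate_add_apply, Function.iterate_fixed h1]
  rw [add_comm, Function.iterate_add_apply, hm, Function.iterate_fixed ht] at h2
  rw [pipe, ← h2]

theorem flows_left (r : Fin k) (a : ℕ) (ha : a < n - k + 1) (h : ∀ c < a, ((r : ℕ), c) ∉ D.plus) :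
    D.Flows (Sum.inl (r, ⟨a, ha⟩)) (Sum.inl (r, ⟨0, Nat.succ_pos _⟩)) := by
  induction a with
  | zero => exact Flows.refl _
  | succ a ih =>
    exact Flows.step (if_neg (h a (Nat.lt_succ_self a)))
      (ih (by omega) fun c hc => h c (hc.trans (Nat.lt_succ_self a)))

theorem flows_up (c : Fin (n - k)) (a b : ℕ) (hab : a ≤ b) (hb : b < k + 1)
    (h : ∀ r < b, a ≤ r → (r, (c : ℕ)) ∉ D.plus) :
    D.Flows (Sum.inr (⟨b, hb⟩, c)) (Sum.inr (⟨a, hab.trans_lt hb⟩, c)) := by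
  induction b with
  | zero =>
    obtain rfl : a = 0 := by omega
    exact Flows.refl _
  | succ b ih =>
    rcases hab.lt_or_eq with hlt | rfl
    · exact Flows.step (if_neg (h b (Nat.lt_succ_self b) (by omega)))
        (ih (by omega) (by omega) fun r hr => h r (hr.trans (Nat.lt_succ_self b)))
    · exact Flows.refl _

/-- After the elbow the pipe heads left and meets no further `+`, since a `+` can only be at the
right end of its row. -/
theorem flows_turn (hD : D.InClosure) (r : Fin k) (c : Fin (n - k)) (hp : ((r : ℕ), (c : ℕ)) ∈ D.plus) :
    D.Flows (Sum.inr (⟨r + 1, Nat.succ_lt_succ r.2⟩, c)) (Sum.inl (r, ⟨0, Nat.succ_pos _⟩)) := by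
  refine Flows.step (if_pos hp) (flows_left r c _ fun d hd hd' => ?_)
  have h1 := hD.2 _ _ hp
  have h2 := hD.2 _ _ hd'
  omega

theorem perm_vLabel (r : Fin k) (e : Fin k ⊕ Fin (n - k)) (h : D.pipe (Sum.inl r) = e) :
    D.decoratedPerm.perm (D.vLabel r) = D.stepLabel e := by
  have : D.stepEquiv.symm (D.vLabel r) = Sum.inl r := by
    rw [Equiv.symm_apply_eq]
    rfl
  simp only [decoratedPerm, Equiv.trans_apply, this, Equiv.ofBijective_apply, h]
  rfl

theorem perm_hLabel (c : Fin (n - k)) (e : Fin k ⊕ Fin (n - k)) (h : D.pipe (Sum.inr c) = e) :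
    D.decoratedPerm.perm (D.hLabel c) = D.stepLabel e := by
  have : D.stepEquiv.symm (D.hLabel c) = Sum.inr c := by
    rw [Equiv.symm_apply_eq]
    rfl
  simp only [decoratedPerm, Equiv.trans_apply, this, Equiv.ofBijective_apply, h]
  rfl

theorem perm_of_mem_coloopSet {x : Fin n} (hx : x ∈ D.coloopSet) : D.decoratedPerm.perm x = x := by
  obtain ⟨r, rfl, hr⟩ := hx
  exact perm_vLabel r _ (Flows.pipe_eq (flows_left r _ _ fun c _ => hr c) rfl)

theorem flows_vertical (hD : D.InClosure) {r : Fin k} {c : Fin (n - k)} (hr : ¬ D.IsZeroRow r)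
    (hc : (c : ℕ) + 1 = D.shape.rowLen r) :
    D.Flows (D.borderEdge (Sum.inl r)) (Sum.inr (⟨r, Nat.lt_succ_of_lt r.2⟩, c)) := by
  refine ⟨1, ?_⟩
  have h1 : D.borderEdge (Sum.inl r) = Sum.inl (r, ⟨c + 1, Nat.succ_lt_succ c.2⟩) := by
    simp only [borderEdge, Sum.map_inl, hc]
  rw [h1]
  exact if_pos (hD.mem_plus_iff.2 ⟨hr, hc⟩)

/-- A row without `+` is the first one of its length. -/
def ZeroRowsFirst (D : LeDiagram k n) : Prop :=
  ∀ r : ℕ, D.IsZeroRow (r + 1) → r + 1 < k → D.shape.rowLen (r + 1) < D.shape.rowLen r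

/-- A `+` in column `c` above row `a` lies in a row of length `c + 1`. By monotonicity row `a - 1`
has this length too, hence contains no `+`; being the first row of its length, it would have to be
the row of the `+` itself. -/
theorem notMem_plus_of_zeroRowsFirst (hD : D.InClosure) (hz : D.ZeroRowsFirst) {a c : ℕ}
    (hak : a ≤ k) (ha : ∀ r < a, c + 1 ≤ D.shape.rowLen r)
    (h : ∀ r, r + 1 = a → D.shape.rowLen r = c + 1 → D.IsZeroRow r) (r : ℕ) (hr : r < a) :
    (r, c) ∉ D.plus := by
  intro hp
  have h1 := hD.2 _ _ hp
  obtain ⟨s, rfl⟩ : ∃ s, a = s + 1 := ⟨a - 1, by omega⟩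
  have h2 := D.shape.rowLen_anti r s (by omega)
  have h3 := ha s (by omega)
  have h4 := h s rfl (by omega)
  rcases Nat.lt_or_ge r s with hl | hl
  · obtain ⟨t, rfl⟩ : ∃ t, s = t + 1 := ⟨s - 1, by omega⟩
    have := hz t h4 (by omega)
    have := D.shape.rowLen_anti r t (by omega)
    omega
  · obtain rfl : r = s := by omega
    exact h4 _ hp

/-- The row of `y` ends in the column in which the pipe from `x` goes up (after an immediate turn if
`x` is vertical). The first box it meets there is the `+` of that row, which sends it left to `y`.
-/
theorem perm_eq_pred (hD : D.InClosure) {x y : Fin n} (hxy : (y : ℕ) + 1 = x)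
    (hx : x ∉ D.coloopSet) (hy : (y : ℕ) ∉ D.hor) (hy' : y ∉ D.coloopSet) :
    D.decoratedPerm.perm x = y := by
  obtain ⟨r, rfl⟩ := D.exists_vLabel_eq hy
  rw [mem_coloopSet_iff] at hy'
  have hcount : D.horCount x = D.horCount (D.vLabel r) := by
    rw [← hxy, horCount_succ_of_notMem _ hy]
  rw [horCount_vLabel] at hcount
  have hr := D.rowLen_le r
  have hpos : D.shape.rowLen r ≠ 0 := fun h => hy' (isZeroRow_of_rowLen_eq_zero h)
  by_cases hxh : (x : ℕ) ∈ D.hor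
  · obtain ⟨c, hc⟩ := hxh
    obtain rfl : D.hLabel c = x := Fin.ext hc
    rw [horCount_hLabel] at hcount
    have hcn := c.2
    have hrc : (c : ℕ) + 1 = D.shape.rowLen r := by omega
    refine perm_hLabel c (Sum.inl r) ?_
    refine Flows.pipe_eq ?_ rfl (t := Sum.inl (r, ⟨0, Nat.succ_pos _⟩))
    have h1 : D.borderEdge (Sum.inr c) = Sum.inr (⟨r + 1, Nat.succ_lt_succ r.2⟩, c) := by
      have : D.shape.colLen c = r + 1 := by
        simp only [vLabel, hLabel] at hxy
        omega
      simp only [borderEdge, Sum.map_inr, this]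
    rw [h1]
    exact flows_turn hD r c (hD.mem_plus_iff.2 ⟨hy', hrc⟩)
  · obtain ⟨s, rfl⟩ := D.exists_vLabel_eq hxh
    rw [mem_coloopSet_iff] at hx
    rw [horCount_vLabel] at hcount
    have hs := D.rowLen_le s
    have hspos : D.shape.rowLen s ≠ 0 := fun h => hx (isZeroRow_of_rowLen_eq_zero h)
    have hrs : (s : ℕ) = r + 1 := by
      simp only [vLabel] at hxy
      omega
    refine perm_vLabel s (Sum.inl r) ?_
    refine Flows.pipe_eq ?_ rfl (t := Sum.inl (r, ⟨0, Nat.succ_pos _⟩))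
    refine (flows_vertical hD (c := ⟨D.shape.rowLen s - 1, by omega⟩) hx ?_).trans ?_
    · simp only
      omega
    · have := congrArg D.shape.rowLen hrs
      simp only [hrs]
      exact flows_turn hD r _ (hD.mem_plus_iff.2 ⟨hy', by simp only; omega⟩)

/-- The pipe rises in the column whose horizontal step closes the interval of `x`, and meets no `+`
on its way to the top. The equality of counts identifies this horizontal step. -/
theorem perm_mem_hor (hD : D.InClosure) (hz : D.ZeroRowsFirst) {x : Fin n} (hx : x ∉ D.coloopSet)
    (h : ∀ y : Fin n, (y : ℕ) + 1 = x → (y : ℕ) ∈ D.hor ∨ y ∈ D.coloopSet) :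
    (D.decoratedPerm.perm x : ℕ) ∈ D.hor ∧ D.horCount (D.decoratedPerm.perm x) = D.horCount x := by
  have hlast : ∀ r : Fin k, (D.vLabel r : ℕ) + 1 = x → D.IsZeroRow r := fun r hr =>
    (mem_coloopSet_iff D r).1 ((h _ hr).resolve_left (D.vLabel_notMem_hor r))
  by_cases hxh : (x : ℕ) ∈ D.hor
  · obtain ⟨c, hc⟩ := hxh
    obtain rfl : D.hLabel c = x := Fin.ext hc
    have hcol := D.colLen_le c
    have hno := notMem_plus_of_zeroRowsFirst hD hz (a := D.shape.colLen c) (c := c) hcol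
      (fun r hr => (D.lt_rowLen_iff_lt_colLen r c).2 hr) (fun r hr hl =>
        hlast ⟨r, by omega⟩ (by
          have := c.2
          simp only [vLabel, hLabel]
          omega))
    have : D.pipe (Sum.inr c) = Sum.inr c :=
      Flows.pipe_eq (flows_up c 0 _ (Nat.zero_le _) (by omega) fun r hr _ => hno r hr) rfl
        (t := Sum.inr (⟨0, Nat.succ_pos _⟩, c))
    rw [perm_hLabel c _ this]
    exact ⟨D.hLabel_mem_hor c, rfl⟩
  · obtain ⟨s, rfl⟩ := D.exists_vLabel_eq hxh
    rw [mem_coloopSet_iff] at hx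
    have hs := D.rowLen_le s
    have hspos : D.shape.rowLen s ≠ 0 := fun h => hx (isZeroRow_of_rowLen_eq_zero h)
    set c : Fin (n - k) := ⟨D.shape.rowLen s - 1, by omega⟩ with hcdef
    have hc : (c : ℕ) + 1 = D.shape.rowLen s := by simp only [hcdef]; omega
    have hsk := s.2
    have hno := notMem_plus_of_zeroRowsFirst hD hz (a := s) (c := c) hsk.le
      (fun r hr => hc ▸ D.shape.rowLen_anti r s hr.le) (fun r hr hl =>
        hlast ⟨r, by omega⟩ (by
          simp only [vLabel]
          omega))
    have : D.pipe (Sum.inl s) = Sum.inr c :=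
      Flows.pipe_eq ((flows_vertical hD hx hc).trans
        (flows_up c 0 _ (Nat.zero_le _) (by omega) fun r hr _ => hno r hr)) rfl
    rw [perm_vLabel s _ this]
    refine ⟨D.hLabel_mem_hor c, ?_⟩
    change D.horCount (D.hLabel c) = _
    rw [horCount_hLabel, horCount_vLabel]
    omega

/-! ### Decorated permutations of maximal diagrams -/

theorem le_of_horCount_le {x y : ℕ} (hy : y ∈ D.hor) (h : D.horCount x ≤ D.horCount y) : x ≤ y := by
  by_contra hl
  have := D.horCount_mono (show y + 1 ≤ x by omega)
  rw [horCount_succ_of_mem _ hy] at this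
  omega

theorem IsMaximal.zeroRowsFirst (hD : D.IsMaximal) : D.ZeroRowsFirst :=
  fun r h hr => absurd h (hD.not_isZeroRow ⟨r + 1, hr⟩)

theorem IsMaximal.perm_eq_pred (hD : D.IsMaximal) {x y : Fin n} (hxy : (y : ℕ) + 1 = x)
    (hy : (y : ℕ) ∉ D.hor) : D.decoratedPerm.perm x = y :=
  LeDiagram.perm_eq_pred hD.inClosure hxy (by simp [hD.coloopSet_eq]) hy (by simp [hD.coloopSet_eq])

theorem IsMaximal.perm_mem_hor (hD : D.IsMaximal) {x : Fin n}
    (h : ∀ y : Fin n, (y : ℕ) + 1 = x → (y : ℕ) ∈ D.hor) :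
    (D.decoratedPerm.perm x : ℕ) ∈ D.hor ∧ D.horCount (D.decoratedPerm.perm x) = D.horCount x :=
  LeDiagram.perm_mem_hor hD.inClosure hD.zeroRowsFirst (by simp [hD.coloopSet_eq])
    fun y hy => Or.inl (h y hy)

theorem exists_pred_notMem_hor {x : Fin n}
    (h : ¬ ∀ y : Fin n, (y : ℕ) + 1 = x → (y : ℕ) ∈ D.hor) :
    ∃ y : Fin n, (y : ℕ) + 1 = x ∧ (y : ℕ) ∉ D.hor := by
  push Not at h
  exact h

theorem IsMaximal.perm_eq_of_mem (hD : D.IsMaximal) {x y : Fin n}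
    (h : ∀ y : Fin n, (y : ℕ) + 1 = x → (y : ℕ) ∈ D.hor) (hy : (y : ℕ) ∈ D.hor)
    (hxy : D.horCount y = D.horCount x) : D.decoratedPerm.perm x = y := by
  obtain ⟨h1, h2⟩ := hD.perm_mem_hor h
  exact Fin.ext (D.eq_of_mem_hor_of_horCount_eq h1 hy (h2.trans hxy.symm))

theorem IsMaximal.white_eq (hD : D.IsMaximal) : D.decoratedPerm.white = ∅ := by
  rw [Set.eq_empty_iff_forall_notMem]
  rintro x hx
  have h1 := D.decoratedPerm.white_fixed x hx
  obtain ⟨⟨r, rfl⟩, -⟩ := hx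
  by_cases h : ∀ y : Fin n, (y : ℕ) + 1 = D.vLabel r → (y : ℕ) ∈ D.hor
  · have := (hD.perm_mem_hor h).1
    rw [h1] at this
    exact D.vLabel_notMem_hor r this
  · obtain ⟨y, hy, hy'⟩ := exists_pred_notMem_hor h
    rw [hD.perm_eq_pred hy hy'] at h1
    rw [h1] at hy
    omega

/-- A step is the first one of its interval if the pipe starting there ends at a horizontal step. -/
theorem IsMaximal.perm_mem_hor_iff (hD : D.IsMaximal) {x : Fin n} :
    (D.decoratedPerm.perm x : ℕ) ∈ D.hor ↔ ∀ y : Fin n, (y : ℕ) + 1 = x → (y : ℕ) ∈ D.hor := by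
  constructor
  · intro h
    by_contra hc
    obtain ⟨y, hy, hy'⟩ := exists_pred_notMem_hor hc
    rw [hD.perm_eq_pred hy hy'] at h
    exact hy' h
  · exact fun h => (hD.perm_mem_hor h).1

/-- The permutation is a cycle on each interval, and its inversions are the pairs formed by the
first element of an interval and a later element of it. Taking the predecessor of the later element
gives one inversion for each vertical step. -/
theorem IsMaximal.inversions_eq (hD : D.IsMaximal) : inversions D.decoratedPerm.perm = k := by
  set p := D.decoratedPerm.perm with hp
  have hlt : ∀ r : Fin k, (D.vLabel r : ℕ) + 1 < n := by
    intro r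
    by_contra h
    exact D.vLabel_notMem_hor r (hD.last_mem_hor (by omega))
  -- The column in which row `r` ends closes the interval of its vertical step.
  have hcol : ∀ r : Fin k, ∃ c, D.horCount (D.hLabel c) = D.horCount (D.vLabel r) := by
    intro r
    have h1 := hD.rowLen_pos r
    have h2 := D.rowLen_le r
    refine ⟨⟨D.shape.rowLen r - 1, by omega⟩, ?_⟩
    rw [horCount_hLabel, horCount_vLabel]
    simp only
    omega
  choose q hq using hcol
  have key : (Finset.univ.filter fun x : Fin n × Fin n => x.1 < x.2 ∧ p x.2 < p x.1) =
      Finset.univ.image fun r : Fin k => (p⁻¹ (D.hLabel (q r)), (⟨D.vLabel r + 1, hlt r⟩ : Fin n)) := by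
    ext ⟨x, y⟩
    simp only [Finset.mem_filter, Finset.mem_univ, true_and, Finset.mem_image, Prod.mk.injEq]
    constructor
    · rintro ⟨hxy, hpxy⟩
      rw [Fin.lt_def] at hxy hpxy
      -- Otherwise `p x = x - 1`, whereas always `p y ≥ y - 1`, so the pair would not be inverted.
      have hx : (p x : ℕ) ∈ D.hor := by
        by_contra h
        rw [hp, hD.perm_mem_hor_iff] at h
        obtain ⟨z, hz, hz'⟩ := exists_pred_notMem_hor h
        rw [hp, hD.perm_eq_pred hz hz'] at hpxy
        by_cases hy : ∀ w : Fin n, (w : ℕ) + 1 = y → (w : ℕ) ∈ D.hor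
        · have h1 := hD.perm_mem_hor hy
          have := le_of_horCount_le h1.1 h1.2.ge
          omega
        · obtain ⟨w, hw, hw'⟩ := exists_pred_notMem_hor hy
          rw [hD.perm_eq_pred hw hw'] at hpxy
          omega
      have hx1 := (hD.perm_mem_hor (hD.perm_mem_hor_iff.1 hx)).2
      by_cases hy : ∀ w : Fin n, (w : ℕ) + 1 = y → (w : ℕ) ∈ D.hor
      · exfalso
        have h1 := hD.perm_mem_hor hy
        have h2 := hy ⟨y - 1, by omega⟩ (by simp only; omega)
        have h3 := D.horCount_succ_of_mem h2
        have h4 := D.horCount_mono (show (x : ℕ) ≤ y - 1 by omega)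
        have h5 := D.horCount_mono hpxy.le
        simp only [show (y : ℕ) - 1 + 1 = y by omega] at h3
        rw [← hp] at h1 hx1
        omega
      · obtain ⟨z, hz, hz'⟩ := exists_pred_notMem_hor hy
        have hpy := hD.perm_eq_pred hz hz'
        obtain ⟨r, rfl⟩ := D.exists_vLabel_eq hz'
        refine ⟨r, ?_, Fin.ext hz⟩
        rw [Equiv.Perm.inv_eq_iff_eq]
        refine Fin.ext (D.eq_of_mem_hor_of_horCount_eq (D.hLabel_mem_hor _) hx ?_)
        rw [hq, hp, hx1]
        rw [← hp] at hpy
        rw [hpy] at hpxy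
        have h1 := D.horCount_mono hpxy.le
        have h2 := D.horCount_mono hxy.le
        rw [← hz, horCount_succ_of_notMem _ hz'] at h2
        rw [← hp] at hx1
        omega
    · rintro ⟨r, rfl, rfl⟩
      have hpy : p ⟨D.vLabel r + 1, hlt r⟩ = D.vLabel r := hD.perm_eq_pred rfl (D.vLabel_notMem_hor r)
      have hpx : p (p⁻¹ (D.hLabel (q r))) = D.hLabel (q r) := by
        rw [← Equiv.Perm.mul_apply, mul_inv_cancel, Equiv.Perm.one_apply]
      set x := p⁻¹ (D.hLabel (q r)) with hxdef
      have hvh : (D.vLabel r : ℕ) < D.hLabel (q r) :=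
        lt_of_le_of_ne (le_of_horCount_le (D.hLabel_mem_hor _) (hq r).ge) fun h =>
          D.vLabel_ne_hLabel _ _ (Fin.ext h)
      have hst : ∀ y : Fin n, (y : ℕ) + 1 = x → (y : ℕ) ∈ D.hor := by
        rw [← hD.perm_mem_hor_iff, ← hp, hpx]
        exact D.hLabel_mem_hor _
      have hx1 := (hD.perm_mem_hor hst).2
      rw [← hp, hpx, hq] at hx1
      refine ⟨?_, by rw [hpx, hpy]; exact hvh⟩
      rw [Fin.lt_def]
      simp only
      by_contra hle
      rcases (not_lt.1 hle).lt_or_eq with hl | hl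
      · have h2 := hst ⟨x - 1, by omega⟩ (by simp only; omega)
        have h3 := D.horCount_succ_of_mem h2
        have h4 := D.horCount_mono (show (D.vLabel r : ℕ) ≤ x - 1 by omega)
        simp only [show (x : ℕ) - 1 + 1 = x by omega] at h3
        omega
      · have : (⟨D.vLabel r + 1, hlt r⟩ : Fin n) = x := Fin.ext hl
        rw [this, hpx] at hpy
        exact D.vLabel_ne_hLabel _ _ hpy.symm
  rw [inversions, key, Finset.card_image_of_injective, Finset.card_univ, Fintype.card_fin]
  intro r s hrs
  have := congrArg Fin.val (congrArg Prod.snd hrs)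
  exact D.vLabel_injective (Fin.ext (by simpa using this))

end LeDiagram

namespace LeDiagram

variable {k n : ℕ} {D E F : LeDiagram k n}

/-! ### Facets -/

theorem coloopSet_eq_image (D : LeDiagram k n) :
    D.coloopSet = D.vLabel '' {r | D.IsZeroRow r} := by
  ext x
  simp only [coloopSet, Set.mem_ofPred_eq, Set.mem_image]
  exact exists_congr fun r => and_comm

theorem InClosure.dim_add_ncard (hD : D.InClosure) : D.dim + D.coloopSet.ncard = k := by
  classical
  have h1 : D.plus = ((Finset.univ : Finset (Fin k)).filter fun r : Fin k => ¬ D.IsZeroRow r).image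
      fun r : Fin k => ((r : ℕ), D.shape.rowLen r - 1) := by
    ext ⟨r, c⟩
    simp only [Finset.mem_image, Finset.mem_filter, Finset.mem_univ, true_and, Prod.mk.injEq]
    rw [hD.mem_plus_iff]
    constructor
    · rintro ⟨h, hc⟩
      have hr : r < k := by
        by_contra hr
        exact h (isZeroRow_of_le (not_lt.1 hr))
      exact ⟨⟨r, hr⟩, h, rfl, by simp only; omega⟩
    · rintro ⟨s, h, rfl, rfl⟩
      refine ⟨h, Nat.sub_add_cancel (Nat.one_le_iff_ne_zero.2 fun h0 => ?_)⟩
      exact h (isZeroRow_of_rowLen_eq_zero h0)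
  have h2 : D.dim = ((Finset.univ : Finset (Fin k)).filter fun r : Fin k => ¬ D.IsZeroRow r).card := by
    rw [dim, h1, Finset.card_image_of_injective]
    intro r s hrs
    exact Fin.ext (congrArg Prod.fst hrs)
  have h3 : D.coloopSet.ncard = ((Finset.univ : Finset (Fin k)).filter fun r : Fin k => D.IsZeroRow r).card := by
    rw [coloopSet_eq_image, Set.ncard_image_of_injective _ D.vLabel_injective,
      ← Set.ncard_coe_finset]
    simp
  rw [h2, h3, add_comm, Finset.card_filter_add_card_filter_not, Finset.card_univ, Fintype.card_fin]

/-- `F` is obtained from `D` by replacing the `+` in the row with the label `i` by a `0`. -/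
structure IsFacetAt (D F : LeDiagram k n) (i : Fin n) : Prop where
  inClosure : F.InClosure
  shape_eq : F.shape = D.shape
  coloopSet_eq : F.coloopSet = {i}

/-- Replace the `+` in row `r` by a `0`. -/
def zeroRow (D : LeDiagram k n) (hD : D.PlusAtRightEnd) (r : ℕ) : LeDiagram k n where
  shape := D.shape
  plus := D.plus.filter fun b => b.1 ≠ r
  k_le_n := D.k_le_n
  shape_le := D.shape_le
  plus_subset := (Finset.filter_subset _ _).trans D.plus_subset
  le_property := by
    -- A `+` at the right end of its row has no box to its right, so the condition is vacuous.
    rintro s c hs - ⟨c', hc', h⟩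
    have h1 := hD s c' (Finset.mem_filter.1 h).1
    rw [YoungDiagram.mem_iff_lt_rowLen] at hs
    omega

theorem IsMaximal.isFacetAt_zeroRow (hD : D.IsMaximal) (r : Fin k) :
    D.IsFacetAt (D.zeroRow hD.2 r) (D.vLabel r) := by
  refine ⟨⟨fun s hs => ?_, fun s c h => hD.2 s c (Finset.mem_filter.1 h).1⟩, rfl, ?_⟩
  · refine le_trans ?_ (hD.1 s hs).le
    exact Finset.card_le_card (Finset.filter_subset_filter _ (Finset.filter_subset _ _))
  · have h : {s : Fin k | (D.zeroRow hD.2 r).IsZeroRow s} = {r} := by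
      ext s
      rw [Set.mem_ofPred_eq, Set.mem_singleton_iff]
      constructor
      · intro h
        by_contra hs
        obtain ⟨c, hc⟩ := D.exists_plus_of_not_isZeroRow (hD.not_isZeroRow s)
        exact h c (Finset.mem_filter.2 ⟨hc, fun h => hs (Fin.ext h)⟩)
      · rintro rfl c hc
        exact (Finset.mem_filter.1 hc).2 rfl
    rw [coloopSet_eq_image, h, Set.image_singleton]
    rfl

theorem IsFacetAt.isZeroRow_iff {i : Fin n} (h : D.IsFacetAt F i) (r : Fin k) :
    F.IsZeroRow r ↔ D.vLabel r = i := by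
  rw [← mem_coloopSet_iff, h.coloopSet_eq, vLabel_eq_of_shape_eq h.shape_eq, Set.mem_singleton_iff]

theorem IsFacetAt.unique {i : Fin n} (h : D.IsFacetAt F i) {G : LeDiagram k n}
    (h' : D.IsFacetAt G i) : F = G :=
  ext_of_shape h.inClosure h'.inClosure (h.shape_eq.trans h'.shape_eq.symm) fun r => by
    rw [h.isZeroRow_iff, h'.isZeroRow_iff]

theorem IsFacetAt.dim_add_one {i : Fin n} (h : D.IsFacetAt F i) : F.dim + 1 = k := by
  have := h.inClosure.dim_add_ncard
  rwa [h.coloopSet_eq, Set.ncard_singleton] at this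

theorem signHat_eq_of_hor_eq (h : D.hor = E.hor) (x : ℕ) : D.signHat x = E.signHat x := by
  rw [signHat_eq, signHat_eq, horCount_eq_of_hor h]

theorem IsFacetAt.sigma_eq {i : Fin n} (h : D.IsFacetAt F i) (hD : D.IsMaximal) :
    F.sigma = Function.update D.sigma i 0 := by
  funext x
  by_cases hx : x = i
  · subst hx
    rw [Function.update_self]
    exact sigma_of_mem (by rw [h.coloopSet_eq]; rfl)
  · rw [Function.update_of_ne hx, hD.sigma_eq, sigma_of_notMem (by rw [h.coloopSet_eq]; exact hx),
      signHat_eq_of_hor_eq (hor_eq_of_shape_eq h.shape_eq)]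

theorem Shift.update_sigma_eq {i : Fin n} (h : Shift D E i) (hD : D.IsMaximal) (hE : E.IsMaximal) :
    Function.update D.sigma i 0 = Function.update E.sigma i 0 := by
  funext x
  by_cases hx : x = i
  · rw [hx, Function.update_self, Function.update_self]
  · rw [Function.update_of_ne hx, Function.update_of_ne hx, hD.sigma_eq, hE.sigma_eq]
    by_contra hne
    exact hx (Fin.ext ((h.signHat_ne_iff x).1 hne))

/-- Off `i` the signs of the two Young diagrams agree. The sign hidden by the zero at `i` is
opposite to the next one, because `i` is vertical for both diagrams; so the borders coincide. -/
theorem isFacetAt_of_sigma_eq (hD : D.IsMaximal) (hF : F.InClosure) {i : Fin n}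
    (hi : (i : ℕ) ∉ D.hor) (h : F.sigma = Function.update D.sigma i 0) : D.IsFacetAt F i := by
  have hC : F.coloopSet = {i} := by
    ext x
    rw [← sigma_eq_zero_iff, h, Set.mem_singleton_iff]
    by_cases hx : x = i
    · simp [hx]
    · rw [Function.update_of_ne hx, hD.sigma_eq]
      exact iff_of_false (D.signHat_ne_zero _) hx
  have hiF : (i : ℕ) ∉ F.hor := notMem_hor_of_mem_coloopSet (by rw [hC]; rfl)
  have hin : (i : ℕ) + 1 < n := by
    by_contra hc
    exact hi (hD.last_mem_hor (by omega))
  have hne : ∀ x : ℕ, x < n → x ≠ i → F.signHat x = D.signHat x := by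
    intro x hx hxi
    have h1 := congrFun h ⟨x, hx⟩
    have hxi' : (⟨x, hx⟩ : Fin n) ≠ i := fun h => hxi (congrArg Fin.val h)
    rwa [Function.update_of_ne hxi', hD.sigma_eq, sigma_of_notMem (by rw [hC]; exact hxi')] at h1
  have hs : ∀ G : LeDiagram k n, (i : ℕ) ∉ G.hor → G.signHat i = -G.signHat (i + 1) := by
    intro G hG
    rw [signHat_eq, signHat_eq, horCount_succ_of_notMem _ hG, add_right_comm, pow_succ, mul_neg,
      mul_one, neg_neg]
  have hall : ∀ x : ℕ, x < n → F.signHat x = D.signHat x := by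
    intro x hx
    by_cases hxi : x = i
    · rw [hxi, hs F hiF, hs D hi, hne _ hin (by omega)]
    · exact hne x hx hxi
  refine ⟨hF, shape_eq_of_hor_eq (eq_of_hor_subset fun x hx => ?_), hC⟩
  have hxn := F.lt_of_mem_hor hx
  by_cases hx1 : x + 1 < n
  · rw [← signHat_succ_eq_iff] at hx ⊢
    rw [← hall _ hx1, ← hall _ hxn, hx]
  · exact hD.last_mem_hor (by omega)

theorem Shift.exists_isFacetAt {i : Fin n} (h : Shift D E i) (hD : D.IsMaximal) :
    ∃ F, D.IsFacetAt F i := by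
  obtain ⟨r, rfl⟩ := D.exists_vLabel_eq h.left_notMem
  exact ⟨_, hD.isFacetAt_zeroRow r⟩

/-- The row of `b` has the label `i` in `D`; its length is `c` in `D` and `c + 1` in `E`, and all
other rows have equal lengths. Row lengths and rows without `+` then determine all positions of `+`.
-/
theorem Shift.isFacetBy {i : Fin n} (h : Shift D E i) (hD : D.IsMaximal) (hE : E.IsMaximal)
    (hF : D.IsFacetAt F i) {b : ℕ × ℕ} (hb : ShapesDifferBy D E b) :
    IsFacetBy D F b ∧ IsFacetBy E F b := by
  obtain ⟨c, hc1, hc2, hins, hnot⟩ := h.exists_column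
  have hbc : b = (D.shape.colLen c, (c : ℕ)) := by
    have := (shapesDifferBy_of_insert hnot hins)
    rw [ShapesDifferBy, hb] at this
    exact Finset.singleton_injective this
  subst hbc
  set r := D.shape.colLen c with hr
  have hmem : ∀ r' c', c' < E.shape.rowLen r' ↔ (r' = r ∧ c' = c) ∨ c' < D.shape.rowLen r' := by
    intro r' c'
    rw [← YoungDiagram.mem_iff_lt_rowLen, ← YoungDiagram.mem_iff_lt_rowLen, ← YoungDiagram.mem_cells,
      hins, Finset.mem_insert, YoungDiagram.mem_cells, Prod.mk.injEq]
  have hDr : D.shape.rowLen r = c := by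
    rw [YoungDiagram.mem_iff_lt_rowLen] at hnot
    have h1 := hmem r c
    have h2 := hmem r (c - 1)
    omega
  have hEr : E.shape.rowLen r = c + 1 := by
    have h1 := hmem r c
    have h2 := hmem r (c + 1)
    omega
  have hoth : ∀ r', r' ≠ r → E.shape.rowLen r' = D.shape.rowLen r' := by
    intro r' hr'
    have h1 := hmem r' (E.shape.rowLen r')
    have h2 := hmem r' (D.shape.rowLen r')
    omega
  have hrk : r < k := (E.shape_le _ (YoungDiagram.mem_iff_lt_rowLen.2 (show (c : ℕ) < _ by omega) :
    (r, (c : ℕ)) ∈ E.shape)).1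
  have hlab : D.vLabel ⟨r, hrk⟩ = i := by
    refine Fin.ext ?_
    have := h.pos
    have := c.2
    simp only [hLabel] at hc1
    simp only [vLabel]
    omega
  have hzero : ∀ r', F.IsZeroRow r' ↔ k ≤ r' ∨ r' = r := by
    intro r'
    rcases Nat.lt_or_ge r' k with hl | hl
    · have := hF.isZeroRow_iff ⟨r', hl⟩
      rw [← hlab, D.vLabel_injective.eq_iff, Fin.mk.injEq] at this
      rw [this]
      omega
    · exact iff_of_true (isZeroRow_of_le hl) (Or.inl hl)
  have hmax : ∀ {G : LeDiagram k n}, G.IsMaximal → ∀ r', G.IsZeroRow r' ↔ k ≤ r' := by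
    intro G hG r'
    rcases Nat.lt_or_ge r' k with hl | hl
    · exact iff_of_false (hG.not_isZeroRow ⟨r', hl⟩) (by omega)
    · exact iff_of_true (isZeroRow_of_le hl) hl
  have hbE : (r, (c : ℕ)) ∈ E.shape := YoungDiagram.mem_iff_lt_rowLen.2 (by omega)
  refine ⟨⟨fun h => absurd h hnot, fun _ => ⟨hF.shape_eq, ?_, ?_⟩⟩, fun _ => ⟨?_, ?_, ?_⟩,
    fun h => absurd hbE h⟩
  · have := hD.rowLen_pos ⟨r, hrk⟩
    simp only at this
    change (r, D.shape.rowLen r - 1) ∈ D.plus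
    rw [hD.inClosure.mem_plus_iff, hmax hD]
    omega
  · ext ⟨r', c'⟩
    rw [Finset.mem_erase, Ne, Prod.mk.injEq, hF.inClosure.mem_plus_iff, hD.inClosure.mem_plus_iff, hzero,
      hmax hD, hF.shape_eq]
    have : r' = r → D.shape.rowLen r' = D.shape.rowLen r := congrArg _
    simp only
    omega
  · rw [hins, Finset.erase_insert (by rwa [YoungDiagram.mem_cells]), hF.shape_eq]
  · rw [hE.inClosure.mem_plus_iff, hmax hE]
    omega
  · ext ⟨r', c'⟩
    rw [Finset.mem_erase, Ne, Prod.mk.injEq, hF.inClosure.mem_plus_iff, hE.inClosure.mem_plus_iff, hzero,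
      hmax hE, hF.shape_eq]
    have h1 : r' = r → E.shape.rowLen r' = E.shape.rowLen r := congrArg _
    have h2 := hoth r'
    omega

/-! ### Matroids -/

theorem uniformMatroid_isBase_iff {E : Set (Fin n)} {r : ℕ} (hr : r ≤ E.ncard) (B : Set (Fin n)) :
    (uniformMatroid E r hr).IsBase B ↔ B ⊆ E ∧ B.ncard = r := Iff.rfl

theorem uniformMatroid_ground {E : Set (Fin n)} {r : ℕ} (hr : r ≤ E.ncard) :
    (uniformMatroid E r hr).E = E := rfl

theorem hLabel_mem_block (j : Fin (n - k)) : D.hLabel j.rev ∈ D.block j :=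
  (D.mem_block_iff _ _).2 (Or.inl (D.horCount_hLabel_rev j))

theorem summand_isBase_iff (D : LeDiagram k n) (j : Fin (n - k)) (B : Set (Fin n)) :
    (D.summand j).IsBase (B ∩ D.block j) ↔
      D.block j ∩ D.coloopSet ⊆ B ∧ (D.block j \ B).ncard = 1 := by
  rw [summand, Matroid.disjointSum_isBase_iff, Matroid.freeOn_ground, uniformMatroid_ground,
    uniformMatroid_isBase_iff, Matroid.freeOn_isBase_iff, Set.inter_union_sdiff]
  have hC : B ∩ D.block j ∩ (D.block j ∩ D.coloopSet) = D.block j ∩ D.coloopSet ↔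
      D.block j ∩ D.coloopSet ⊆ B := by
    rw [Set.inter_eq_right]
    exact ⟨fun h => h.trans Set.inter_subset_left,
      fun h => Set.subset_inter h Set.inter_subset_left⟩
  rw [hC]
  refine and_congr_right fun hsub => ?_
  rw [and_iff_left Set.inter_subset_right, and_iff_right Set.inter_subset_right]
  have h1 : B ∩ D.block j ∩ (D.block j \ D.coloopSet) = (D.block j \ D.coloopSet) ∩ B := by
    ext x
    simp only [Set.mem_inter_iff, Set.mem_sdiff]
    tauto
  have h2 : D.block j \ B = (D.block j \ D.coloopSet) \ B := by
    ext x
    have := @hsub x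
    simp only [Set.mem_inter_iff, Set.mem_sdiff] at this ⊢
    tauto
  have h3 := Set.ncard_inter_add_ncard_sdiff_eq_ncard (D.block j \ D.coloopSet) B (Set.toFinite _)
  -- Each block contains its horizontal label, which is not a coloop; so the rank of the uniform
  -- part is a genuine difference.
  have h4 : 0 < (D.block j \ D.coloopSet).ncard :=
    (Set.ncard_pos (Set.toFinite _)).2 ⟨_, hLabel_mem_block j, D.hLabel_notMem_coloopSet _⟩
  rw [h1, h2]
  omega

theorem iUnion_block (D : LeDiagram k n) (hkn : k < n) : ⋃ j, D.block j = Set.univ :=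
  Set.eq_univ_of_forall fun x => Set.mem_iUnion.2 (D.exists_mem_block hkn x)

theorem matroid_ground (D : LeDiagram k n) (hkn : k < n) : D.matroid.E = Set.univ := by
  refine (Matroid.disjointSigma_ground_eq (M := D.summand)).trans ?_
  simp only [summand_ground]
  exact D.iUnion_block hkn

/-- The bases are the complements of those transversals of the interval partition that avoid `C`. In
this form diagrams can be compared interval by interval. -/
theorem matroid_isBase_iff (D : LeDiagram k n) (hkn : k < n) (B : Set (Fin n)) :
    D.matroid.IsBase B ↔ D.coloopSet ⊆ B ∧ ∀ j, (D.block j \ B).ncard = 1 := by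
  refine (Matroid.disjointSigma_isBase_iff (M := D.summand)).trans ?_
  simp only [summand_ground]
  rw [D.iUnion_block hkn, and_iff_left (Set.subset_univ B)]
  simp only [summand_isBase_iff, forall_and]
  refine and_congr_left fun _ => ⟨fun h x hx => ?_, fun h j => Set.inter_subset_right.trans h⟩
  obtain ⟨j, hj⟩ := D.exists_mem_block hkn x
  exact h j ⟨hj, hx⟩

theorem block_eq_of_shape_eq (h : D.shape = E.shape) : D.block = E.block := by
  funext j
  ext x
  rw [mem_block_iff, mem_block_iff, horCount_eq_of_hor (hor_eq_of_shape_eq h)]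

theorem IsFacetAt.turnsIntoColoop {i : Fin n} (h : D.IsFacetAt F i) (hD : D.IsMaximal)
    (hkn : k < n) : TurnsIntoColoop D.matroid F.matroid i := by
  refine ⟨by rw [matroid_ground _ hkn, matroid_ground _ hkn], fun B => ?_⟩
  rw [matroid_isBase_iff _ hkn, matroid_isBase_iff _ hkn, h.coloopSet_eq, hD.coloopSet_eq,
    block_eq_of_shape_eq h.shape_eq, Set.singleton_subset_iff]
  simp [and_comm]

/-- The intervals of `D` and `E` differ only in the place of `i`, which is invisible in the
complement of a base containing `i`. -/
theorem Shift.turnsIntoColoop {i : Fin n} (h : Shift D E i) (hD : D.IsMaximal) (hE : E.IsMaximal)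
    (hF : D.IsFacetAt F i) (hkn : k < n) : TurnsIntoColoop E.matroid F.matroid i := by
  refine ⟨by rw [matroid_ground _ hkn, matroid_ground _ hkn], fun B => ?_⟩
  rw [(hF.turnsIntoColoop hD hkn).2, matroid_isBase_iff _ hkn, matroid_isBase_iff _ hkn,
    hD.coloopSet_eq, hE.coloopSet_eq]
  refine and_congr_left fun hi => and_congr_right fun _ => forall_congr' fun j => ?_
  have : D.block j \ B = E.block j \ B := by
    ext x
    rw [Set.mem_sdiff, Set.mem_sdiff, hD.mem_block_iff, hE.mem_block_iff]
    refine and_congr_left fun hx => ?_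
    rw [h.horCount_eq fun hxi => hx ((Fin.ext hxi : x = i) ▸ hi)]
  rw [this]

/-! ### Adjacency in terms of permutations -/

/-- The interval of `D` that starts with `i, i + 1` loses `i` to the preceding interval, which ended
at `i - 1`. The only changed values are those at `i`, at `i + 1` and at the first element of the
preceding interval. -/
theorem Shift.perm_eq {i : Fin n} (h : Shift D E i) (hD : D.IsMaximal) (hE : E.IsMaximal) :
    E.decoratedPerm.perm = adjSwap n (i - 1) * D.decoratedPerm.perm * adjSwap n i := by
  have hpos := h.pos
  have hin := (h.isInner hD).2
  set a : Fin n := ⟨i - 1, by omega⟩ with ha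
  set b : Fin n := ⟨i + 1, hin⟩ with hb
  have hai : (a : ℕ) + 1 = i := Nat.sub_add_cancel hpos
  have hib : (i : ℕ) + 1 = b := rfl
  have haD : (a : ℕ) ∈ D.hor := h.left_mem
  have haE : (a : ℕ) ∉ E.hor := h.right_notMem
  rw [adjSwap_eq (x := a) (y := i) rfl (by omega), adjSwap_eq (x := i) (y := b) rfl rfl]
  have hne : ∀ {y : Fin n}, y ≠ a → y ≠ i → ((y : ℕ) ∈ D.hor ↔ (y : ℕ) ∈ E.hor) := fun h1 h2 =>
    h.agree _ (fun h => h1 (Fin.ext h)) (fun h => h2 (Fin.ext h))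
  have hstart : ∀ x : Fin n, (x : ℕ) = i → ∀ y : Fin n, (y : ℕ) + 1 = x → (y : ℕ) ∈ D.hor := by
    intro x hx y hy
    rwa [show (y : ℕ) = a by omega]
  have hca : D.horCount i = D.horCount a + 1 := by
    rw [← hai, horCount_succ_of_mem _ haD]
  ext1 x
  rw [Equiv.Perm.mul_apply, Equiv.Perm.mul_apply]
  by_cases hxi : x = i
  · subst hxi
    rw [Equiv.swap_apply_left, hD.perm_eq_pred hib h.left_notMem, Equiv.swap_apply_right]
    exact hE.perm_eq_pred hai haE
  by_cases hxb : x = b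
  · subst hxb
    rw [Equiv.swap_apply_right]
    obtain ⟨h1, h2⟩ := hD.perm_mem_hor (hstart i rfl)
    set y := D.decoratedPerm.perm i
    have hya : y ≠ a := by
      intro hy
      rw [hy] at h2
      omega
    have hyi : y ≠ i := fun hy => h.left_notMem (hy ▸ h1)
    rw [Equiv.swap_apply_of_ne_of_ne hya hyi]
    refine hE.perm_eq_of_mem (fun z hz => ?_) ((hne hya hyi).1 h1) ?_
    · rw [show (z : ℕ) = i by omega]
      exact h.right_mem
    · rw [← h.horCount_eq (fun h => hyi (Fin.ext h)), ← h.horCount_eq (by omega : (b : ℕ) ≠ i), h2,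
        ← hib, horCount_succ_of_notMem _ h.left_notMem]
  rw [Equiv.swap_apply_of_ne_of_ne hxi hxb]
  have hpred : ∀ y : Fin n, (y : ℕ) + 1 = x → y ≠ a ∧ y ≠ i := by
    intro y hy
    refine ⟨fun h => hxi (Fin.ext ?_), fun h => hxb (Fin.ext ?_)⟩
    · rw [← hy, h, hai]
    · rw [← hy, h, hib]
  by_cases hx : ∀ y : Fin n, (y : ℕ) + 1 = x → (y : ℕ) ∈ D.hor
  · have hxE : ∀ y : Fin n, (y : ℕ) + 1 = x → (y : ℕ) ∈ E.hor := fun y hy =>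
      (hne (hpred y hy).1 (hpred y hy).2).1 (hx y hy)
    have hcx := h.horCount_eq (fun h => hxi (Fin.ext h) : (x : ℕ) ≠ i)
    obtain ⟨h1, h2⟩ := hD.perm_mem_hor hx
    set y := D.decoratedPerm.perm x
    have hyi : y ≠ i := fun hy => h.left_notMem (hy ▸ h1)
    by_cases hya : y = a
    · rw [hya, Equiv.swap_apply_left]
      refine hE.perm_eq_of_mem hxE h.right_mem ?_
      rw [← hcx, ← h2, hya]
      have := h.horCount_self
      omega
    · rw [Equiv.swap_apply_of_ne_of_ne hya hyi]
      refine hE.perm_eq_of_mem hxE ((hne hya hyi).1 h1) ?_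
      rw [← h.horCount_eq (fun h => hyi (Fin.ext h)), h2, hcx]
  · obtain ⟨y, hy, hy'⟩ := exists_pred_notMem_hor hx
    obtain ⟨h1, h2⟩ := hpred y hy
    rw [hD.perm_eq_pred hy hy', Equiv.swap_apply_of_ne_of_ne h1 h2]
    exact hE.perm_eq_pred hy (mt (hne h1 h2).2 hy')

theorem IsMaximal.mem_hor_iff_perm (hD : D.IsMaximal) {x y : Fin n} (hxy : (y : ℕ) + 1 = x) :
    (y : ℕ) ∈ D.hor ↔ D.decoratedPerm.perm x ≠ y := by
  constructor
  · intro h hp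
    have h1 := (hD.perm_mem_hor (x := x) fun z hz => by rwa [show (z : ℕ) = y by omega]).2
    rw [hp, ← hxy, horCount_succ_of_mem _ h] at h1
    omega
  · intro h
    by_contra hy
    exact h (hD.perm_eq_pred hxy hy)

/-- The test `π(x + 1) = x` for vertical labels is not affected by the two transpositions unless `x`
is `i - 1` or `i`. -/
theorem permsDifferAt_iff (hD : D.IsMaximal) (hE : E.IsMaximal) (hne : D ≠ E) (i : Fin n) :
    PermsDifferAt D E i ↔ Shift D E i ∨ Shift E D i := by
  constructor
  · rintro ⟨⟨hi, hi'⟩, h⟩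
    refine shift_or_shift hi (fun h => hne (hD.eq_of_hor_eq hE h))
      (agree_of_agree_below hD hE fun x hx h1 h2 => ?_)
    rw [adjSwap_eq (a := (i : ℕ) - 1) (x := ⟨i - 1, by omega⟩) (y := i) rfl (by omega),
      adjSwap_eq (x := i) (y := ⟨i + 1, hi'⟩) rfl rfl] at h
    have hx1 : (⟨x, by omega⟩ : Fin n) ≠ ⟨i - 1, by omega⟩ := fun h => h1 (congrArg Fin.val h)
    have hx2 : (⟨x, by omega⟩ : Fin n) ≠ i := fun h => h2 (congrArg Fin.val h)
    have hsw : Equiv.swap i ⟨i + 1, hi'⟩ ⟨x + 1, hx⟩ = ⟨x + 1, hx⟩ := by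
      refine Equiv.swap_apply_of_ne_of_ne (fun h => ?_) (fun h => ?_)
      · have := congrArg Fin.val h
        simp only at this
        omega
      · have := congrArg Fin.val h
        simp only at this
        omega
    rw [hD.mem_hor_iff_perm (x := ⟨x + 1, hx⟩) (y := ⟨x, by omega⟩) rfl,
      hE.mem_hor_iff_perm (x := ⟨x + 1, hx⟩) (y := ⟨x, by omega⟩) rfl, h, Equiv.Perm.mul_apply,
      Equiv.Perm.mul_apply, hsw, Ne, Ne, Equiv.swap_apply_eq_iff, Equiv.swap_apply_of_ne_of_ne hx1 hx2]
  · rintro (h | h)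
    · exact ⟨h.isInner hD, h.perm_eq hD hE⟩
    · refine ⟨h.isInner hE, ?_⟩
      rw [h.perm_eq hE hD]
      simp only [← mul_assoc, adjSwap_mul_self, one_mul]
      rw [mul_assoc, adjSwap_mul_self, mul_one]

/-- Deleting the `+` takes `i` out of its cycle: `i` becomes fixed, and `i + 1` takes over as the
first element, mapped to the end of the interval. -/
theorem Shift.facet_perm {i : Fin n} (h : Shift D E i) (hD : D.IsMaximal) (hF : D.IsFacetAt F i) :
    F.decoratedPerm.perm = D.decoratedPerm.perm * adjSwap n i ∧ F.decoratedPerm.white = {i} := by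
  have hpos := h.pos
  have hin := (h.isInner hD).2
  set a : Fin n := ⟨i - 1, by omega⟩ with ha
  set b : Fin n := ⟨i + 1, hin⟩ with hb
  have hai : (a : ℕ) + 1 = i := Nat.sub_add_cancel hpos
  have hib : (i : ℕ) + 1 = b := rfl
  have hor := hor_eq_of_shape_eq hF.shape_eq
  have hC : ∀ {x}, x ≠ i → x ∉ F.coloopSet := fun hx => by rwa [hF.coloopSet_eq]
  have hiC : i ∈ F.coloopSet := by rw [hF.coloopSet_eq]; rfl
  -- The vertical step `i` comes right after a horizontal one, so its row is shorter than the row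
  -- above, if there is one.
  have hz : F.ZeroRowsFirst := by
    intro r hr hrk
    have h1 := (hF.isZeroRow_iff ⟨r + 1, hrk⟩).1 hr
    by_contra hlen
    have h2 := F.shape.rowLen_anti r (r + 1) (by omega)
    refine D.vLabel_notMem_hor ⟨r, by omega⟩ ?_
    have h3 : (D.vLabel ⟨r, by omega⟩ : ℕ) = i - 1 := by
      have h3 := congrArg Fin.val h1
      have := D.rowLen_le r
      rw [hF.shape_eq] at hlen h2
      simp only [vLabel] at h3 ⊢
      omega
    rw [h3]
    exact h.left_mem
  have huniq : ∀ {x y : Fin n}, (x : ℕ) ∈ D.hor → (y : ℕ) ∈ D.hor → D.horCount x = D.horCount y →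
      x = y := fun h1 h2 h3 => Fin.ext (D.eq_of_mem_hor_of_horCount_eq h1 h2 h3)
  have hperm : F.decoratedPerm.perm = D.decoratedPerm.perm * adjSwap n i := by
    rw [adjSwap_eq (x := i) (y := b) rfl rfl]
    ext1 x
    rw [Equiv.Perm.mul_apply]
    by_cases hxi : x = i
    · subst hxi
      rw [Equiv.swap_apply_left, hD.perm_eq_pred hib h.left_notMem, perm_of_mem_coloopSet hiC]
    by_cases hxb : x = b
    · subst hxb
      rw [Equiv.swap_apply_right]
      obtain ⟨h1, h2⟩ := hD.perm_mem_hor (x := i) fun y hy => by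
        rw [show (y : ℕ) = i - 1 by omega]
        exact h.left_mem
      obtain ⟨h3, h4⟩ := perm_mem_hor hF.inClosure hz (hC hxi) fun y hy => Or.inr (by
        rwa [show y = i from Fin.ext (by omega)])
      rw [hor] at h3
      rw [horCount_eq_of_hor hor, ← hib, horCount_succ_of_notMem _ h.left_notMem] at h4
      exact huniq h3 h1 (h4.trans h2.symm)
    rw [Equiv.swap_apply_of_ne_of_ne hxi hxb]
    by_cases hx : ∀ y : Fin n, (y : ℕ) + 1 = x → (y : ℕ) ∈ D.hor
    · obtain ⟨h1, h2⟩ := hD.perm_mem_hor hx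
      obtain ⟨h3, h4⟩ := perm_mem_hor hF.inClosure hz (hC hxi) fun y hy =>
        Or.inl (hor ▸ hx y hy)
      rw [hor] at h3
      rw [horCount_eq_of_hor hor] at h4
      exact huniq h3 h1 (h4.trans h2.symm)
    · obtain ⟨y, hy, hy'⟩ := exists_pred_notMem_hor hx
      rw [hD.perm_eq_pred hy hy']
      refine perm_eq_pred hF.inClosure hy (hC hxi) (hor ▸ hy') (hC fun h => hxb (Fin.ext ?_))
      rw [← hy, h, hib]
  refine ⟨hperm, ?_⟩
  ext x
  rw [Set.mem_singleton_iff]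
  constructor
  · intro hx
    have hfix := F.decoratedPerm.white_fixed x hx
    obtain ⟨⟨r, rfl⟩, -⟩ := hx
    have hr := F.vLabel_notMem_hor r
    by_contra hxi
    by_cases hx' : ∀ y : Fin n, (y : ℕ) + 1 = F.vLabel r → (y : ℕ) ∈ F.hor ∨ y ∈ F.coloopSet
    · have := (perm_mem_hor hF.inClosure hz (hC hxi) hx').1
      rw [hfix] at this
      exact hr this
    · push Not at hx'
      obtain ⟨y, hy, hy1, hy2⟩ := hx'
      rw [perm_eq_pred hF.inClosure hy (hC hxi) hy1 hy2] at hfix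
      rw [hfix] at hy
      omega
  · rintro rfl
    exact ⟨F.exists_vLabel_eq (notMem_hor_of_mem_coloopSet hiC), perm_of_mem_coloopSet hiC⟩

/-- The images of `i` and `i + 1` are the end of their interval and `i`, an inversion that right
multiplication removes. The preimages of `i - 1` and `i` are the first element of the preceding
interval and `i + 1`, which are in order, so left multiplication adds an inversion. -/
theorem Shift.inversions_eq {i : Fin n} (h : Shift D E i) (hD : D.IsMaximal) :
    inversions (D.decoratedPerm.perm * adjSwap n i) + 1 = k ∧
      inversions (adjSwap n (i - 1) * D.decoratedPerm.perm) = k + 1 := by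
  have hpos := h.pos
  have hin := (h.isInner hD).2
  set a : Fin n := ⟨i - 1, by omega⟩ with ha
  set b : Fin n := ⟨i + 1, hin⟩ with hb
  have hai : (a : ℕ) + 1 = i := Nat.sub_add_cancel hpos
  have hib : (i : ℕ) + 1 = b := rfl
  have haD : (a : ℕ) ∈ D.hor := h.left_mem
  rw [adjSwap_eq (x := a) (y := i) rfl (by omega), adjSwap_eq (x := i) (y := b) rfl rfl]
  have hpb : D.decoratedPerm.perm b = i := hD.perm_eq_pred hib h.left_notMem
  constructor
  · rw [← inversions_mul_swap _ hib, mul_assoc, Equiv.swap_mul_self, mul_one, hD.inversions_eq]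
    rw [Equiv.Perm.mul_apply, Equiv.Perm.mul_apply, Equiv.swap_apply_left, Equiv.swap_apply_right, hpb,
      Fin.lt_def]
    obtain ⟨h1, h2⟩ := hD.perm_mem_hor (x := i) fun y hy => by
      rwa [show (y : ℕ) = a by omega]
    refine lt_of_le_of_ne (le_of_horCount_le h1 h2.ge) fun hi => h.left_notMem ?_
    rwa [hi]
  · rw [inversions_swap_mul _ hai, hD.inversions_eq]
    rw [Equiv.Perm.inv_eq_iff_eq.2 hpb.symm, Fin.lt_def]
    set x := D.decoratedPerm.perm⁻¹ a with hx
    have hpx : D.decoratedPerm.perm x = a := by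
      rw [hx, ← Equiv.Perm.mul_apply, mul_inv_cancel, Equiv.Perm.one_apply]
    have h1 := hD.perm_mem_hor ((hD.perm_mem_hor_iff (x := x)).1 (by rwa [hpx]))
    rw [hpx] at h1
    have := le_of_horCount_le h1.1 h1.2.ge
    omega

end LeDiagram

/-! ### Sign changes of vectors in totally positive subspaces -/

theorem IsRowSpan.exists_coeff {r n : ℕ} {A : Matrix (Fin r) (Fin n) ℝ}
    {W : Submodule ℝ (EuclideanSpace ℝ (Fin n))} (hA : IsRowSpan A W) {u : EuclideanSpace ℝ (Fin n)}
    (hu : u ∈ W) : ∃ c : Fin r → ℝ, ∀ i, u i = ∑ a, c a * A a i := by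
  rw [← hA, Submodule.mem_span_range_iff_exists_fun] at hu
  obtain ⟨c, rfl⟩ := hu
  refine ⟨c, fun i => ?_⟩
  simp

theorem IsTotallyPositive.eq_zero_of_vanish {r n : ℕ} {W : Submodule ℝ (EuclideanSpace ℝ (Fin n))}
    (hW : IsTotallyPositive r W) {u : EuclideanSpace ℝ (Fin n)} (hu : u ∈ W)
    (I : Fin r ↪o Fin n) (h : ∀ j, u (I j) = 0) : u = 0 := by
  obtain ⟨-, A, hA, hpos⟩ := hW
  obtain ⟨c, hc⟩ := hA.exists_coeff hu
  have h0 : Matrix.vecMul c (A.submatrix id I) = 0 := by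
    funext j
    rw [Pi.zero_apply, ← h j, hc]
    rfl
  have hc0 := Matrix.eq_zero_of_vecMul_eq_zero (hpos I).ne' h0
  ext i
  rw [hc, hc0]
  simp

/-- The matrix of `W` restricted to the columns `I`, with `u` as an additional top row, is singular.
Expanding its determinant along `u` gives a sum of nonnegative terms with positive minors, so `u`
vanishes on `I`, and `eq_zero_of_vanish` applies. -/
theorem IsTotallyPositive.eq_zero_of_alternating {r n : ℕ}
    {W : Submodule ℝ (EuclideanSpace ℝ (Fin n))}
    (hW : IsTotallyPositive r W) {u : EuclideanSpace ℝ (Fin n)} (hu : u ∈ W)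
    (I : Fin (r + 1) ↪o Fin n) (h : ∀ j : Fin (r + 1), 0 ≤ (-1) ^ (j : ℕ) * u (I j)) : u = 0 := by
  obtain ⟨-, A, hA, hpos⟩ := id hW
  obtain ⟨c, hc⟩ := hA.exists_coeff hu
  let M : Matrix (Fin (r + 1)) (Fin (r + 1)) ℝ :=
    Matrix.of (Fin.cons (fun j => u (I j)) fun a j => A a (I j))
  have hdet : M.det = 0 := by
    rw [← Matrix.exists_vecMul_eq_zero_iff]
    refine ⟨Fin.cons 1 (-c), fun h => ?_, ?_⟩
    · have := congrFun h 0
      simp at this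
    · funext j
      simp [M, Matrix.vecMul, dotProduct, Fin.sum_univ_succ, hc]
  rw [Matrix.det_succ_row_zero] at hdet
  have hminor : ∀ j : Fin (r + 1), 0 < (M.submatrix Fin.succ j.succAbove).det := fun j =>
    hpos ((Fin.succAboveOrderEmb j).trans I)
  have hnn : ∀ j ∈ (Finset.univ : Finset (Fin (r + 1))),
      0 ≤ (-1) ^ (j : ℕ) * M 0 j * (M.submatrix Fin.succ j.succAbove).det :=
    fun j _ => mul_nonneg (h j) (hminor j).le
  rw [Finset.sum_eq_zero_iff_of_nonneg hnn] at hdet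
  refine hW.eq_zero_of_vanish hu ((Fin.succAboveOrderEmb 0).trans I) fun j => ?_
  have h0 := hdet ((Fin.succAboveOrderEmb 0) j) (Finset.mem_univ _)
  rcases mul_eq_zero.1 h0 with h1 | h1
  · exact (mul_eq_zero.1 h1).resolve_left (pow_ne_zero _ (by norm_num))
  · exact absurd h1 (hminor _).ne'

/-- Take the first position where the counter reaches `j`; since it grows by at most one per step,
it equals `j` there. -/
theorem exists_orderEmbedding_of_counter {r n : ℕ} (c : ℕ → ℕ) (h0 : c 0 = 0) (hc : Monotone c)
    (hstep : ∀ x, c (x + 1) ≤ c x + 1) (hn : 0 < n) (hr : r ≤ c (n - 1)) :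
    ∃ I : Fin (r + 1) ↪o Fin n, ∀ j, c (I j) = j := by
  have hex : ∀ j : Fin (r + 1), ∃ x, (j : ℕ) ≤ c x := fun j => ⟨n - 1, by omega⟩
  have hlt : ∀ j, Nat.find (hex j) < n := fun j => by
    have := Nat.find_min' (hex j) (show (j : ℕ) ≤ c (n - 1) by omega)
    omega
  have heq : ∀ j, c (Nat.find (hex j)) = j := by
    intro j
    refine le_antisymm ?_ (Nat.find_spec (hex j))
    rcases Nat.eq_zero_or_pos (Nat.find (hex j)) with h | h
    · rw [h, h0]
      exact Nat.zero_le _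
    · have h1 := Nat.find_min (hex j) (show Nat.find (hex j) - 1 < _ by omega)
      have h2 := hstep (Nat.find (hex j) - 1)
      rw [Nat.sub_add_cancel h] at h2
      omega
  refine ⟨OrderEmbedding.ofStrictMono (fun j => ⟨Nat.find (hex j), hlt j⟩) fun i j hij => ?_, heq⟩
  rw [Fin.lt_def] at hij ⊢
  simp only
  by_contra hle
  have := hc (not_lt.1 hle)
  rw [heq, heq] at this
  omega

/-- The number of sign changes before position `x`. -/
noncomputable def signChanges (s : ℕ → ℝ) (x : ℕ) : ℕ :=
  ((Finset.range x).filter fun y => s (y + 1) ≠ s y).card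

theorem signChanges_succ (s : ℕ → ℝ) (x : ℕ) :
    signChanges s (x + 1) = signChanges s x + if s (x + 1) ≠ s x then 1 else 0 := by
  rw [signChanges, Finset.range_add_one, Finset.filter_insert]
  split_ifs
  · rw [Finset.card_insert_of_notMem (by simp), signChanges]
  · rfl

theorem eq_mul_pow_signChanges {s : ℕ → ℝ} (hs : ∀ x, s x = 1 ∨ s x = -1) (x : ℕ) :
    s x = s 0 * (-1) ^ signChanges s x := by
  induction x with
  | zero => simp [signChanges]
  | succ x ih =>
    rw [signChanges_succ]
    split_ifs with h
    · rw [pow_succ, ← mul_assoc, ← ih]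
      rcases hs x with h1 | h1 <;> rcases hs (x + 1) with h2 | h2 <;> rw [h1, h2] at h ⊢
      · exact absurd rfl h
      · norm_num
      · norm_num
      · exact absurd rfl h
    · rw [add_zero, ← ih]
      exact not_not.1 h

theorem IsTotallyPositive.eq_zero_of_signChanges {r n : ℕ}
    {W : Submodule ℝ (EuclideanSpace ℝ (Fin n))} (hW : IsTotallyPositive r W)
    {u : EuclideanSpace ℝ (Fin n)} (hu : u ∈ W) {s : ℕ → ℝ} (hs : ∀ x, s x = 1 ∨ s x = -1)
    (hsu : ∀ x : Fin n, 0 ≤ s x * u x) (hn : 0 < n) (hr : r ≤ signChanges s (n - 1)) : u = 0 := by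
  obtain ⟨I, hI⟩ := exists_orderEmbedding_of_counter (signChanges s) (by simp [signChanges])
    (monotone_nat_of_le_succ fun x => by rw [signChanges_succ]; omega)
    (fun x => by rw [signChanges_succ]; split_ifs <;> omega) hn hr
  have key : ∀ j, s (I j) = s 0 * (-1) ^ (j : ℕ) := fun j => by
    rw [eq_mul_pow_signChanges hs, hI]
  rcases hs 0 with h0 | h0
  · refine hW.eq_zero_of_alternating hu I fun j => ?_
    have := hsu (I j)
    rwa [key, h0, one_mul] at this
  · rw [← neg_eq_zero]
    refine hW.eq_zero_of_alternating (W.neg_mem hu) I fun j => ?_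
    have := hsu (I j)
    rw [key, h0] at this
    simp only [PiLp.neg_apply]
    linarith

/-! ### Vectors of `W` that alternate in sign on each interval -/

namespace LeDiagram

variable {k n : ℕ} {D E F : LeDiagram k n}

/-- The index of the interval containing `x`. -/
def blockIndex (D : LeDiagram k n) (x : ℕ) : ℕ := min (D.horCount x) (n - k - 1)

theorem blockIndex_succ (D : LeDiagram k n) (x : ℕ) :
    D.blockIndex (x + 1) = D.blockIndex x ∨ D.blockIndex (x + 1) = D.blockIndex x + 1 := by
  unfold blockIndex
  by_cases hx : x ∈ D.hor
  · rw [horCount_succ_of_mem _ hx]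
    omega
  · rw [horCount_succ_of_notMem _ hx]
    omega

theorem blockIndex_last (D : LeDiagram k n) (hkn : k < n) : D.blockIndex (n - 1) = n - k - 1 := by
  unfold blockIndex
  have h1 : D.horCount (n - 1 + 1) = n - k := by
    rw [Nat.sub_add_cancel (by omega), horCount_top]
  by_cases hx : n - 1 ∈ D.hor
  · rw [horCount_succ_of_mem _ hx] at h1
    omega
  · rw [horCount_succ_of_notMem _ hx] at h1
    omega

theorem blockIndex_of_notMem {x : Fin n} (hx : x ∉ D.coloopSet) : D.blockIndex x = D.horCount x := by
  have := horCount_lt_of_notMem_coloopSet hx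
  unfold blockIndex
  omega

/-- Each step either stays in its interval and changes the sign of `s`, or enters the next interval.
The passage from interval `j` to `j + 1` does both, whence the extra one. -/
theorem le_signChanges (D : LeDiagram k n) {s e : ℕ → ℝ} (he : ∀ j, e j = 1 ∨ e j = -1)
    (hs : ∀ x, s x = e (D.blockIndex x) * (-1) ^ x) {j : ℕ} (hj : e j = e (j + 1)) (x : ℕ) :
    x + (if j < D.blockIndex x then 1 else 0) ≤ signChanges s x + D.blockIndex x := by
  have hne : ∀ x, e (D.blockIndex (x + 1)) = e (D.blockIndex x) → s (x + 1) ≠ s x := by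
    intro x h
    rw [hs, hs, h, pow_succ]
    have h1 : e (D.blockIndex x) * (-1) ^ x ≠ 0 :=
      mul_ne_zero (by rcases he (D.blockIndex x) with h | h <;> rw [h] <;> norm_num)
        (pow_ne_zero _ (by norm_num))
    intro h2
    apply h1
    linarith
  induction x with
  | zero => simp [blockIndex, horCount_zero]
  | succ x ih =>
    rw [signChanges_succ]
    rcases D.blockIndex_succ x with h | h
    · rw [if_pos (hne x (by rw [h])), h]
      omega
    · by_cases hjx : D.blockIndex x = j
      · rw [if_pos (hne x (by rw [h, hjx, hj])), h]
        split_ifs at ih ⊢ <;> omega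
      · rw [h]
        split_ifs at ih ⊢ <;> omega

/-- If `τ j` and `τ (j + 1)` are not strictly opposite, signs `e` weakly compatible with `τ` can be
chosen equal at `j` and `j + 1`. The resulting sign pattern has at least `k + 1` changes, too many
for a nonzero vector of `W`. -/
theorem mul_neg_of_blocks (D : LeDiagram k n) {W : Submodule ℝ (EuclideanSpace ℝ (Fin n))}
    (hW : IsTotallyPositive (k + 1) W) (hkn : k < n) {u : EuclideanSpace ℝ (Fin n)} (hu : u ∈ W)
    (hu0 : u ≠ 0) {τ : ℕ → ℝ} {a : Fin n → ℝ} (ha : ∀ x, 0 ≤ a x)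
    (h : ∀ x : Fin n, u x = τ (D.blockIndex x) * (-1) ^ (x : ℕ) * a x) {j : ℕ} (hj : j + 1 < n - k) :
    τ j * τ (j + 1) < 0 := by
  by_contra hc
  have hex : ∃ e : ℕ → ℝ, (∀ j, e j = 1 ∨ e j = -1) ∧ (∀ j, 0 ≤ e j * τ j) ∧ e j = e (j + 1) := by
    have h1 : ∃ ε : ℝ, (ε = 1 ∨ ε = -1) ∧ 0 ≤ ε * τ j ∧ 0 ≤ ε * τ (j + 1) := by
      by_cases hp : 0 ≤ τ j ∧ 0 ≤ τ (j + 1)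
      · exact ⟨1, Or.inl rfl, by linarith [hp.1], by linarith [hp.2]⟩
      · refine ⟨-1, Or.inr rfl, ?_, ?_⟩
        · by_contra hn
          have : 0 < τ j := by linarith
          have : τ (j + 1) < 0 := by
            by_contra h'
            exact hp ⟨this.le, not_lt.1 h'⟩
          exact hc (by nlinarith)
        · by_contra hn
          have : 0 < τ (j + 1) := by linarith
          have : τ j < 0 := by
            by_contra h'
            exact hp ⟨not_lt.1 h', this.le⟩
          exact hc (by nlinarith)
    obtain ⟨ε, hε, h1, h2⟩ := h1
    refine ⟨fun i => if i = j ∨ i = j + 1 then ε else if 0 ≤ τ i then 1 else -1, fun i => ?_,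
      fun i => ?_, by simp⟩
    · simp only
      split_ifs
      · exact hε
      · exact Or.inl rfl
      · exact Or.inr rfl
    · simp only
      split_ifs with h3 h4
      · rcases h3 with rfl | rfl
        · exact h1
        · exact h2
      · linarith
      · linarith
  obtain ⟨e, he, heτ, hej⟩ := hex
  refine hu0 (hW.eq_zero_of_signChanges hu (s := fun x => e (D.blockIndex x) * (-1) ^ x)
    (fun x => ?_) (fun x => ?_) (by omega) ?_)
  · rcases he (D.blockIndex x) with h1 | h1 <;> rcases neg_one_pow_eq_or ℝ x with h2 | h2 <;>
      simp [h1, h2]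
  · rw [h x]
    have h1 : ((-1 : ℝ) ^ (x : ℕ)) * (-1) ^ (x : ℕ) = 1 := by
      rw [← mul_pow]
      norm_num
    calc (0 : ℝ) ≤ (e (D.blockIndex x) * τ (D.blockIndex x)) * a x := mul_nonneg (heτ _) (ha x)
      _ = (e (D.blockIndex x) * τ (D.blockIndex x)) * a x * ((-1) ^ (x : ℕ) * (-1) ^ (x : ℕ)) := by
        rw [h1, mul_one]
      _ = _ := by ring
  -- At `n - 1` the interval index is `n - k - 1`, so the bound reads `n ≤ signChanges + (n - k -
  -- 1)`.
  · have := D.le_signChanges he (fun x => rfl) hej (n - 1)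
    rw [D.blockIndex_last hkn, if_pos (by omega)] at this
    omega

theorem ne_zero_of_blocks (D : LeDiagram k n) {W : Submodule ℝ (EuclideanSpace ℝ (Fin n))}
    (hW : IsTotallyPositive (k + 1) W) (hkn : k < n) {u : EuclideanSpace ℝ (Fin n)} (hu : u ∈ W)
    (hu0 : u ≠ 0) {τ : ℕ → ℝ} {a : Fin n → ℝ} (ha : ∀ x, 0 ≤ a x)
    (h : ∀ x : Fin n, u x = τ (D.blockIndex x) * (-1) ^ (x : ℕ) * a x) : τ 0 ≠ 0 := by
  intro h0
  by_cases hj : 1 < n - k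
  · have := D.mul_neg_of_blocks hW hkn hu hu0 ha h (j := 0) hj
    rw [h0, zero_mul] at this
    exact lt_irrefl _ this
  · refine hu0 ?_
    ext x
    have : D.blockIndex x = 0 := by
      unfold blockIndex
      omega
    rw [h x, this, h0]
    simp

end LeDiagram

namespace LeDiagram

variable {k n : ℕ} {D E F : LeDiagram k n}

/-! ### Points of the totally nonnegative Grassmannian -/

theorem vLabel_strictMono (D : LeDiagram k n) : StrictMono D.vLabel := by
  intro r s hrs
  rw [Fin.lt_def] at hrs ⊢
  have := D.shape.rowLen_anti r s hrs.le
  simp only [vLabel]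
  omega

/-- The label of the column of the box at the right end of row `r` (of the first column if the row
is empty). -/
def rowEnd (D : LeDiagram k n) (hkn : k < n) (r : Fin k) : Fin n :=
  D.hLabel ⟨D.shape.rowLen r - 1, by have := D.rowLen_le r; omega⟩

theorem vLabel_ne_rowEnd (hkn : k < n) (r s : Fin k) : D.vLabel r ≠ D.rowEnd hkn s :=
  D.vLabel_ne_hLabel _ _

theorem rowEnd_mem_hor (hkn : k < n) (r : Fin k) : (D.rowEnd hkn r : ℕ) ∈ D.hor :=
  D.hLabel_mem_hor _

theorem horCount_rowEnd (hkn : k < n) {r : Fin k} (hr : ¬ D.IsZeroRow r) :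
    D.horCount (D.rowEnd hkn r) = D.horCount (D.vLabel r) := by
  have h1 : D.shape.rowLen r ≠ 0 := fun h => hr (isZeroRow_of_rowLen_eq_zero h)
  have h2 := D.rowLen_le r
  rw [rowEnd, horCount_hLabel, horCount_vLabel]
  simp only
  omega

theorem vLabel_lt_rowEnd (hkn : k < n) {r : Fin k} (hr : ¬ D.IsZeroRow r) :
    D.vLabel r < D.rowEnd hkn r :=
  lt_of_le_of_ne (le_of_horCount_le (D.rowEnd_mem_hor hkn r) (horCount_rowEnd hkn hr).ge)
    (vLabel_ne_rowEnd hkn r r)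

/-- The matrix with the rows `e_p + t_r e_q`, where `p` is the label of the vertical step in row `r`
and `q` is the label of the column at the right end of this row. -/
noncomputable def network (D : LeDiagram k n) (hkn : k < n) (t : Fin k → ℝ) :
    Matrix (Fin k) (Fin n) ℝ :=
  Matrix.of fun r x => if x = D.vLabel r then 1 else if x = D.rowEnd hkn r then t r else 0

theorem network_vLabel (hkn : k < n) (t : Fin k → ℝ) (r s : Fin k) :
    D.network hkn t r (D.vLabel s) = if s = r then 1 else 0 := by
  simp only [network, Matrix.of_apply, D.vLabel_injective.eq_iff, if_neg (vLabel_ne_rowEnd hkn s r)]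

theorem sum_network (hkn : k < n) (t : Fin k → ℝ) (r : Fin k) (x : Fin n → ℝ) :
    ∑ i, D.network hkn t r i * x i = x (D.vLabel r) + t r * x (D.rowEnd hkn r) := by
  have h : ∀ i, D.network hkn t r i * x i =
      (if i = D.vLabel r then x i else 0) + (if i = D.rowEnd hkn r then t r * x i else 0) := by
    intro i
    have := vLabel_ne_rowEnd hkn r r (D := D)
    simp only [network, Matrix.of_apply]
    split_ifs with h1 h2 <;> simp_all
  simp only [h, Finset.sum_add_distrib, Finset.sum_ite_eq', Finset.mem_univ, if_true]

theorem card_filter_vLabel (hkn : k < n) {r : Fin k} (hr : ¬ D.IsZeroRow r) :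
    ((Finset.Ioi r).filter fun s => D.vLabel s < D.rowEnd hkn r).card =
      D.rowEnd hkn r - D.vLabel r - 1 := by
  rw [← Fin.card_Ioo, ← Finset.card_map ⟨D.vLabel, D.vLabel_injective⟩]
  congr 1
  ext x
  simp only [Finset.mem_map, Finset.mem_filter, Finset.mem_Ioi, Finset.mem_Ioo,
    Function.Embedding.coeFn_mk]
  constructor
  · rintro ⟨s, ⟨h1, h2⟩, rfl⟩
    exact ⟨D.vLabel_strictMono h1, h2⟩
  · rintro ⟨h1, h2⟩
    have hx : (x : ℕ) ∉ D.hor := by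
      intro hx
      have h3 := D.horCount_mono (Fin.lt_def.1 h1).le
      have h4 := D.horCount_mono (Nat.succ_le_of_lt (Fin.lt_def.1 h2))
      rw [Nat.succ_eq_add_one, horCount_succ_of_mem _ hx, horCount_rowEnd hkn hr] at h4
      omega
    obtain ⟨s, rfl⟩ := D.exists_vLabel_eq hx
    exact ⟨s, ⟨D.vLabel_strictMono.lt_iff_lt.1 h1, h2⟩, rfl⟩

/-- Every term of the Leibniz expansion is nonnegative. The sign of the permutation is split into
one factor per row `r`, counting the later rows that are inverted with it, and this factor cancels
the sign of the entry chosen in row `r`. -/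
theorem network_minor_nonneg (hkn : k < n) {t : Fin k → ℝ} (ht : ∀ r : Fin k, D.IsZeroRow r → t r = 0)
    (ht' : ∀ r, 0 ≤ (-1) ^ ((D.rowEnd hkn r : ℕ) + D.vLabel r + 1) * t r) (I : Fin k ↪o Fin n) :
    0 ≤ ((D.network hkn t).submatrix id I).det := by
  rw [← Matrix.det_transpose, Matrix.det_apply']
  refine Finset.sum_nonneg fun σ _ => ?_
  simp only [Matrix.transpose_apply, Matrix.submatrix_apply, id]
  by_cases hall : ∀ r, D.network hkn t r (I (σ r)) ≠ 0
  swap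
  · push Not at hall
    obtain ⟨r, hr⟩ := hall
    rw [Finset.prod_eq_zero (Finset.mem_univ r) hr, mul_zero]
  have hf : ∀ r, I (σ r) = D.vLabel r ∨ (¬ D.IsZeroRow r ∧ I (σ r) = D.rowEnd hkn r) := by
    intro r
    have h := hall r
    simp only [network, Matrix.of_apply] at h
    split_ifs at h with h1 h2
    · exact Or.inl h1
    · exact Or.inr ⟨fun hz => h (ht r hz), h2⟩
    · exact absurd rfl h
  have hle : ∀ r, D.vLabel r ≤ I (σ r) := by
    intro r
    rcases hf r with h | ⟨h, h'⟩
    · exact h.ge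
    · rw [h']
      exact (vLabel_lt_rowEnd hkn h).le
  rw [Equiv.Perm.sign_eq_prod_prod_Ioi]
  push_cast
  rw [← Finset.prod_mul_distrib]
  refine Finset.prod_nonneg fun r _ => ?_
  have hlt : ∀ s, σ r < σ s ↔ I (σ r) < I (σ s) := fun s => I.lt_iff_lt.symm
  simp only [hlt]
  rcases hf r with h | ⟨h, h'⟩
  · rw [Finset.prod_eq_one, h, network_vLabel, if_pos rfl, one_mul]
    · exact zero_le_one
    · intro s hs
      rw [if_pos]
      · simp
      · rw [h]
        exact (D.vLabel_strictMono (Finset.mem_Ioi.1 hs)).trans_le (hle s)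
  · have hval : D.network hkn t r (I (σ r)) = t r := by
      simp only [network, Matrix.of_apply, h', if_true, if_neg (vLabel_ne_rowEnd hkn r r).symm]
    -- If row `r` uses its horizontal label, it is inverted precisely with the later rows whose
    -- vertical step comes before that label, and all labels in between are such vertical steps.
    have hprod : (∏ s ∈ Finset.Ioi r,
        (((if I (σ r) < I (σ s) then (1 : ℤˣ) else -1 : ℤˣ) : ℤ) : ℝ)) =
          (-1) ^ (D.rowEnd hkn r - D.vLabel r - 1 : ℕ) := by
      rw [← card_filter_vLabel hkn h, ← Finset.prod_const, Finset.prod_filter]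
      refine Finset.prod_congr rfl fun s hs => ?_
      have hrs := Finset.mem_Ioi.1 hs
      have hiff : I (σ r) < I (σ s) ↔ ¬ D.vLabel s < D.rowEnd hkn r := by
        rw [h']
        constructor
        · intro hlt hlt'
          rcases hf s with h1 | ⟨h1, h2⟩
          · rw [h1] at hlt
            exact lt_asymm hlt hlt'
          · rw [h2] at hlt
            have h3 := D.horCount_mono (Fin.lt_def.1 hlt').le
            rw [← horCount_rowEnd hkn h1] at h3
            exact absurd (le_of_horCount_le (D.rowEnd_mem_hor hkn r) h3)
              (not_le.2 (Fin.lt_def.1 hlt))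
        · intro hn
          refine lt_of_le_of_ne ((not_lt.1 hn).trans (hle s)) fun he => ?_
          rw [← h', I.injective.eq_iff, σ.injective.eq_iff] at he
          exact hrs.ne he
      by_cases hc : D.vLabel s < D.rowEnd hkn r
      · rw [if_neg (by rw [hiff]; exact not_not.2 hc), if_pos hc]
        simp
      · rw [if_pos (hiff.2 hc), if_neg hc]
        simp
    rw [hval, hprod]
    have h1 := ht' r
    have h2 := Fin.lt_def.1 (vLabel_lt_rowEnd hkn h)
    have h3 : (D.rowEnd hkn r : ℕ) + D.vLabel r + 1 =
        (D.rowEnd hkn r - D.vLabel r - 1) + 2 * (D.vLabel r + 1) := by omega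
    rwa [h3, pow_add, pow_mul, neg_one_sq, one_pow, mul_one] at h1

/-- The row span of the network matrix. -/
noncomputable def networkSpan (D : LeDiagram k n) (hkn : k < n) (t : Fin k → ℝ) :
    Submodule ℝ (EuclideanSpace ℝ (Fin n)) :=
  Submodule.span ℝ (Set.range fun i => WithLp.toLp 2 (D.network hkn t i))

theorem isTotallyNonneg_networkSpan (hkn : k < n) {t : Fin k → ℝ}
    (ht : ∀ r : Fin k, D.IsZeroRow r → t r = 0)
    (ht' : ∀ r, 0 ≤ (-1) ^ ((D.rowEnd hkn r : ℕ) + D.vLabel r + 1) * t r) :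
    IsTotallyNonneg k (D.networkSpan hkn t) := by
  refine ⟨?_, D.network hkn t, rfl, network_minor_nonneg hkn ht ht'⟩
  rw [networkSpan, finrank_span_eq_card, Fintype.card_fin]
  rw [Fintype.linearIndependent_iff]
  intro c hc r
  have := congrArg (fun v : EuclideanSpace ℝ (Fin n) => v (D.vLabel r)) hc
  simpa [network_vLabel] using this

theorem mem_networkSpan_orthogonal_iff (hkn : k < n) (t : Fin k → ℝ)
    (x : EuclideanSpace ℝ (Fin n)) : x ∈ (D.networkSpan hkn t)ᗮ ↔
      ∀ r, x (D.vLabel r) + t r * x (D.rowEnd hkn r) = 0 := by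
  have hinner : ∀ r, inner ℝ (WithLp.toLp 2 (D.network hkn t r)) x =
      x (D.vLabel r) + t r * x (D.rowEnd hkn r) := by
    intro r
    rw [← sum_network, PiLp.inner_apply]
    refine Finset.sum_congr rfl fun i _ => ?_
    simp [mul_comm]
  rw [Submodule.mem_orthogonal]
  constructor
  · intro h r
    rw [← hinner]
    exact h _ (Submodule.subset_span ⟨r, rfl⟩)
  · intro h v hv
    induction hv using Submodule.span_induction with
    | mem v hv =>
      obtain ⟨r, rfl⟩ := hv
      rw [hinner, h]
    | zero => exact inner_zero_left _
    | add v w _ _ hv hw => rw [inner_add_left, hv, hw, add_zero]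
    | smul c v _ hv => rw [inner_smul_left, hv, mul_zero]

/-- Edge weights for which the row span of the network is orthogonal to the vectors with the
absolute values `a` and the signs of `D`. -/
noncomputable def edgeWeight (D : LeDiagram k n) (hkn : k < n) (a : Fin n → ℝ) (r : Fin k) : ℝ :=
  (-1) ^ ((D.rowEnd hkn r : ℕ) + D.vLabel r + 1) * (a (D.vLabel r) / a (D.rowEnd hkn r))

/-- The nonnegative vector `a` vanishes precisely at the labels of the rows without `+`. -/
def IsWeight (D : LeDiagram k n) (a : Fin n → ℝ) : Prop :=
  (∀ x ∈ D.coloopSet, a x = 0) ∧ ∀ x, x ∉ D.coloopSet → 0 < a x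

theorem IsWeight.nonneg {a : Fin n → ℝ} (ha : D.IsWeight a) (x : Fin n) : 0 ≤ a x := by
  by_cases hx : x ∈ D.coloopSet
  · exact (ha.1 x hx).ge
  · exact (ha.2 x hx).le

theorem IsWeight.isTotallyNonneg (hkn : k < n) {a : Fin n → ℝ} (ha : D.IsWeight a) :
    IsTotallyNonneg k (D.networkSpan hkn (D.edgeWeight hkn a)) := by
  refine isTotallyNonneg_networkSpan hkn (fun (r : Fin k) hr => ?_) fun r => ?_
  · rw [edgeWeight, ha.1 _ ((mem_coloopSet_iff D r).2 hr), zero_div, mul_zero]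
  · rw [edgeWeight, ← mul_assoc, ← mul_pow]
    norm_num
    exact div_nonneg (ha.nonneg _) (ha.nonneg _)

theorem neg_one_pow_mul_self (m : ℕ) : ((-1 : ℝ)) ^ m * (-1) ^ m = 1 := by
  rw [← mul_pow]
  norm_num

/-- The quotients of the components of `x` and of `a` at the horizontal labels, up to sign. -/
noncomputable def blockCoeff (D : LeDiagram k n) (a : Fin n → ℝ) (x : EuclideanSpace ℝ (Fin n))
    (j : ℕ) : ℝ :=
  if h : j < n - k then
    (-1) ^ (D.hLabel (Fin.rev ⟨j, h⟩) : ℕ) * (x (D.hLabel (Fin.rev ⟨j, h⟩)) /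
      a (D.hLabel (Fin.rev ⟨j, h⟩))) else 0

/-- Orthogonality is a two-term equation for each row. For a row with `+` it ties the vertical
component to the horizontal one of the same interval in the ratio prescribed by `(-1)^i * a i`; for
a row without `+` it makes the component vanish. -/
theorem IsWeight.eq_blockCoeff_mul (hkn : k < n) {a : Fin n → ℝ} (ha : D.IsWeight a)
    {x : EuclideanSpace ℝ (Fin n)} (hx : x ∈ (D.networkSpan hkn (D.edgeWeight hkn a))ᗮ) (i : Fin n) :
    x i = D.blockCoeff a x (D.blockIndex i) * (-1) ^ (i : ℕ) * a i := by
  rw [mem_networkSpan_orthogonal_iff] at hx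
  by_cases hi : i ∈ D.coloopSet
  · rw [ha.1 i hi, mul_zero]
    obtain ⟨r, rfl, hr⟩ := id hi
    have := hx r
    rwa [edgeWeight, ha.1 _ hi, zero_div, mul_zero, zero_mul, add_zero] at this
  · have hlt := horCount_lt_of_notMem_coloopSet hi
    rw [blockIndex_of_notMem hi]
    rw [blockCoeff, dif_pos hlt]
    have hend : ∀ q : Fin n, (q : ℕ) ∈ D.hor → D.horCount q = D.horCount i →
        D.hLabel (Fin.rev ⟨D.horCount i, hlt⟩) = q := fun q hq hc =>
      Fin.ext (D.eq_of_mem_hor_of_horCount_eq (D.hLabel_mem_hor _) hq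
        ((D.horCount_hLabel_rev _).trans hc.symm))
    by_cases hih : (i : ℕ) ∈ D.hor
    · rw [hend i hih rfl]
      have h1 := (ha.2 i hi).ne'
      have h2 := neg_one_pow_mul_self i
      field_simp
      linear_combination (-x i) * h2
    · obtain ⟨r, rfl⟩ := D.exists_vLabel_eq hih
      rw [mem_coloopSet_iff] at hi
      rw [hend _ (D.rowEnd_mem_hor hkn r) (horCount_rowEnd hkn hi)]
      have h1 := hx r
      rw [edgeWeight, pow_succ, pow_add] at h1
      rw [eq_neg_of_add_eq_zero_left h1]
      ring

theorem sign_eq_neg_one_pow {m : ℕ} {y : ℝ} (h : 0 < (-1) ^ m * y) :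
    SignType.sign y = (-1) ^ m := by
  rcases Nat.even_or_odd m with hm | hm
  · rw [hm.neg_one_pow, one_mul] at h
    rw [hm.neg_one_pow, sign_pos h]
  · rw [hm.neg_one_pow] at h
    rw [hm.neg_one_pow, sign_neg (by linarith)]

theorem eq_neg_one_pow_mul_abs {m : ℕ} {y : ℝ} (h : SignType.sign y = (-1) ^ m) :
    y = (-1) ^ m * |y| := by
  rcases Nat.even_or_odd m with hm | hm
  · rw [hm.neg_one_pow, sign_eq_one_iff] at h
    rw [hm.neg_one_pow, one_mul, abs_of_pos h]
  · rw [hm.neg_one_pow, sign_eq_neg_one_iff] at h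
    rw [hm.neg_one_pow, abs_of_neg h]
    ring

/-! ### Cells -/

/-- Any weight `a` will do. By dimensions `Vᗮ` meets `W` nontrivially, a vector there alternates on
each interval, and its interval coefficients strictly alternate by `mul_neg_of_blocks`; up to a
global sign this is `σ(D)`. -/
theorem exists_sign_eq_sigma {W : Submodule ℝ (EuclideanSpace ℝ (Fin n))}
    (hW : IsTotallyPositive (k + 1) W) (hkn : k < n) (D : LeDiagram k n) :
    ∃ u ∈ W, ∀ i, SignType.sign (u i) = D.sigma i := by
  classical
  let a : Fin n → ℝ := fun x => if x ∈ D.coloopSet then 0 else 1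
  have ha : D.IsWeight a := ⟨fun x hx => if_pos hx, fun x hx => by simp [a, hx]⟩
  set V := D.networkSpan hkn (D.edgeWeight hkn a) with hV
  have hVk : Module.finrank ℝ V = k := (ha.isTotallyNonneg hkn).1
  obtain ⟨u, hu, huV, hu0⟩ : ∃ u ∈ W, u ∈ Vᗮ ∧ u ≠ 0 := by
    have h1 := Submodule.finrank_add_finrank_orthogonal V
    have h2 := Submodule.finrank_sup_add_finrank_inf_eq Vᗮ W
    have h3 := Submodule.finrank_le (Vᗮ ⊔ W)
    have h4 := hW.1
    rw [finrank_euclideanSpace_fin] at h1 h3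
    have h5 : Vᗮ ⊓ W ≠ ⊥ := by
      intro h
      rw [h, finrank_bot] at h2
      omega
    obtain ⟨u, hu, hu0⟩ := Submodule.exists_mem_ne_zero_of_ne_bot h5
    exact ⟨u, hu.2, hu.1, hu0⟩
  obtain ⟨τ, hτ⟩ : ∃ τ : ℕ → ℝ, ∀ i, u i = τ (D.blockIndex i) * (-1) ^ (i : ℕ) * a i :=
    ⟨_, ha.eq_blockCoeff_mul hkn huV⟩
  have key : ∀ (u : EuclideanSpace ℝ (Fin n)) (τ : ℕ → ℝ), u ∈ W → u ≠ 0 →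
      (∀ i, u i = τ (D.blockIndex i) * (-1) ^ (i : ℕ) * a i) → 0 < τ 0 →
      ∀ i, SignType.sign (u i) = D.sigma i := by
    intro u τ hu hu0 hτ h0 i
    have hsign : ∀ j, j < n - k → 0 < (-1) ^ j * τ j := by
      intro j
      induction j with
      | zero => intro; simpa using h0
      | succ j ih =>
        intro hj
        have h1 := ih (by omega)
        have h2 := D.mul_neg_of_blocks hW hkn hu hu0 ha.nonneg hτ hj
        rw [pow_succ]
        rcases neg_one_pow_eq_or ℝ j with h3 | h3 <;> rw [h3] at h1 ⊢ <;> nlinarith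
    by_cases hi : i ∈ D.coloopSet
    · rw [sigma_of_mem hi, hτ i, ha.1 i hi, mul_zero, sign_zero]
    · rw [sigma_of_notMem hi, signHat_eq]
      apply sign_eq_neg_one_pow
      have h1 := hsign _ (horCount_lt_of_notMem_coloopSet hi)
      rw [hτ i, blockIndex_of_notMem hi, pow_add]
      have h2 := mul_pos h1 (ha.2 i hi)
      have h3 := neg_one_pow_mul_self i
      calc (0 : ℝ) < (-1) ^ D.horCount i * τ (D.horCount i) * a i * 1 := by rwa [mul_one]
        _ = (-1) ^ D.horCount i * τ (D.horCount i) * a i * ((-1) ^ (i : ℕ) * (-1) ^ (i : ℕ)) := by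
          rw [h3]
        _ = _ := by ring
  rcases lt_or_gt_of_ne (D.ne_zero_of_blocks hW hkn hu hu0 ha.nonneg hτ) with h | h
  · refine ⟨-u, W.neg_mem hu, key (-u) (fun j => -τ j) (W.neg_mem hu) (neg_ne_zero.2 hu0)
      (fun i => ?_) (by linarith)⟩
    rw [PiLp.neg_apply, hτ i]
    ring
  · exact ⟨u, hu, key u τ hu hu0 hτ h⟩

theorem ne_zero_of_sign_eq_sigma (hkn : k < n) {w : EuclideanSpace ℝ (Fin n)}
    (h : ∀ i, SignType.sign (w i) = D.sigma i) : w ≠ 0 := by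
  rintro rfl
  have h1 := h (D.hLabel ⟨0, by omega⟩)
  rw [sigma_of_notMem (D.hLabel_notMem_coloopSet _)] at h1
  exact D.signHat_ne_zero _ (h1.symm.trans (by simp))

/-- The weight `|w|` gives a network orthogonal to `w`. Its orthogonal complement meets `W` in no
more than the line of `w`, since a nonzero vector there cannot have zero first interval coefficient.
-/
theorem mem_amplituhedron_of_sign_eq_sigma {W : Submodule ℝ (EuclideanSpace ℝ (Fin n))}
    (hW : IsTotallyPositive (k + 1) W) (hkn : k < n) {w : EuclideanSpace ℝ (Fin n)} (hw0 : w ≠ 0)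
    (hw : w ∈ W) (h : ∀ i, SignType.sign (w i) = D.sigma i) :
    Projectivization.mk ℝ w hw0 ∈ amplituhedron k W := by
  let a : Fin n → ℝ := fun x => |w x|
  have hzero : ∀ x ∈ D.coloopSet, w x = 0 := fun x hx => by
    rw [← sign_eq_zero_iff, h, sigma_of_mem hx]
  have hnz : ∀ x, x ∉ D.coloopSet → w x ≠ 0 := fun x hx => by
    rw [← sign_ne_zero, h, sigma_of_notMem hx]
    exact D.signHat_ne_zero _
  have ha : D.IsWeight a := ⟨fun x hx => by simp [a, hzero x hx], fun x hx => abs_pos.2 (hnz x hx)⟩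
  have hwx : ∀ x : Fin n, w x = (-1) ^ ((x : ℕ) + D.horCount x) * |w x| := by
    intro x
    by_cases hx : x ∈ D.coloopSet
    · simp [hzero x hx]
    · apply eq_neg_one_pow_mul_abs
      rw [h, sigma_of_notMem hx, signHat_eq]
  set V := D.networkSpan hkn (D.edgeWeight hkn a) with hV
  have hwV : w ∈ Vᗮ := by
    rw [mem_networkSpan_orthogonal_iff]
    intro r
    by_cases hr : D.IsZeroRow r
    · have hp := (mem_coloopSet_iff D r).2 hr
      rw [edgeWeight, ha.1 _ hp, hzero _ hp]
      simp
    · have hq : |w (D.rowEnd hkn r)| ≠ 0 := abs_ne_zero.2 (hnz _ (D.hLabel_notMem_coloopSet _))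
      rw [edgeWeight, hwx (D.vLabel r), hwx (D.rowEnd hkn r), horCount_rowEnd hkn hr]
      simp only [a]
      rw [pow_add, pow_add, pow_succ, pow_add]
      field_simp
      linear_combination (-(-1) ^ (D.vLabel r : ℕ) * (-1) ^ D.horCount (D.vLabel r) *
        |w (D.vLabel r)|) * neg_one_pow_mul_self (D.rowEnd hkn r)
  refine ⟨V, ha.isTotallyNonneg hkn, ?_⟩
  rw [Projectivization.submodule_mk]
  apply le_antisymm
  · rw [Submodule.span_singleton_le_iff_mem]
    exact ⟨hwV, hw⟩
  · rintro x ⟨hxV, hxW⟩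
    rw [Submodule.mem_span_singleton]
    -- The horizontal label of the first interval: subtracting a multiple of `w` kills the component
    -- at `q`, hence the first interval coefficient.
    set q := D.hLabel (Fin.rev ⟨0, by omega⟩) with hq
    have hwq : w q ≠ 0 := hnz _ (D.hLabel_notMem_coloopSet _)
    refine ⟨x q / w q, ?_⟩
    by_contra hne
    set y := x - (x q / w q) • w with hy
    have hy0 : y ≠ 0 := fun h => hne (sub_eq_zero.1 h).symm
    have hyW : y ∈ W := W.sub_mem hxW (W.smul_mem _ hw)
    have hyV : y ∈ Vᗮ := Submodule.sub_mem _ hxV (Submodule.smul_mem _ _ hwV)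
    have hyq : y q = 0 := by
      simp only [hy, PiLp.sub_apply, PiLp.smul_apply, smul_eq_mul]
      rw [div_mul_cancel₀ _ hwq, sub_self]
    refine D.ne_zero_of_blocks hW hkn hyW hy0 ha.nonneg (ha.eq_blockCoeff_mul hkn hyV) ?_
    rw [blockCoeff, dif_pos (show 0 < n - k by omega), ← hq, hyq, zero_div, mul_zero]

end LeDiagram

/-! ### Closures of cells -/

/-- Every nonzero component of `v` has the sign prescribed by `σ`. -/
def Conforms {n : ℕ} (σ : Fin n → SignType) (v : EuclideanSpace ℝ (Fin n)) : Prop :=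
  ∀ i, v i = 0 ∨ SignType.sign (v i) = σ i

theorem isClosed_conforms {n : ℕ} (σ : Fin n → SignType) : IsClosed {v | Conforms σ v} := by
  simp only [Conforms, Set.ofPred_forall]
  refine isClosed_iInter fun i => ?_
  have hc : Continuous fun v : EuclideanSpace ℝ (Fin n) => v i := by fun_prop
  rcases hσ : σ i with _ | _ | _
  · have : {v : EuclideanSpace ℝ (Fin n) | v i = 0 ∨ SignType.sign (v i) = 0} = {v | v i = 0} := by
      ext v
      rw [Set.mem_ofPred_eq, Set.mem_ofPred_eq, sign_eq_zero_iff, or_self]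
    exact this ▸ isClosed_eq hc continuous_const
  · have : {v : EuclideanSpace ℝ (Fin n) | v i = 0 ∨ SignType.sign (v i) = -1} = {v | v i ≤ 0} := by
      ext v
      rw [Set.mem_ofPred_eq, Set.mem_ofPred_eq, sign_eq_neg_one_iff, le_iff_eq_or_lt]
    exact this ▸ isClosed_le hc continuous_const
  · have : {v : EuclideanSpace ℝ (Fin n) | v i = 0 ∨ SignType.sign (v i) = 1} = {v | 0 ≤ v i} := by
      ext v
      rw [Set.mem_ofPred_eq, Set.mem_ofPred_eq, sign_eq_one_iff, le_iff_eq_or_lt, eq_comm]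
    exact this ▸ isClosed_le continuous_const hc

theorem Conforms.smul_pos {n : ℕ} {σ : Fin n → SignType} {v : EuclideanSpace ℝ (Fin n)}
    (h : Conforms σ v) {a : ℝ} (ha : 0 < a) : Conforms σ (a • v) := by
  intro i
  rw [PiLp.smul_apply, smul_eq_mul, sign_mul, sign_pos ha, one_mul]
  exact (h i).imp_left fun h => by rw [h, mul_zero]

theorem Conforms.smul_neg {n : ℕ} {σ : Fin n → SignType} {v : EuclideanSpace ℝ (Fin n)}
    (h : Conforms σ v) {a : ℝ} (ha : a < 0) : Conforms σ (-(a • v)) := by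
  rw [← neg_smul]
  exact h.smul_pos (neg_pos.2 ha)

/-- In the quotient topology this is a condition on nonzero vectors `v`, namely that `v` or `-v`
conforms. -/
theorem isClosed_lines_conforms {n : ℕ} (σ : Fin n → SignType) :
    IsClosed {x : ℙ ℝ (EuclideanSpace ℝ (Fin n)) |
      ∃ (w : EuclideanSpace ℝ (Fin n)) (hw : w ≠ 0), x = Projectivization.mk ℝ w hw ∧
        Conforms σ w} := by
  refine isClosed_coinduced.2 ?_
  have h1 : IsClosed {v : {v : EuclideanSpace ℝ (Fin n) // v ≠ 0} | Conforms σ v} :=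
    (isClosed_conforms σ).preimage continuous_subtype_val
  have h2 : IsClosed {v : {v : EuclideanSpace ℝ (Fin n) // v ≠ 0} | Conforms σ (-v)} :=
    (isClosed_conforms σ).preimage continuous_subtype_val.neg
  convert h1.union h2 using 1
  ext v
  simp only [Set.mem_preimage, Set.mem_ofPred_eq, Set.mem_union]
  constructor
  · rintro ⟨w, hw, hvw, h⟩
    obtain ⟨a, ha⟩ := (Projectivization.mk_eq_mk_iff' ℝ _ _ v.2 hw).1 hvw
    rcases lt_trichotomy a 0 with h0 | h0 | h0
    · exact Or.inr (ha ▸ h.smul_neg h0)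
    · rw [h0, zero_smul] at ha
      exact absurd ha.symm v.2
    · exact Or.inl (ha ▸ h.smul_pos h0)
  · rintro (h | h)
    · exact ⟨v, v.2, rfl, h⟩
    · exact ⟨-v, neg_ne_zero.2 v.2,
        (Projectivization.mk_eq_mk_iff' ℝ _ _ v.2 _).2 ⟨-1, by simp⟩, h⟩

theorem Conforms.add_smul {n : ℕ} {σ : Fin n → SignType} {w u : EuclideanSpace ℝ (Fin n)}
    (h : Conforms σ w) (hu : ∀ i, SignType.sign (u i) = σ i) {ε : ℝ} (hε : 0 < ε) (i : Fin n) :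
    SignType.sign ((w + ε • u) i) = σ i := by
  rw [PiLp.add_apply, PiLp.smul_apply, smul_eq_mul]
  have hu' : SignType.sign (ε * u i) = σ i := by rw [sign_mul, sign_pos hε, one_mul, hu]
  rcases h i with h0 | h0
  · rw [h0, zero_add, hu']
  · rw [← hu'] at h0
    rw [← hu']
    rcases lt_trichotomy (ε * u i) 0 with h1 | h1 | h1
    · rw [sign_neg h1] at h0 ⊢
      rw [sign_eq_neg_one_iff] at h0 ⊢
      linarith
    · rw [h1, sign_zero, sign_eq_zero_iff] at h0
      rw [h1, h0, add_zero]
    · rw [sign_pos h1] at h0 ⊢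
      rw [sign_eq_one_iff] at h0 ⊢
      linarith

section Cells

open LeDiagram

variable {k n : ℕ} {W : Submodule ℝ (EuclideanSpace ℝ (Fin n))} {D E F : LeDiagram k n}

theorem mem_of_mem_amplituhedron {w : EuclideanSpace ℝ (Fin n)} {hw : w ≠ 0}
    (h : Projectivization.mk ℝ w hw ∈ amplituhedron k W) : w ∈ W := by
  obtain ⟨V, -, hV⟩ := h
  rw [Projectivization.submodule_mk] at hV
  have : w ∈ Vᗮ ⊓ W := hV ▸ Submodule.mem_span_singleton_self w
  exact this.2

theorem IsTotallyPositive.lt (hW : IsTotallyPositive (k + 1) W) : k < n := by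
  have := Submodule.finrank_le W
  rw [hW.1, finrank_euclideanSpace_fin] at this
  exact this

/-- Conforming is a closed condition. Conversely, adding a small positive multiple of a vector of
`W` with signs `σ(D)` moves a conforming vector into the cell. -/
theorem mem_closure_cell_iff (hW : IsTotallyPositive (k + 1) W) (x : amplituhedron k W) :
    x ∈ closure (cell W D) ↔ ∃ (w : EuclideanSpace ℝ (Fin n)) (hw : w ≠ 0),
      (x : ℙ ℝ (EuclideanSpace ℝ (Fin n))) = Projectivization.mk ℝ w hw ∧ Conforms D.sigma w := by
  have hkn := hW.lt
  constructor
  · intro h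
    refine closure_minimal (t := Subtype.val ⁻¹' {x | _}) ?_
      ((isClosed_lines_conforms D.sigma).preimage continuous_subtype_val) h
    rintro y ⟨w, hw, -, hy, hs⟩
    exact ⟨w, hw, hy, fun i => Or.inr (hs i)⟩
  · rintro ⟨w, hw, hx, hc⟩
    obtain ⟨u, huW, hu⟩ := exists_sign_eq_sigma hW hkn D
    have hwW : w ∈ W := mem_of_mem_amplituhedron (hx ▸ x.2)
    let S : Set {v : EuclideanSpace ℝ (Fin n) // v ≠ 0} :=
      {v | v.1 ∈ W ∧ ∀ i, SignType.sign (v.1 i) = D.sigma i}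
    have hwS : (⟨w, hw⟩ : {v : EuclideanSpace ℝ (Fin n) // v ≠ 0}) ∈ closure S := by
      rw [closure_subtype]
      have hlim : Filter.Tendsto (fun ε : ℝ => w + ε • u) (nhdsWithin 0 (Set.Ioi 0)) (nhds w) := by
        have : Continuous fun ε : ℝ => w + ε • u := by fun_prop
        have h0 := this.tendsto 0
        simp only [zero_smul, add_zero] at h0
        exact h0.mono_left nhdsWithin_le_nhds
      refine mem_closure_of_tendsto hlim ?_
      filter_upwards [self_mem_nhdsWithin] with ε hε
      have hs := hc.add_smul hu (Set.mem_Ioi.1 hε)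
      exact ⟨⟨_, ne_zero_of_sign_eq_sigma hkn hs⟩, ⟨W.add_mem hwW (W.smul_mem _ huW), hs⟩, rfl⟩
    have hcont : Continuous (Projectivization.mk' ℝ : {v : EuclideanSpace ℝ (Fin n) // v ≠ 0} → _) :=
      continuous_coinduced_rng
    rw [closure_subtype, hx]
    refine map_mem_closure hcont hwS fun v hv => ?_
    exact ⟨⟨_, mem_amplituhedron_of_sign_eq_sigma hW hkn v.2 hv.1 hv.2⟩,
      ⟨v, v.2, hv.1, rfl, hv.2⟩, rfl⟩

/-! ### Adjacency of cells -/

theorem LeDiagram.Shift.two_le {i : Fin n} (h : Shift D E i) (hD : D.IsMaximal) : k + 2 ≤ n := by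
  have h1 := h.horCount_self
  have h2 := i.2
  have h3 := D.horCount_mono (show (i : ℕ) ≤ n - 1 by omega)
  have h4 := D.horCount_lt_of_mem (hD.last_mem_hor (x := n - 1) (by omega))
  omega

/-- The two sign vectors agree off `i` and are opposite at `i`, so a vector conforming to both is
zero at `i`, and then conforms to the signs of `F`. It remains to exclude that the two conforming
representatives of a line are negative multiples of each other. -/
theorem LeDiagram.Shift.meetAlong {i : Fin n} (hW : IsTotallyPositive (k + 1) W) (h : Shift D E i)
    (hD : D.IsMaximal) (hE : E.IsMaximal) (hF : D.IsFacetAt F i) : MeetAlong W D E F := by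
  refine ⟨hF.inClosure, hF.dim_add_one, ?_⟩
  have hsD := hF.sigma_eq hD
  have hsE := hsD.trans (h.update_sigma_eq hD hE)
  have hσ : ∀ j, j ≠ i → F.sigma j = D.sigma j ∧ F.sigma j = E.sigma j := fun j hj => by
    constructor
    · rw [hsD, Function.update_of_ne hj]
    · rw [hsE, Function.update_of_ne hj]
  have hi : F.sigma i = 0 := by rw [hsD, Function.update_self]
  have hiDE : D.sigma i ≠ E.sigma i := by
    rw [hD.sigma_eq, hE.sigma_eq, h.signHat_ne_iff]
  ext x
  rw [Set.mem_inter_iff, mem_closure_cell_iff hW, mem_closure_cell_iff hW, mem_closure_cell_iff hW]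
  constructor
  · rintro ⟨⟨w, hw, hx, hwD⟩, w', hw', hx', hwE⟩
    refine ⟨w, hw, hx, ?_⟩
    have hwW : w ∈ W := mem_of_mem_amplituhedron (hx ▸ x.2)
    obtain ⟨a, rfl⟩ := (Projectivization.mk_eq_mk_iff' ℝ _ _ hw hw').1 (hx.symm.trans hx')
    rcases lt_trichotomy a 0 with h0 | rfl | h0
    · exfalso
      -- A negative ratio makes the components off `i` conform to opposite signs, so they all
      -- vanish; these are `n - 1 ≥ k + 1` zeros, too many for a nonzero vector of `W`.
      have hvan : ∀ j, j ≠ i → (a • w') j = 0 := by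
        intro j hj
        by_contra hne
        have h1 := (hwD j).resolve_left hne
        rw [PiLp.smul_apply, smul_eq_mul, sign_mul, sign_neg h0] at h1
        have h2 : w' j ≠ 0 := fun h => hne (by rw [PiLp.smul_apply, h, smul_zero])
        have h3 := (hwE j).resolve_left h2
        rw [← (hσ j hj).1, (hσ j hj).2, ← h3] at h1
        have h4 := sign_ne_zero.2 h2
        revert h1 h4
        cases SignType.sign (w' j) <;> decide
      obtain ⟨s, hs, hcard⟩ := Finset.exists_subset_card_eq
        (s := (Finset.univ : Finset (Fin n)).erase i) (n := k + 1) (by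
          rw [Finset.card_erase_of_mem (Finset.mem_univ _), Finset.card_univ, Fintype.card_fin]
          have := h.two_le hD
          omega)
      exact hw (hW.eq_zero_of_vanish hwW (s.orderEmbOfFin hcard) fun j =>
        hvan _ (Finset.ne_of_mem_erase (hs (s.orderEmbOfFin_mem hcard j))))
    · exact absurd (zero_smul ℝ w') hw
    · intro j
      have hwE' := hwE.smul_pos h0
      by_cases hj : j = i
      · subst hj
        left
        by_contra hne
        exact hiDE (((hwD j).resolve_left hne).symm.trans ((hwE' j).resolve_left hne))
      · rw [(hσ j hj).1]
        exact hwD j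
  · rintro ⟨w, hw, hx, hwF⟩
    have key : ∀ σ : Fin n → SignType, (∀ j, j ≠ i → F.sigma j = σ j) → Conforms σ w := by
      intro σ hσ j
      rcases hwF j with h0 | h0
      · exact Or.inl h0
      · by_cases hj : j = i
        · subst hj
          rw [hi, sign_eq_zero_iff] at h0
          exact Or.inl h0
        · exact Or.inr (h0.trans (hσ j hj))
    exact ⟨⟨w, hw, hx, key _ fun j hj => (hσ j hj).1⟩, ⟨w, hw, hx, key _ fun j hj => (hσ j hj).2⟩⟩

theorem MeetAlong.symm (h : MeetAlong W D E F) : MeetAlong W E D F :=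
  ⟨h.1, h.2.1, by rw [Set.inter_comm]; exact h.2.2⟩

theorem exists_sign_of_conforms {u w : EuclideanSpace ℝ (Fin n)} {hu : u ≠ 0} {hw : w ≠ 0}
    (h : Projectivization.mk ℝ u hu = Projectivization.mk ℝ w hw) {σ : Fin n → SignType}
    (hc : Conforms σ w) : ∃ ε : SignType, ε ≠ 0 ∧ ∀ i, u i ≠ 0 → SignType.sign (u i) = ε * σ i := by
  obtain ⟨a, rfl⟩ := (Projectivization.mk_eq_mk_iff' ℝ _ _ hu hw).1 h
  refine ⟨SignType.sign a, fun h0 => hu ?_, fun i hi => ?_⟩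
  · rw [sign_eq_zero_iff] at h0
    rw [h0, zero_smul]
  · rw [PiLp.smul_apply, smul_eq_mul] at hi ⊢
    rw [sign_mul, (hc i).resolve_left (right_ne_zero_of_mul hi)]

/-- A vector in the cell of `F` has a single zero, at `i`, and lies on a line in both closures. Its
nonzero components thus have the signs of `D` and of `E` up to global signs, and the comparison of
consecutive components does not see global signs. -/
theorem MeetAlong.exists_shift (hW : IsTotallyPositive (k + 1) W) (hD : D.IsMaximal)
    (hE : E.IsMaximal) (hne : D ≠ E) (h : MeetAlong W D E F) :
    ∃ i : Fin n, (Shift D E i ∧ D.IsFacetAt F i) ∨ (Shift E D i ∧ E.IsFacetAt F i) := by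
  have hkn := hW.lt
  obtain ⟨hF, hdim, hmeet⟩ := h
  obtain ⟨i, hC⟩ : ∃ i, F.coloopSet = {i} := by
    rw [← Set.ncard_eq_one]
    have := hF.dim_add_ncard
    omega
  obtain ⟨u, huW, hu⟩ := exists_sign_eq_sigma hW hkn F
  have hu0 := ne_zero_of_sign_eq_sigma hkn hu
  have hmem := mem_amplituhedron_of_sign_eq_sigma hW hkn hu0 huW hu
  have hcl : (⟨_, hmem⟩ : amplituhedron k W) ∈ closure (cell W F) :=
    subset_closure ⟨u, hu0, huW, rfl, hu⟩
  rw [← hmeet, Set.mem_inter_iff, mem_closure_cell_iff hW, mem_closure_cell_iff hW] at hcl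
  have hne0 : ∀ j, j ≠ i → u j ≠ 0 := fun j hj h0 => by
    have h1 := hu j
    rw [h0, sign_zero, eq_comm, sigma_eq_zero_iff, hC] at h1
    exact hj h1
  have key : ∀ G : LeDiagram k n, G.IsMaximal → (∃ (w : EuclideanSpace ℝ (Fin n)) (hw : w ≠ 0),
      Projectivization.mk ℝ u hu0 = Projectivization.mk ℝ w hw ∧ Conforms G.sigma w) →
      ∃ ε : SignType, ε ≠ 0 ∧ ∀ j, j ≠ i → F.sigma j = ε * G.signHat j := by
    rintro G hG ⟨w, hw, he, hc⟩
    obtain ⟨ε, hε, h⟩ := exists_sign_of_conforms he hc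
    exact ⟨ε, hε, fun j hj => by rw [← hu, h j (hne0 j hj), hG.sigma_eq]⟩
  obtain ⟨ε, hε, hD'⟩ := key D hD hcl.1
  obtain ⟨δ, hδ, hE'⟩ := key E hE hcl.2
  have hhor : ∀ (G : LeDiagram k n) (ε : SignType), ε ≠ 0 →
      (∀ j, j ≠ i → F.sigma j = ε * G.signHat j) → ∀ x (hx : x + 1 < n),
      x ≠ i - 1 → x ≠ i → (x ∈ G.hor ↔ F.sigma ⟨x + 1, hx⟩ = F.sigma ⟨x, by omega⟩) := by
    intro G ε hε hG x hx h1 h2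
    rw [hG ⟨x + 1, hx⟩ (fun h => by
        have := congrArg Fin.val h
        simp only at this
        omega), hG ⟨x, by omega⟩ (fun h => h2 (congrArg Fin.val h)), ← signHat_succ_eq_iff]
    exact (mul_right_inj' hε).symm
  have hagree := agree_of_agree_below hD hE (i := i) fun x hx h1 h2 => by
    rw [hhor D ε hε hD' x hx h1 h2, hhor E δ hδ hE' x hx h1 h2]
  have hne' : D.hor ≠ E.hor := fun h => hne (hD.eq_of_hor_eq hE h)
  -- For `i = 0` the borders could differ only at label `0`, which is impossible for distinct sets
  -- of the same size.
  have hi : 0 < (i : ℕ) := by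
    by_contra hi
    have h1 := hagree 1 (by omega) (by omega)
    rcases shift_or_shift (i := 1) one_pos hne' fun x h2 h3 => hagree x (by omega) (by omega) with
      h | h
    · exact h.left_notMem (h1.2 h.right_mem)
    · exact h.left_notMem (h1.1 h.right_mem)
  have hupd : ∀ (G : LeDiagram k n) (ε : SignType), G.IsMaximal →
      (∀ j, j ≠ i → F.sigma j = ε * G.signHat j) → F.sigma = Function.update G.sigma i 0 := by
    intro G ε hG h
    have h0 := h ⟨0, by omega⟩ (fun h => by
      have := congrArg Fin.val h
      simp only at this
      omega)
    rw [sigma_of_notMem (by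
      rw [hC]
      intro h
      have := congrArg Fin.val (Set.mem_singleton_iff.1 h)
      simp only at this
      omega)] at h0
    -- All sign vectors start with `+`, and the component `0` is not the one set to zero; this fixes
    -- the global sign.
    obtain rfl : ε = 1 := by simpa [signHat] using h0.symm
    funext j
    by_cases hj : j = i
    · rw [hj, Function.update_self, sigma_of_mem (by rw [hC]; rfl)]
    · rw [Function.update_of_ne hj, h j hj, one_mul, hG.sigma_eq]
  refine ⟨i, ?_⟩
  rcases shift_or_shift hi hne' hagree with h | h
  · exact Or.inl ⟨h, isFacetAt_of_sigma_eq hD hF h.left_notMem (hupd D ε hD hD')⟩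
  · exact Or.inr ⟨h, isFacetAt_of_sigma_eq hE hF h.left_notMem (hupd E δ hE hE')⟩

theorem cellsAdjacent_iff (hW : IsTotallyPositive (k + 1) W) (hD : D.IsMaximal)
    (hE : E.IsMaximal) (hne : D ≠ E) :
    CellsAdjacent W D E ↔ ∃ i : Fin n, Shift D E i ∨ Shift E D i := by
  constructor
  · rintro ⟨F, hF⟩
    obtain ⟨i, h⟩ := hF.exists_shift hW hD hE hne
    exact ⟨i, h.imp And.left And.left⟩
  · rintro ⟨i, h | h⟩
    · obtain ⟨F, hF⟩ := h.exists_isFacetAt hD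
      exact ⟨F, h.meetAlong hW hD hE hF⟩
    · obtain ⟨F, hF⟩ := h.exists_isFacetAt hE
      exact ⟨F, (h.meetAlong hW hE hD hF).symm⟩

theorem eq_of_shift {i j : Fin n} (hi : Shift D E i ∨ Shift E D i) (hj : Shift D E j ∨ Shift E D j) :
    i = j := by
  have key : ∀ l : Fin n, Shift D E l ∨ Shift E D l → ∀ x : ℕ, D.signHat x ≠ E.signHat x ↔ x = l := by
    rintro l (h | h) x
    · exact h.signHat_ne_iff x
    · rw [ne_comm]
      exact h.signHat_ne_iff x
  exact Fin.ext ((key j hj i).1 ((key i hi i).2 rfl))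

theorem MeetAlong.eq_of_isFacetAt {G : LeDiagram k n} (hW : IsTotallyPositive (k + 1) W)
    (hD : D.IsMaximal) (hE : E.IsMaximal) (hne : D ≠ E) {i : Fin n} (h : Shift D E i)
    (hF : D.IsFacetAt F i) (hG : MeetAlong W D E G) : G = F := by
  obtain ⟨j, ⟨h1, h2⟩ | ⟨h1, h2⟩⟩ := hG.exists_shift hW hD hE hne
  · obtain rfl := eq_of_shift (Or.inl h) (Or.inl h1)
    exact h2.unique hF
  · obtain rfl := eq_of_shift (Or.inl h) (Or.inr h1)
    exact absurd h1.right_mem h.left_notMem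

end Cells

/-! ### The proposition -/

theorem mainTheorem9 (n k : ℕ) (W : Submodule ℝ (EuclideanSpace ℝ (Fin n)))
    (hW : IsTotallyPositive (k + 1) W) (D₁ D₂ : LeDiagram k n)
    (h₁ : D₁.IsMaximal) (h₂ : D₂.IsMaximal) (hne : D₁ ≠ D₂) :
    List.TFAE [
      CellsAdjacent W D₁ D₂,
      ∃ b, ShapesDifferBy D₁ D₂ b,
      ∃ i, SignsDifferAt D₁ D₂ i,
      ∃ i, PartitionsDifferAt D₁ D₂ i,
      ∃ i, PermsDifferAt D₁ D₂ i] ∧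
    D₁.decoratedPerm.white = ∅ ∧ D₂.decoratedPerm.white = ∅ ∧
    ∀ D', MeetAlong W D₁ D₂ D' →
      (∀ D'', MeetAlong W D₁ D₂ D'' → D'' = D') ∧
      (∀ b, ShapesDifferBy D₁ D₂ b → IsFacetBy D₁ D' b ∧ IsFacetBy D₂ D' b) ∧
      (∀ i, SignsDifferAt D₁ D₂ i →
        D'.sigma = Function.update D₁.sigma i 0 ∧ D'.sigma = Function.update D₂.sigma i 0) ∧
      (∀ i, PartitionsDifferAt D₁ D₂ i →
        TurnsIntoColoop D₁.matroid D'.matroid i ∧ TurnsIntoColoop D₂.matroid D'.matroid i) ∧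
      (∀ i, PermsDifferAt D₁ D₂ i →
        D₁.decoratedPerm.perm * adjSwap n i = adjSwap n (i - 1) * D₂.decoratedPerm.perm ∧
        adjSwap n (i - 1) * D₁.decoratedPerm.perm = D₂.decoratedPerm.perm * adjSwap n i ∧
        Xor (inversions (D₁.decoratedPerm.perm * adjSwap n i) + 1 = k)
          (inversions (adjSwap n (i - 1) * D₁.decoratedPerm.perm) + 1 = k) ∧
        (inversions (D₁.decoratedPerm.perm * adjSwap n i) + 1 = k →
          D'.decoratedPerm.perm = D₁.decoratedPerm.perm * adjSwap n i) ∧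
        (inversions (adjSwap n (i - 1) * D₁.decoratedPerm.perm) + 1 = k →
          D'.decoratedPerm.perm = adjSwap n (i - 1) * D₁.decoratedPerm.perm) ∧
        D'.decoratedPerm.white = {i}) := by
  have hkn := hW.lt
  refine ⟨?_, h₁.white_eq, h₂.white_eq, fun D' hD' => ?_⟩
  · have e1 := cellsAdjacent_iff hW h₁ h₂ hne
    have e2 := LeDiagram.exists_shapesDifferBy_iff (D := D₁) (E := D₂)
    have e3 := exists_congr (LeDiagram.signsDifferAt_iff h₁ h₂ hne)
    have e4 := exists_congr (LeDiagram.partitionsDifferAt_iff h₁ h₂ hne)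
    have e5 := exists_congr (LeDiagram.permsDifferAt_iff h₁ h₂ hne)
    tfae_have 1 ↔ 2 := e1.trans e2.symm
    tfae_have 1 ↔ 3 := e1.trans e3.symm
    tfae_have 1 ↔ 4 := e1.trans e4.symm
    tfae_have 1 ↔ 5 := e1.trans e5.symm
    tfae_finish
  have hperm : ∀ i : Fin n, PermsDifferAt D₁ D₂ i →
      D₁.decoratedPerm.perm * adjSwap n i = adjSwap n (i - 1) * D₂.decoratedPerm.perm ∧
      adjSwap n (i - 1) * D₁.decoratedPerm.perm = D₂.decoratedPerm.perm * adjSwap n i := by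
    rintro i ⟨-, h⟩
    constructor
    · rw [h, ← mul_assoc, ← mul_assoc, adjSwap_mul_self, one_mul]
    · rw [h, mul_assoc, adjSwap_mul_self, mul_one]
  obtain ⟨i, ⟨hs, hF⟩ | ⟨hs, hF⟩⟩ := hD'.exists_shift hW h₁ h₂ hne
  · refine ⟨fun D'' h'' => h''.eq_of_isFacetAt hW h₁ h₂ hne hs hF, fun b hb => hs.isFacetBy h₁ h₂ hF hb,
      fun j hj => ?_, fun j hj => ?_, fun j hj => ?_⟩
    · obtain rfl := eq_of_shift (Or.inl hs) ((LeDiagram.signsDifferAt_iff h₁ h₂ hne j).1 hj)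
      have := hF.sigma_eq h₁
      exact ⟨this, this.trans (hs.update_sigma_eq h₁ h₂)⟩
    · obtain rfl := eq_of_shift (Or.inl hs) ((LeDiagram.partitionsDifferAt_iff h₁ h₂ hne j).1 hj)
      exact ⟨hF.turnsIntoColoop h₁ hkn, hs.turnsIntoColoop h₁ h₂ hF hkn⟩
    · obtain rfl := eq_of_shift (Or.inl hs) ((LeDiagram.permsDifferAt_iff h₁ h₂ hne j).1 hj)
      obtain ⟨p1, p2⟩ := hperm i hj
      obtain ⟨q1, q2⟩ := hs.inversions_eq h₁
      obtain ⟨r1, r2⟩ := hs.facet_perm h₁ hF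
      exact ⟨p1, p2, Or.inl ⟨q1, by omega⟩, fun _ => r1, fun h => by omega, r2⟩
  · refine ⟨fun D'' h'' => h''.symm.eq_of_isFacetAt hW h₂ h₁ hne.symm hs hF,
      fun b hb => (hs.isFacetBy h₂ h₁ hF (LeDiagram.shapesDifferBy_symm hb)).symm,
      fun j hj => ?_, fun j hj => ?_, fun j hj => ?_⟩
    · obtain rfl := eq_of_shift (Or.inr hs) ((LeDiagram.signsDifferAt_iff h₁ h₂ hne j).1 hj)
      have := hF.sigma_eq h₂
      exact ⟨this.trans (hs.update_sigma_eq h₂ h₁), this⟩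
    · obtain rfl := eq_of_shift (Or.inr hs) ((LeDiagram.partitionsDifferAt_iff h₁ h₂ hne j).1 hj)
      exact ⟨hs.turnsIntoColoop h₂ h₁ hF hkn, hF.turnsIntoColoop h₂ hkn⟩
    · obtain rfl := eq_of_shift (Or.inr hs) ((LeDiagram.permsDifferAt_iff h₁ h₂ hne j).1 hj)
      obtain ⟨p1, p2⟩ := hperm i hj
      obtain ⟨q1, q2⟩ := hs.inversions_eq h₂
      obtain ⟨r1, r2⟩ := hs.facet_perm h₂ hF
      -- Here the shift goes from `D₂` to `D₁`. The exchange identities rewrite the products with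
      -- `π(D₂)` in terms of `π(D₁)`, and now the left product is the one with `k - 1` inversions.
      rw [← p2] at q1 r1
      rw [← p1] at q2
      exact ⟨p1, p2, Or.inr ⟨q1, by omega⟩, fun h => by omega, fun _ => r1, r2⟩
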